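/- **Setting.** Let $X$ be a smooth 4-dimensional Riemannian manifold (Hausdorff, second countable, without boundary, not necessarily compact or complete), with Riemannian volume measure. Let $\mathcal V\to X$ be a smooth finite-rank Euclidean vector bundle (for instance a unitary bundle, regarded as a real bundle) with a smooth Clifford multiplication $\rho\in\mathrm{Hom}(TX,\mathrm{End}\,\mathcal V)$ satisfying $\rho(e)^2=-\|e\|^2\,\mathrm{id}$ and $\|\rho(e)u\|=\|e\|\,\|u\|$, and a smooth connection $\nabla$ with $\nabla_e(\rho(e')u)=\rho(\nabla_e e')u+\rho(e')\nabla_e u$, where $\nabla_e e'$ is the Levi-Civita derivative. The Dirac operator is $D(u)=\sum_{i=1}^4\rho(e_i)\nabla_{e_i}u$ for a local orthonormal frame $(e_i)$. A 2-valued section $U$ of $\mathcal V$ assigns to each $x\in X$ an unordered pair $U(x)=[\![u_1]\!]+[\![u_2]\!]$ of elements of $\mathcal V|_x$. The distance between $[\![a]\!]+[\![b]\!]$ and $[\![c]\!]+[\![d]\!]$ is $\min\big(\sqrt{|a-c|^2+|b-d|^2},\sqrt{|a-d|^2+|b-c|^2}\big)$, and $|U|=\mathrm{dist}(U,2[\![0]\!])$.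 Continuity is understood in local trivializations. $U$ is smooth if it is locally $[\![f]\!]+[\![g]\!]$ with smooth sections $f,g$, and odd if $U=-U$. A continuous 2-valued section $U$ is a $\mathbb Z/2$ harmonic spinor if, with $Z=\{x: U(x)=2[\![0]\!]\}$: (i) $Z\ne X$; (ii) near every $x\in X\setminus Z$ one has $U=[\![u]\!]+[\![-u]\!]$ with a smooth section $u$ satisfying $D(u)=0$; (iii) $\int_{X\setminus Z}|\nabla u|^2<\infty$. **Sobolev notions.** For $\Omega\subset\mathbb R^4$ open and a Euclidean space $F$, a map $f:\Omega\to\mathcal A_2(F)$ to unordered pairs belongs to Almgren's space $W^{1,2}(\Omega,\mathcal A_2)$ if $|f|\in L^2(\Omega)$ and there are $\varphi_1,\dots,\varphi_4\in L^2(\Omega)$ such that for every $T\in\mathcal A_2(F)$ the function $\mathrm{dist}(f,T)$ has distributional partial derivatives with $|\partial_j\,\mathrm{dist}(f,T)|\le\varphi_j$ a.e. A 2-valued section of $\mathcal V$ is of class $W^{1,2}$ locally on an open set $\Omega\subset X$ if it is so in a chart and local trivialization near each point of $\Omega$. Its distributional derivative is the approximate covariant derivative: at almost every $x$ there are sections $\sigma_1,\sigma_2$,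 differentiable at $x$, with $U(x)=[\![\sigma_1(x)]\!]+[\![\sigma_2(x)]\!]$, with $\nabla\sigma_1(x)=\nabla\sigma_2(x)$ if $\sigma_1(x)=\sigma_2(x)$, and with $\mathrm{dist}(U(y),[\![\sigma_1(y)]\!]+[\![\sigma_2(y)]\!])=o(|y-x|)$ as $y\to x$ within a measurable set of density one at $x$ (in coordinates). The weak 1-jet of $U$ at $x$ is the unordered pair of the $(\sigma_i(x),\nabla\sigma_i(x))$; one puts $\nabla U=\sum_i[\![\nabla\sigma_i]\!]$, $|\nabla U|^2=\sum_i|\nabla\sigma_i|^2$ and $D(U)=\sum_i[\![\sum_k\rho(e_k)\nabla_{e_k}\sigma_i]\!]$. For open $\Omega\subset X$, $U\in W^{1,2}(\Omega,\mathcal A_2)$ means that $U$ is locally of class $W^{1,2}$ on $\Omega$, that it has a weak 1-jet a.e. on $\Omega$, and that $\int_\Omega|U|^2<\infty$ and $\int_\Omega|\nabla U|^2<\infty$. **Statement.** Let $U$ be a $\mathbb Z/2$ harmonic spinor. Then: 1. $U\in W^{1,2}(\Omega,\mathcal A_2)$ for every open $\Omega\subset X$ that is relatively compact or satisfies $\int_\Omega|U|^2<\infty$.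 In particular $U\in W^{1,2}(X,\mathcal A_2)$ if $X$ is compact or, more generally, if $|U|\in L^2(X)$. 2. $U$ is locally of class $W^{1,2}$ on $X$, its distributional derivative satisfies $\int_X|\nabla U|^2<\infty$, and $D(U)=0$ in the distributional sense, i.e. $D(U)=2[\![0]\!]$ almost everywhere on $X$ for $D$ applied to the distributional derivative of $U$. 3. There are smooth odd 2-valued sections $U_n$ of $\mathcal V$, locally of class $W^{1,2}$, that converge to $U$ strongly in $W^{1,2}$: the distances between the weak 1-jets of $U_n$ and $U$ (the distance of unordered pairs formed with $|(v,L)|^2=|v|^2+|L|^2$) tend to $0$ in $L^2(X)$. -/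

import Mathlib

open Set Filter Topology MeasureTheory Manifold Bundle
open scoped ENNReal ContDiff

noncomputable section

namespace ZTwoSpinor

/-- The model space of the 4-dimensional manifolds. -/
abbrev R4 : Type := EuclideanSpace ℝ (Fin 4)

/-! ### Unordered pairs

`Sym2 W` is the set of unordered pairs of points of `W`, written `s(a, b)` for `[[a]] + [[b]]`. -/

/-- For a "squared length" `q` on `W`, the squared matching distance
`min (q (a - c) + q (b - d)) (q (a - d) + q (b - c))`
between the unordered pairs `s(a, b)` and `s(c, d)`. -/
def pairDistSq {W : Type*} [AddCommGroup W] (q : W → ℝ) : Sym2 W → Sym2 W → ℝ :=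
  Sym2.lift₂ ⟨fun a b c d => min (q (a - c) + q (b - d)) (q (a - d) + q (b - c)), by
    intro a b c d
    refine ⟨?_, ?_⟩
    · dsimp only
      rw [min_comm, add_comm (q (a - d)), add_comm (q (a - c))]
    · dsimp only
      rw [min_comm]⟩

/-- The distance on the space `A_2(W)` of unordered pairs of vectors. -/
def pairDist {W : Type*} [NormedAddCommGroup W] (S T : Sym2 W) : ℝ :=
  Real.sqrt (pairDistSq (fun w => ‖w‖ ^ 2) S T)

/-- `|T|`, the distance from `T` to `2[[0]]`. -/
def pairNorm {W : Type*} [NormedAddCommGroup W] (T : Sym2 W) : ℝ :=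
  pairDist T s(0, 0)

/-! ### 2-valued Sobolev functions on open sets of `ℝ⁴` -/

/-- On the open set `Ω`, the function `h` is locally integrable and has the locally integrable
function `g` as distributional partial derivative in the `j`-th direction. -/
def HasWeakPartial (Ω : Set R4) (j : Fin 4) (h g : R4 → ℝ) : Prop :=
  LocallyIntegrableOn h Ω ∧ LocallyIntegrableOn g Ω ∧
    ∀ ψ : R4 → ℝ, ContDiff ℝ ∞ ψ → HasCompactSupport ψ → tsupport ψ ⊆ Ω →
      ∫ y in Ω, h y * fderiv ℝ ψ y (EuclideanSpace.single j 1) = - ∫ y in Ω, g y * ψ y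

/-- The Almgren Sobolev space `W^{1,2}(Ω, A_2(F))`: `|f|` is square integrable, and there are
square integrable functions `φ_j` such that, for every `T` in `A_2(F)`, the function
`dist (f, T)` has distributional partial derivatives with `|∂_j dist (f, T)| ≤ φ_j`. -/
def MemW12Euclidean {F : Type*} [NormedAddCommGroup F] (Ω : Set R4) (f : R4 → Sym2 F) : Prop :=
  MemLp (fun y => pairNorm (f y)) 2 (volume.restrict Ω) ∧
    ∃ φ : Fin 4 → R4 → ℝ, (∀ j, MemLp (φ j) 2 (volume.restrict Ω)) ∧
      ∀ T : Sym2 F, ∃ g : Fin 4 → R4 → ℝ, ∀ j,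
        HasWeakPartial Ω j (fun y => pairDist (f y) T) (g j) ∧
        ∀ᵐ y ∂(volume.restrict Ω), |g j y| ≤ φ j y

/-! ### The Riemannian volume measure -/

section Volume

variable (X : Type*) [TopologicalSpace X] [ChartedSpace R4 X]
  [RiemannianBundle (fun x : X => TangentSpace (𝓡 4) x)]

/-- The matrix of the metric in the chart around `p`, at the point with coordinates `y`. -/
def gram (p : X) (y : R4) : Matrix (Fin 4) (Fin 4) ℝ :=
  Matrix.of fun i j =>
    inner ℝ
      (mfderiv 𝓘(ℝ, R4) (𝓡 4) (chartAt R4 p).symm y (EuclideanSpace.single i 1) :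
        TangentSpace (𝓡 4) ((chartAt R4 p).symm y))
      (mfderiv 𝓘(ℝ, R4) (𝓡 4) (chartAt R4 p).symm y (EuclideanSpace.single j 1) :
        TangentSpace (𝓡 4) ((chartAt R4 p).symm y))

/-- The volume measure `√(det g) dy` of the domain of the chart around `p`, extended by zero. -/
def chartVolume [MeasurableSpace X] (p : X) : Measure X :=
  Measure.map (chartAt R4 p).symm
    ((volume.withDensity fun y => ENNReal.ofReal (Real.sqrt (gram X p y).det)).restrict
      (chartAt R4 p).target)

/-- The Riemannian volume measure. The measures `chartVolume X p` agree on overlaps of chart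
domains; their least upper bound is the measure that restricts to each of them. -/
def riemannianVolume [MeasurableSpace X] : Measure X :=
  ⨆ p : X, chartVolume X p

end Volume

/-! ### Clifford bundles, 2-valued sections and their derivatives -/

section Bundles

variable {X : Type*} [TopologicalSpace X] [ChartedSpace R4 X] [IsManifold (𝓡 4) ∞ X]
  [RiemannianBundle (fun x : X => TangentSpace (𝓡 4) x)]
  [IsContMDiffRiemannianBundle (𝓡 4) ∞ R4 (fun x : X => TangentSpace (𝓡 4) x)]
  {F : Type*} [NormedAddCommGroup F] [InnerProductSpace ℝ F]
  {V : X → Type*} [TopologicalSpace (TotalSpace F V)]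
  [∀ x, NormedAddCommGroup (V x)] [∀ x, InnerProductSpace ℝ (V x)]
  [FiberBundle F V] [VectorBundle ℝ F V]

variable (F) in
/-- `u` is a smooth section of `V` on the set `N`. -/
def SmoothOn (u : Π x, V x) (N : Set X) : Prop :=
  ContMDiffOn (𝓡 4) ((𝓡 4).prod 𝓘(ℝ, F)) ∞ (fun x => (⟨x, u x⟩ : TotalSpace F V)) N

set_option synthInstance.maxHeartbeats 200000 in
variable (X F V) in
/-- A Clifford multiplication `ρ` on the Euclidean vector bundle `V → X`, the Levi-Civita
connection of `X` (the connection on `TX` that is metric and torsion free), and a smooth connection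
on `V` compatible with `ρ`. -/
structure CliffordStructure where
  /-- Clifford multiplication. -/
  ρ : Π x : X, TangentSpace (𝓡 4) x →L[ℝ] V x →L[ℝ] V x
  smooth_ρ : ContMDiff (𝓡 4) ((𝓡 4).prod 𝓘(ℝ, R4 →L[ℝ] F →L[ℝ] F)) ∞
    (fun x => TotalSpace.mk' (R4 →L[ℝ] F →L[ℝ] F)
      (E := fun x : X => TangentSpace (𝓡 4) x →L[ℝ] V x →L[ℝ] V x) x (ρ x))
  ρ_sq : ∀ (x : X) (e : TangentSpace (𝓡 4) x) (v : V x), ρ x e (ρ x e v) = -(‖e‖ ^ 2 • v)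
  norm_ρ : ∀ (x : X) (e : TangentSpace (𝓡 4) x) (v : V x), ‖ρ x e v‖ = ‖e‖ * ‖v‖
  /-- The Levi-Civita connection. -/
  leviCivita : CovariantDerivative (𝓡 4) R4 (fun x : X => TangentSpace (𝓡 4) x)
  leviCivita_metric : leviCivita.IsMetricCompatible
  leviCivita_torsion : leviCivita.torsion = 0
  /-- The connection on `V`; `conn u x e` is `∇_e u` at `x`. -/
  conn : CovariantDerivative (𝓡 4) F V
  smooth_conn : CovariantDerivative.ContMDiffCovariantDerivative conn ∞
  compatible : ∀ (e' : Π x : X, TangentSpace (𝓡 4) x) (u : Π x, V x),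
    ContMDiff (𝓡 4) ((𝓡 4).prod 𝓘(ℝ, R4)) ∞
      (fun x => (⟨x, e' x⟩ : TotalSpace R4 (fun x : X => TangentSpace (𝓡 4) x))) →
    SmoothOn F u univ →
    ∀ (x : X) (e : TangentSpace (𝓡 4) x),
      conn (fun y => ρ y (e' y) (u y)) x e
        = ρ x (leviCivita e' x e) (u x) + ρ x (e' x) (conn u x e)

/-- `∑ ‖L e_i‖²` for an orthonormal basis `e_i` of the tangent space. -/
def derivNormSq {x : X} (L : TangentSpace (𝓡 4) x →L[ℝ] V x) : ℝ :=
  haveI : FiniteDimensional ℝ (TangentSpace (𝓡 4) x) := inferInstanceAs (FiniteDimensional ℝ R4)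
  ∑ i, ‖L (stdOrthonormalBasis ℝ (TangentSpace (𝓡 4) x) i)‖ ^ 2

/-- The Dirac symbol `∑ ρ(e_i) L(e_i)`, so that `D u = dirac C (∇ u)`. -/
def dirac (C : CliffordStructure X F V) {x : X} (L : TangentSpace (𝓡 4) x →L[ℝ] V x) : V x :=
  haveI : FiniteDimensional ℝ (TangentSpace (𝓡 4) x) := inferInstanceAs (FiniteDimensional ℝ R4)
  ∑ i, C.ρ x (stdOrthonormalBasis ℝ (TangentSpace (𝓡 4) x) i)
    (L (stdOrthonormalBasis ℝ (TangentSpace (𝓡 4) x) i))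

variable (F) in
/-- The 2-valued section `U`, read in the local trivialization of `V` around `p`. -/
def inTrivialization (U : Π x, Sym2 (V x)) (p x : X) : Sym2 F :=
  (U x).map ((trivializationAt F V p).continuousLinearMapAt ℝ x)

variable (F) in
/-- Continuity of a 2-valued section in local trivializations. -/
def ContinuousSection (U : Π x, Sym2 (V x)) : Prop :=
  ∀ p : X, Tendsto (fun x => pairDist (inTrivialization F U p x) (inTrivialization F U p p))
    (𝓝 p) (𝓝 0)

/-- The zero locus of a 2-valued section. -/
def zeroLocus (U : Π x, Sym2 (V x)) : Set X := {x | U x = s(0, 0)}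

variable (F) in
/-- On the open neighbourhood `N` of `x`, the 2-valued section `U` is `[[u]] + [[-u]]` with a smooth
section `u`. -/
def IsLift (U : Π x, Sym2 (V x)) (u : Π x, V x) (N : Set X) (x : X) : Prop :=
  IsOpen N ∧ x ∈ N ∧ SmoothOn F u N ∧ ∀ y ∈ N, U y = s(u y, -u y)

/-- The function `|∇u|²` off the zero locus, where `U` is locally `[[u]] + [[-u]]`; all local lifts
`u` give the same value. -/
def energyDensity (C : CliffordStructure X F V) (U : Π x, Sym2 (V x)) (x : X) : ℝ≥0∞ :=
  ⨆ (u : Π x, V x) (N : Set X) (_ : IsLift F U u N x), ENNReal.ofReal (derivNormSq (C.conn u x))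

/-- `Z/2` harmonic spinors. -/
structure IsZTwoHarmonicSpinor [MeasurableSpace X] (C : CliffordStructure X F V)
    (U : Π x, Sym2 (V x)) : Prop where
  continuousSection : ContinuousSection F U
  not_zero : ∃ x, U x ≠ s(0, 0)
  exists_lift : ∀ x ∉ zeroLocus U, ∃ (u : Π x, V x) (N : Set X),
    IsLift F U u N x ∧ ∀ y ∈ N, dirac C (C.conn u y) = 0
  finite_energy : ∫⁻ x in (zeroLocus U)ᶜ, energyDensity C U x ∂(riemannianVolume X) < ⊤

variable (F) in
/-- Smooth 2-valued sections. -/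
def SmoothSection (U : Π x, Sym2 (V x)) : Prop :=
  ∀ x, ∃ (f g : Π x, V x) (N : Set X), IsOpen N ∧ x ∈ N ∧ SmoothOn F f N ∧ SmoothOn F g N ∧
    ∀ y ∈ N, U y = s(f y, g y)

/-- `U = -U`. -/
def OddSection (U : Π x, Sym2 (V x)) : Prop := ∀ x, (U x).map (fun v => -v) = U x

/-- The set `S` is measurable and has Lebesgue density one at `x`, read in the chart `φ`. -/
def DensityOne [MeasurableSpace X] (φ : OpenPartialHomeomorph X R4) (S : Set X) (x : X) : Prop :=
  MeasurableSet S ∧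
    Tendsto (fun r : ℝ => volume ((φ.target ∩ φ.symm ⁻¹' S) ∩ Metric.closedBall (φ x) r)
      / volume (Metric.closedBall (φ x) r)) (𝓝[>] 0) (𝓝 1)

/-- Approximate differentiability of a 2-valued section `U` at `x`, with 1-jet
`s((u₁, ∇u₁), (u₂, ∇u₂))`. There are sections `σ` and `τ`, differentiable at `x`, such that
`U x = s(σ x, τ x)`, such that `dist (U y, s(σ y, τ y)) = o(|y - x|)` as `y` tends to `x` in a set
of density one at `x`, and such that `∇σ = ∇τ` at `x` if `σ x = τ x`; the jet is made of the values
and covariant derivatives of `σ` and `τ` at `x`. The notion does not depend on the chart. -/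
def HasApproxJet [MeasurableSpace X] (C : CliffordStructure X F V) (U : Π x, Sym2 (V x)) (x : X)
    (j : Sym2 (V x × (TangentSpace (𝓡 4) x →L[ℝ] V x))) : Prop :=
  ∃ σ τ : Π y, V y,
    MDifferentiableAt (𝓡 4) ((𝓡 4).prod 𝓘(ℝ, F)) (fun y => (⟨y, σ y⟩ : TotalSpace F V)) x ∧
    MDifferentiableAt (𝓡 4) ((𝓡 4).prod 𝓘(ℝ, F)) (fun y => (⟨y, τ y⟩ : TotalSpace F V)) x ∧
    U x = s(σ x, τ x) ∧
    j = s((σ x, C.conn σ x), (τ x, C.conn τ x)) ∧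
    (σ x = τ x → C.conn σ x = C.conn τ x) ∧
    ∃ φ ∈ atlas R4 X, x ∈ φ.source ∧ ∃ S : Set X, DensityOne φ S x ∧
      (fun y => pairDist (U y) s(σ y, τ y)) =o[𝓝[S] x] (fun y => ‖φ y - φ x‖)

variable (F) in
/-- In charts and local trivializations, `U` is a 2-valued function of class `W^{1,2}` near every
point of `Ω`. -/
def LocallyW12 (Ω : Set X) (U : Π x, Sym2 (V x)) : Prop :=
  ∀ p ∈ Ω, ∃ O : Set R4, IsOpen O ∧ chartAt R4 p p ∈ O ∧ O ⊆ (chartAt R4 p).target ∧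
    (∀ y ∈ O, (chartAt R4 p).symm y ∈ Ω ∩ (trivializationAt F V p).baseSet) ∧
    MemW12Euclidean O (fun y => inTrivialization F U p ((chartAt R4 p).symm y))

/-- `U` is locally of class `W^{1,2}` on the open set `Ω`, and its first jet (its values together
with its distributional covariant derivative, which for 2-valued Sobolev functions is the
approximate derivative, existing almost everywhere) is `J`. -/
def HasWeakJet [MeasurableSpace X] (C : CliffordStructure X F V) (Ω : Set X) (U : Π x, Sym2 (V x))
    (J : Π x, Sym2 (V x × (TangentSpace (𝓡 4) x →L[ℝ] V x))) : Prop :=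
  LocallyW12 F Ω U ∧ ∀ᵐ x ∂((riemannianVolume X).restrict Ω), HasApproxJet C U x (J x)

/-- The squared length `|v|² + |L|²` of a pair `(v, L)`. -/
def jetSq {x : X} (w : V x × (TangentSpace (𝓡 4) x →L[ℝ] V x)) : ℝ :=
  ‖w.1‖ ^ 2 + derivNormSq w.2

/-- `|∇U|² = |∇u₁|² + |∇u₂|²` for the jet `s((u₁, ∇u₁), (u₂, ∇u₂))`. -/
def gradSq {x : X} (j : Sym2 (V x × (TangentSpace (𝓡 4) x →L[ℝ] V x))) : ℝ :=
  pairDistSq derivNormSq (j.map Prod.snd) s(0, 0)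

/-- The Sobolev space `W^{1,2}(Ω, A_2)` of 2-valued sections of `V` on an open set `Ω` of `X`. -/
def MemW12 [MeasurableSpace X] (C : CliffordStructure X F V) (Ω : Set X)
    (U : Π x, Sym2 (V x)) : Prop :=
  ∫⁻ x in Ω, ENNReal.ofReal (pairNorm (U x) ^ 2) ∂(riemannianVolume X) < ⊤ ∧
    ∃ J : Π x, Sym2 (V x × (TangentSpace (𝓡 4) x →L[ℝ] V x)),
      HasWeakJet C Ω U J ∧
      ∫⁻ x in Ω, ENNReal.ofReal (gradSq (J x)) ∂(riemannianVolume X) < ⊤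

/-- Strong convergence in `W^{1,2}(X, A_2)`: the matching distances of the first jets tend to zero
in `L²`. -/
def TendstoW12 [MeasurableSpace X] (C : CliffordStructure X F V) (Un : ℕ → Π x, Sym2 (V x))
    (U : Π x, Sym2 (V x)) : Prop :=
  ∃ (Jn : ℕ → Π x, Sym2 (V x × (TangentSpace (𝓡 4) x →L[ℝ] V x)))
    (J : Π x, Sym2 (V x × (TangentSpace (𝓡 4) x →L[ℝ] V x))),
    (∀ n, HasWeakJet C univ (Un n) (Jn n)) ∧ HasWeakJet C univ U J ∧
    Tendsto (fun n => ∫⁻ x, ENNReal.ofReal (pairDistSq jetSq (Jn n x) (J x)) ∂(riemannianVolume X))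
      atTop (𝓝 0)

end Bundles

end ZTwoSpinor

end

/-! Off the zero locus Z everything is smooth: locally U = [[u]] + [[-u]], and u is unique up to
sign. All the difficulty sits on Z, about whose size and regularity nothing is known. Three
observations replace such knowledge.

Weak differentiability. For a fixed pair T the function h = dist(U, T), read in a chart, is constant
on Z, with value c₀ = dist(2[[0]], T). Hence wherever h differs from c₀ there is a smooth lift, h is
locally Lipschitz, and its partial derivatives are bounded by those of u, which the finite energy
makes square integrable. Soft thresholding of h - c₀ at height ε gives a function that is constant
near the level set {h = c₀} and Lipschitz on compact sets. Integration by parts holds for it, and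
dominated convergence as ε → 0 gives it for h (`exists_hasWeakPartial`,
`locallyW12_of_finite_energy`). The domination comes from covariant derivatives, which are compared
with partial derivatives in `eventually_norm_mvfderiv_localRep_le`.

The derivative on Z. By Lebesgue's density theorem almost every point of Z is a density point of Z,
and there the zero section approximates U along Z. So the 1-jet of U is that of ±u off Z and zero
almost everywhere on Z (`ae_hasApproxJet_zero`, `ae_hasApproxJet_liftJet`). It follows that |∇U|²
has finite integral over X, and that D(U) = 0, since D(u) = 0 off Z and the jet is zero on Z.

Approximation. Let χ be a smooth cutoff, 0 up to 1 and 1 from 2 on, and truncate by values: U_s =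
χ(s²|u|²/ε²) U, with a positive smooth function ε. Near Z the factor vanishes, so U_s is smooth and
odd. Differentiating the factor produces |u| |d(s²|u|²/ε²)|; on the region s²|u|² ≤ 2ε², which
contains all points where U_s differs from U, this is at most a constant times |∇u| plus an error of
order 1/s (`norm_mul_abs_mvfderiv_truncRatio_le`). Thus no information on the distance to Z is
needed. As s → ∞ these regions, taken off Z, decrease to the empty set, so the energy of U on them
tends to 0.

Since X may be noncompact and the connection need not be metric, ε is chosen so small that ε, dε and
ε times the failure of metricity are dominated by one integrable function m ≤ 1
(`exists_smooth_pos_dominated`). This makes U_s - U square integrable even when U is not. -/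

noncomputable section

set_option linter.unusedSectionVars false

namespace ZTwoSpinor

/-! ### Weak derivatives of functions that are Lipschitz off a level set -/

/-- The soft threshold `t ↦ sign t * max (|t| - ε) 0`. -/
def softThreshold (ε t : ℝ) : ℝ := t - max (-ε) (min ε t)

lemma abs_softThreshold_sub_le {ε : ℝ} (s t : ℝ) :
    |softThreshold ε s - softThreshold ε t| ≤ |s - t| := by
  unfold softThreshold
  rcases abs_cases (s - t) with h | h <;>
  rcases min_cases ε s with h1 | h1 <;> rcases min_cases ε t with h2 | h2 <;>
  rcases max_cases (-ε) (min ε s) with h3 | h3 <;> rcases max_cases (-ε) (min ε t) with h4 | h4 <;>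
  rw [abs_le] <;> constructor <;> linarith

lemma softThreshold_of_abs_le {ε t : ℝ} (h : |t| ≤ ε) : softThreshold ε t = 0 := by
  rw [abs_le] at h
  simp [softThreshold, min_eq_right h.2, max_eq_right h.1]

lemma softThreshold_of_lt {ε t : ℝ} (hε : 0 ≤ ε) (h : ε < t) : softThreshold ε t = t - ε := by
  simp [softThreshold, min_eq_left h.le, max_eq_right (show -ε ≤ ε by linarith)]

lemma softThreshold_of_lt_neg {ε t : ℝ} (hε : 0 ≤ ε) (h : t < -ε) :
    softThreshold ε t = t + ε := by
  simp [softThreshold, min_eq_right (show t ≤ ε by linarith), max_eq_left h.le]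

lemma abs_softThreshold_sub_self_le {ε : ℝ} (hε : 0 ≤ ε) (t : ℝ) :
    |softThreshold ε t - t| ≤ ε := by
  unfold softThreshold
  rcases min_cases ε t with h1 | h1 <;> rcases max_cases (-ε) (min ε t) with h3 | h3 <;>
  rw [abs_le] <;> constructor <;> linarith

section SoftThreshold

variable {c : R4} {r : ℝ} {h : R4 → ℝ} {c₀ : ℝ}

/-- Near a point of the level set the thresholded function is constant by continuity of `h`;
elsewhere it inherits the local Lipschitz constant of `h`, since thresholding is 1-Lipschitz.
Compactness of the ball makes the constant uniform. -/
lemma exists_lipschitzOnWith_softThreshold (hc : ContinuousOn h (Metric.closedBall c r))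
    (hL : ∀ y ∈ Metric.closedBall c r, h y ≠ c₀ → ∃ K, ∃ t ∈ 𝓝[Metric.closedBall c r] y,
      LipschitzOnWith K h t) {ε : ℝ} (hε : 0 < ε) :
    ∃ K, LipschitzOnWith K (fun y => softThreshold ε (h y - c₀) + c₀)
      (Metric.closedBall c r) := by
  apply LocallyLipschitzOn.exists_lipschitzOnWith_of_compact (isCompact_closedBall c r)
  intro y hy
  by_cases hy0 : h y = c₀
  · refine ⟨0, Metric.closedBall c r ∩ {y' | |h y' - c₀| < ε}, ?_, ?_⟩
    · have : ContinuousWithinAt (fun y' => |h y' - c₀|) (Metric.closedBall c r) y :=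
        ((hc y hy).sub continuousWithinAt_const).abs
      refine inter_mem self_mem_nhdsWithin (this.eventually_lt_const ?_)
      simpa [hy0] using hε
    · refine LipschitzOnWith.of_dist_le_mul fun a ha b hb => ?_
      simp [softThreshold_of_abs_le ha.2.le, softThreshold_of_abs_le hb.2.le]
  · obtain ⟨K, t, ht, hK⟩ := hL y hy hy0
    refine ⟨K, t, ht, LipschitzOnWith.of_dist_le_mul fun a ha b hb => ?_⟩
    have := hK.dist_le_mul a ha b hb
    rw [Real.dist_eq] at this ⊢
    calc _ = |softThreshold ε (h a - c₀) - softThreshold ε (h b - c₀)| := by congr 1; ring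
      _ ≤ |(h a - c₀) - (h b - c₀)| := abs_softThreshold_sub_le _ _
      _ = |h a - h b| := by congr 1; ring
      _ ≤ _ := this

/-- Once `ε n < |h y - c₀|`, the thresholded function is a translate of `h` near `y`. No
differentiability of `h` enters: adding a constant does not change `lineDeriv`, whatever its value.
-/
lemma lineDeriv_softThreshold_eventually_eq (hc : ContinuousOn h (Metric.closedBall c r)) {y : R4}
    (hy : y ∈ Metric.ball c r) (v : R4) {ε : ℕ → ℝ} (hε : ∀ n, 0 < ε n)
    (hε' : Tendsto ε atTop (𝓝 0)) :
    ∀ᶠ n in atTop, lineDeriv ℝ (fun y => softThreshold (ε n) (h y - c₀) + c₀) y v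
      = if h y = c₀ then 0 else lineDeriv ℝ h y v := by
  have hcy : ContinuousAt h y :=
    hc.continuousAt (mem_of_superset (Metric.isOpen_ball.mem_nhds hy) Metric.ball_subset_closedBall)
  split_ifs with hy0
  · filter_upwards with n
    have : (fun y => softThreshold (ε n) (h y - c₀) + c₀) =ᶠ[𝓝 y] fun _ => c₀ := by
      have h1 : ContinuousAt (fun y' => |h y' - c₀|) y := (hcy.sub continuousAt_const).abs
      filter_upwards [h1.eventually_lt_const (u := ε n) (by simpa [hy0] using hε n)] with z hz
      simp [softThreshold_of_abs_le hz.le]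
    rw [this.lineDeriv_eq]
    simp [lineDeriv]
  · rcases lt_or_gt_of_ne hy0 with hlt | hgt
    · filter_upwards [hε'.eventually_lt_const (sub_pos.2 hlt)] with n hn
      have : (fun y => softThreshold (ε n) (h y - c₀) + c₀) =ᶠ[𝓝 y] fun z => h z + ε n := by
        filter_upwards [hcy.eventually_lt_const (u := c₀ - ε n) (by linarith)] with z hz
        rw [softThreshold_of_lt_neg (hε n).le (by linarith)]; ring
      rw [this.lineDeriv_eq]
      simp [lineDeriv]
    · filter_upwards [hε'.eventually_lt_const (sub_pos.2 hgt)] with n hn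
      have : (fun y => softThreshold (ε n) (h y - c₀) + c₀) =ᶠ[𝓝 y] fun z => h z - ε n := by
        filter_upwards [hcy.eventually_const_lt (u := c₀ + ε n) (by linarith)] with z hz
        rw [softThreshold_of_lt (hε n).le (by linarith)]; ring
      rw [this.lineDeriv_eq]
      simp [lineDeriv]

lemma abs_lineDeriv_le {g : R4 → ℝ} {y v : R4} {M : ℝ} (hM : 0 ≤ M)
    (hg : ∀ᶠ t : ℝ in 𝓝 0, |g (y + t • v) - g y| ≤ M * |t|) : |lineDeriv ℝ g y v| ≤ M := by
  have := norm_deriv_le_of_lip' (f := fun t : ℝ => g (y + t • v)) (x₀ := 0) hM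
    (by simpa using hg)
  simpa [lineDeriv] using this

lemma integral_mul_fderiv_eq_of_lipschitzWith {g ψ : R4 → ℝ} {K : NNReal} (hg : LipschitzWith K g)
    (hψ : ContDiff ℝ ∞ ψ) (hψc : HasCompactSupport ψ) (v : R4) :
    ∫ y, g y * fderiv ℝ ψ y v = - ∫ y, lineDeriv ℝ g y v * ψ y := by
  obtain ⟨D, hD⟩ := (hψ.of_le (by simp)).lipschitzWith_of_hasCompactSupport hψc (n := 1) (by simp)
  rw [hg.integral_lineDeriv_mul_eq hD hψc v, ← integral_neg]
  congr 1 with y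
  rw [((hψ.differentiable (by simp)) y).lineDeriv_eq_fderiv]
  simp; ring

lemma setIntegral_eq_of_tsupport_subset {O : Set R4} {g ψ : R4 → ℝ} (hψ : tsupport ψ ⊆ O)
    (hg : ∀ y, ψ y = 0 → g y = 0) :
    ∫ y in O, g y = ∫ y, g y :=
  setIntegral_eq_integral_of_forall_compl_eq_zero fun y hy =>
    hg y (image_eq_zero_of_notMem_tsupport fun h => hy (hψ h))

/-- The weak derivative is the classical one off `{h = c₀}` and zero on this set, even if the set is
large and `h` is far from Lipschitz near it. The thresholded functions are flat there, their
derivatives are dominated by `φ`, and at each point they eventually equal the claimed limit. -/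
lemma exists_hasWeakPartial (j : Fin 4) {φ : R4 → ℝ}
    (hc : ContinuousOn h (Metric.closedBall c r))
    (hL : ∀ y ∈ Metric.closedBall c r, h y ≠ c₀ → ∃ K, ∃ t ∈ 𝓝[Metric.closedBall c r] y,
      LipschitzOnWith K h t)
    (hφ : MemLp φ 2 (volume.restrict (Metric.ball c r))) (hφ0 : ∀ y, 0 ≤ φ y)
    (hb : ∀ y ∈ Metric.ball c r, h y ≠ c₀ → ∀ᶠ t : ℝ in 𝓝 0,
      |h (y + t • EuclideanSpace.single j 1) - h y| ≤ φ y * |t|) :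
    ∃ g : R4 → ℝ, HasWeakPartial (Metric.ball c r) j h g ∧
      ∀ᵐ y ∂(volume.restrict (Metric.ball c r)), |g y| ≤ φ y := by
  set O := Metric.ball c r with hO
  set v : R4 := EuclideanSpace.single j 1
  have : IsFiniteMeasure (volume.restrict O) := ⟨by
    rw [Measure.restrict_apply_univ]; exact measure_ball_lt_top⟩
  let ε : ℕ → ℝ := fun n => 1 / ((n : ℝ) + 1)
  have hε : ∀ n, 0 < ε n := fun n => by positivity
  have hε' : Tendsto ε atTop (𝓝 0) := tendsto_one_div_add_atTop_nhds_zero_nat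
  let g : R4 → ℝ := fun y => if h y = c₀ then 0 else lineDeriv ℝ h y v
  let k : ℕ → R4 → ℝ := fun n y => softThreshold (ε n) (h y - c₀) + c₀
  choose K hK using fun n => exists_lipschitzOnWith_softThreshold hc hL (hε n)
  -- The thresholded functions are controlled on the closed ball only. A Lipschitz extension to all
  -- of `R4` makes the global integration by parts available, and the test function ignores the
  -- extension.
  choose k' hk' hkk' using fun n => (hK n).extend_real
  have hkO : ∀ n y, y ∈ O → k' n =ᶠ[𝓝 y] k n := fun n y hy => by
    filter_upwards [Metric.isOpen_ball.mem_nhds hy] with z hz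
    exact (hkk' n (Metric.ball_subset_closedBall hz)).symm
  have hlim : ∀ y ∈ O, ∀ᶠ n in atTop, lineDeriv ℝ (k' n) y v = g y := fun y hy => by
    filter_upwards [lineDeriv_softThreshold_eventually_eq (c₀ := c₀) hc hy v hε hε'] with n hn
    rw [(hkO n y hy).lineDeriv_eq, hn]
  have hbd : ∀ n, ∀ y ∈ O, |lineDeriv ℝ (k' n) y v| ≤ φ y := fun n y hy => by
    rw [(hkO n y hy).lineDeriv_eq]
    by_cases hy0 : h y = c₀
    · have hcy : ContinuousAt h y := hc.continuousAt
        (mem_of_superset (Metric.isOpen_ball.mem_nhds hy) Metric.ball_subset_closedBall)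
      have : k n =ᶠ[𝓝 y] fun _ => c₀ := by
        have h1 : ContinuousAt (fun y' => |h y' - c₀|) y := (hcy.sub continuousAt_const).abs
        filter_upwards [h1.eventually_lt_const (u := ε n) (by simpa [hy0] using hε n)] with z hz
        simp [k, softThreshold_of_abs_le hz.le]
      rw [this.lineDeriv_eq]
      simpa [lineDeriv] using hφ0 y
    · apply abs_lineDeriv_le (hφ0 y)
      filter_upwards [hb y hy hy0] with t ht
      calc _ = |softThreshold (ε n) (h (y + t • v) - c₀) - softThreshold (ε n) (h y - c₀)| := by
            congr 1; simp only [k]; ring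
        _ ≤ |(h (y + t • v) - c₀) - (h y - c₀)| := abs_softThreshold_sub_le _ _
        _ = |h (y + t • v) - h y| := by congr 1; ring
        _ ≤ _ := ht
  have hgφ : ∀ᵐ y ∂(volume.restrict O), |g y| ≤ φ y := by
    filter_upwards [ae_restrict_mem measurableSet_ball] with y hy
    obtain ⟨n, hn⟩ := (hlim y hy).exists
    exact hn ▸ hbd n y hy
  have hgm : AEStronglyMeasurable g (volume.restrict O) := by
    refine aestronglyMeasurable_of_tendsto_ae atTop
      (f := fun n y => lineDeriv ℝ (k' n) y v)
      (fun n => aestronglyMeasurable_lineDeriv (hk' n).continuous _) ?_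
    filter_upwards [ae_restrict_mem measurableSet_ball] with y hy
    exact tendsto_nhds_of_eventually_eq (hlim y hy)
  have hφi : Integrable φ (volume.restrict O) := hφ.integrable (by norm_num)
  have hgi : IntegrableOn g O := hφi.mono' hgm (by simpa using hgφ)
  have hhi : IntegrableOn h O :=
    (hc.integrableOn_compact (isCompact_closedBall c r)).mono_set Metric.ball_subset_closedBall
  refine ⟨g, ⟨hhi.locallyIntegrableOn, hgi.locallyIntegrableOn, fun ψ hψ hψc hψO => ?_⟩, hgφ⟩
  have hdψ : Continuous fun y => fderiv ℝ ψ y v :=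
    (hψ.continuous_fderiv (by simp)).clm_apply continuous_const
  have hdψ0 : ∀ y, y ∉ tsupport ψ → fderiv ℝ ψ y v = 0 := fun y hy => by
    have := image_eq_zero_of_notMem_tsupport (fun h => hy (tsupport_fderiv_subset ℝ h))
    simp [this]
  have hparts : ∀ n, ∫ y in O, k' n y * fderiv ℝ ψ y v
      = - ∫ y in O, lineDeriv ℝ (k' n) y v * ψ y := fun n => by
    rw [setIntegral_eq_integral_of_forall_compl_eq_zero
        (fun y hy => by simp [hdψ0 y fun h => hy (hψO h)]),
      setIntegral_eq_of_tsupport_subset hψO (fun y hy => by simp [hy])]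
    exact integral_mul_fderiv_eq_of_lipschitzWith (hk' n) hψ hψc v
  obtain ⟨Cψ, hCψ⟩ := hψc.exists_bound_of_continuous hψ.continuous
  obtain ⟨Cd, hCd⟩ := (hψc.fderiv_apply (𝕜 := ℝ) v).exists_bound_of_continuous hdψ
  have hl1 : Tendsto (fun n => ∫ y in O, k' n y * fderiv ℝ ψ y v) atTop
      (𝓝 (∫ y in O, h y * fderiv ℝ ψ y v)) := by
    refine tendsto_integral_of_dominated_convergence (fun y => (|h y| + 1) * Cd)
      (fun n => ((hk' n).continuous.mul hdψ).aestronglyMeasurable)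
      ((hhi.norm.add (integrable_const 1)).mul_const _) (fun n => ?_) ?_
    · filter_upwards [ae_restrict_mem measurableSet_ball] with y hy
      rw [norm_mul]
      refine mul_le_mul ?_ (hCd y) (norm_nonneg _) (by positivity)
      rw [← hkk' n (Metric.ball_subset_closedBall hy), Real.norm_eq_abs]
      have h1 := abs_softThreshold_sub_self_le (hε n).le (h y - c₀)
      have h2 : ε n ≤ 1 := by
        simp only [ε]; rw [div_le_one (by positivity)]; linarith [Nat.cast_nonneg (α := ℝ) n]
      calc _ = |(softThreshold (ε n) (h y - c₀) - (h y - c₀)) + h y| := by congr 1; ring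
        _ ≤ _ := (abs_add_le _ _).trans (by linarith)
    · filter_upwards [ae_restrict_mem measurableSet_ball] with y hy
      refine Tendsto.mul_const _ ?_
      rw [tendsto_iff_dist_tendsto_zero]
      refine squeeze_zero (fun _ => dist_nonneg) (fun n => ?_) hε'
      rw [← hkk' n (Metric.ball_subset_closedBall hy), Real.dist_eq]
      calc _ = |softThreshold (ε n) (h y - c₀) - (h y - c₀)| := by congr 1; ring
        _ ≤ _ := abs_softThreshold_sub_self_le (hε n).le _
  have hl2 : Tendsto (fun n => ∫ y in O, lineDeriv ℝ (k' n) y v * ψ y) atTop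
      (𝓝 (∫ y in O, g y * ψ y)) := by
    refine tendsto_integral_of_dominated_convergence (fun y => φ y * Cψ)
      (fun n => (aestronglyMeasurable_lineDeriv (hk' n).continuous _).mul
        hψ.continuous.aestronglyMeasurable)
      (hφi.mul_const _) (fun n => ?_) ?_
    · filter_upwards [ae_restrict_mem measurableSet_ball] with y hy
      rw [norm_mul]
      exact mul_le_mul (hbd n y hy) (hCψ y) (norm_nonneg _) (hφ0 y)
    · filter_upwards [ae_restrict_mem measurableSet_ball] with y hy
      exact (tendsto_nhds_of_eventually_eq (hlim y hy)).mul_const _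
  refine tendsto_nhds_unique hl1 ?_
  simp_rw [hparts]
  exact hl2.neg

end SoftThreshold

/-! ### The matching distance on unordered pairs -/

section PairDist

variable {W : Type*}

lemma pairDistSq_mk [AddCommGroup W] (q : W → ℝ) (a b c d : W) :
    pairDistSq q s(a, b) s(c, d) = min (q (a - c) + q (b - d)) (q (a - d) + q (b - c)) := rfl

variable [NormedAddCommGroup W]

lemma pairDist_mk (a b c d : W) :
    pairDist s(a, b) s(c, d)
      = min (√(‖a - c‖ ^ 2 + ‖b - d‖ ^ 2)) (√(‖a - d‖ ^ 2 + ‖b - c‖ ^ 2)) := by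
  rw [pairDist, pairDistSq_mk]
  exact Real.sqrt_monotone.map_min

lemma sqrt_sq_add_sq_le {x y x' y' p : ℝ} (hx : 0 ≤ x) (hy : 0 ≤ y) (hx' : 0 ≤ x') (hy' : 0 ≤ y')
    (hp : 0 ≤ p) (h1 : x' ≤ x + p) (h2 : y' ≤ y + p) :
    √(x' ^ 2 + y' ^ 2) ≤ √(x ^ 2 + y ^ 2) + 2 * p := by
  have hs : 0 ≤ √(x ^ 2 + y ^ 2) := Real.sqrt_nonneg _
  have hsq : √(x ^ 2 + y ^ 2) ^ 2 = x ^ 2 + y ^ 2 := Real.sq_sqrt (by positivity)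
  have hxs : x ≤ √(x ^ 2 + y ^ 2) := Real.le_sqrt_of_sq_le (by nlinarith)
  have hys : y ≤ √(x ^ 2 + y ^ 2) := Real.le_sqrt_of_sq_le (by nlinarith)
  rw [Real.sqrt_le_left (by positivity)]
  nlinarith [mul_le_mul h1 h1 hx' (by linarith), mul_le_mul h2 h2 hy' (by linarith),
    mul_le_mul_of_nonneg_right hxs hp, mul_le_mul_of_nonneg_right hys hp]

/-- Each of the two matching costs moves by at most `2 * p`, hence so does their minimum. The factor
2 is not sharp; it reappears in the bounds for the weak derivatives. -/
lemma abs_pairDist_sub_le (a b a' b' : W) (T : Sym2 W) {p : ℝ} (ha : ‖a - a'‖ ≤ p)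
    (hb : ‖b - b'‖ ≤ p) : |pairDist s(a, b) T - pairDist s(a', b') T| ≤ 2 * p := by
  have hp : 0 ≤ p := (norm_nonneg _).trans ha
  have key : ∀ (a b a' b' : W), ‖a - a'‖ ≤ p → ‖b - b'‖ ≤ p →
      pairDist s(a', b') T ≤ pairDist s(a, b) T + 2 * p := by
    intro a b a' b' ha hb
    induction T using Sym2.ind with | _ c d
    have e : ∀ (u u' w : W), ‖u - u'‖ ≤ p → ‖u' - w‖ ≤ ‖u - w‖ + p := fun u u' w h => by
      rw [norm_sub_rev u u'] at h
      linarith [norm_sub_le_norm_sub_add_norm_sub u' u w]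
    rw [pairDist_mk, pairDist_mk, ← min_add_add_right]
    refine min_le_min ?_ ?_ <;>
    exact sqrt_sq_add_sq_le (norm_nonneg _) (norm_nonneg _) (norm_nonneg _) (norm_nonneg _) hp
      (e _ _ _ ha) (e _ _ _ hb)
  rw [abs_le]
  constructor
  · linarith [key a b a' b' ha hb]
  · linarith [key a' b' a b (by rwa [norm_sub_rev]) (by rwa [norm_sub_rev])]

lemma pairDist_self (T : Sym2 W) : pairDist T T = 0 := by
  induction T using Sym2.ind with | _ c d
  rw [pairDist_mk]
  simp

lemma pairNorm_nonneg (T : Sym2 W) : 0 ≤ pairNorm T := Real.sqrt_nonneg _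

lemma pairNorm_mk (a b : W) : pairNorm s(a, b) = √(‖a‖ ^ 2 + ‖b‖ ^ 2) := by
  rw [pairNorm, pairDist_mk]; simp

lemma pairNorm_sq (a b : W) : pairNorm s(a, b) ^ 2 = ‖a‖ ^ 2 + ‖b‖ ^ 2 := by
  rw [pairNorm_mk, Real.sq_sqrt (by positivity)]

lemma pairNorm_mk_neg_sq (a : W) : pairNorm s(a, -a) ^ 2 = 2 * ‖a‖ ^ 2 := by
  rw [pairNorm_sq, norm_neg]; ring

lemma norm_le_pairNorm_left (a b : W) : ‖a‖ ≤ pairNorm s(a, b) := by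
  rw [pairNorm_mk]; exact Real.le_sqrt_of_sq_le (by nlinarith [sq_nonneg ‖b‖])

lemma abs_pairDist_sub_zero_le (S T : Sym2 W) :
    |pairDist S T - pairDist s(0, 0) T| ≤ 2 * pairNorm S := by
  induction S using Sym2.ind with | _ a b
  refine abs_pairDist_sub_le a b 0 0 T ?_ ?_
  · simpa using norm_le_pairNorm_left a b
  · rw [Sym2.eq_swap]; simpa using norm_le_pairNorm_left b a

lemma pairNorm_eq_zero {S : Sym2 W} : pairNorm S = 0 ↔ S = s(0, 0) := by
  induction S using Sym2.ind with | _ a b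
  constructor
  · intro h
    have h1 := norm_le_pairNorm_left a b
    have h2 := norm_le_pairNorm_left b a
    rw [Sym2.eq_swap] at h2
    rw [h] at h1 h2
    rw [norm_le_zero_iff] at h1 h2
    rw [h1, h2]
  · intro h
    rw [h, pairNorm_mk]
    simp

lemma pairNorm_map_le {W' : Type*} [NormedAddCommGroup W'] {S : Sym2 W} {L : W → W'} {K : ℝ}
    (hK : 0 ≤ K) (hL : ∀ w, ‖L w‖ ≤ K * ‖w‖) : pairNorm (S.map L) ≤ K * pairNorm S := by
  induction S using Sym2.ind with | _ a b
  rw [Sym2.map_mk, pairNorm_mk, pairNorm_mk, Real.sqrt_le_left (by positivity), mul_pow,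
    Real.sq_sqrt (by positivity), mul_add, ← mul_pow, ← mul_pow]
  gcongr <;> exact hL _

end PairDist

/-! ### Frames from trivializations, and the metric in charts -/

section SymmL

variable {𝕜 E H B F : Type*} [NontriviallyNormedField 𝕜] [NormedAddCommGroup E] [NormedSpace 𝕜 E]
  [TopologicalSpace H] {I : ModelWithCorners 𝕜 E H} [TopologicalSpace B] [ChartedSpace H B]
  [NormedAddCommGroup F] [NormedSpace 𝕜 F] {V : B → Type*} [TopologicalSpace (TotalSpace F V)]
  [∀ x, AddCommGroup (V x)] [∀ x, Module 𝕜 (V x)] [∀ x, TopologicalSpace (V x)]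
  [FiberBundle F V] [VectorBundle 𝕜 F V]

lemma contMDiffOn_symmL {n : ℕ∞ω} [ContMDiffVectorBundle n F V I]
    (e : Trivialization F (TotalSpace.proj : TotalSpace F V → B)) [MemTrivializationAtlas e]
    (v : F) : ContMDiffOn I (I.prod 𝓘(𝕜, F)) n
      (fun x => (⟨x, e.symmL 𝕜 x v⟩ : TotalSpace F V)) e.baseSet := by
  rw [e.contMDiffOn_section_baseSet_iff]
  refine (contMDiffOn_const (c := v)).congr fun y hy => ?_
  simp [hy]

end SymmL

lemma isContinuousRiemannianBundle_of_contMDiff {B F : Type*} [TopologicalSpace B]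
    [ChartedSpace R4 B] [NormedAddCommGroup F] [NormedSpace ℝ F] (V : B → Type*)
    [TopologicalSpace (TotalSpace F V)] [∀ x, NormedAddCommGroup (V x)]
    [∀ x, InnerProductSpace ℝ (V x)] [FiberBundle F V] [VectorBundle ℝ F V]
    [h : IsContMDiffRiemannianBundle (𝓡 4) ∞ F V] : IsContinuousRiemannianBundle F V := by
  obtain ⟨g, hg, hg'⟩ := h.exists_contMDiff
  exact ⟨g, hg.continuous, hg'⟩

section ChartFrame

variable {X : Type*} [TopologicalSpace X] [ChartedSpace R4 X]

/-- The derivative of the inverse of the chart around `p`, as an endomorphism of `ℝ⁴`. -/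
def chartSymmDeriv (p : X) (y : R4) : R4 →L[ℝ] R4 :=
  mfderiv 𝓘(ℝ, R4) (𝓡 4) (chartAt R4 p).symm y

lemma symmL_trivializationAt_eq [IsManifold (𝓡 4) 1 X] {p x : X}
    (hx : x ∈ (chartAt R4 p).source) :
    (trivializationAt R4 (TangentSpace (𝓡 4)) p).symmL ℝ x
      = chartSymmDeriv p (chartAt R4 p x) := by
  rw [TangentBundle.symmL_trivializationAt hx]
  simp only [mfld_simps]
  rfl

lemma continuousLinearMapAt_trivializationAt_eq [IsManifold (𝓡 4) 1 X] {p x : X}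
    (hx : x ∈ (chartAt R4 p).source) :
    (trivializationAt R4 (TangentSpace (𝓡 4)) p).continuousLinearMapAt ℝ x
      = mfderiv (𝓡 4) 𝓘(ℝ, R4) (chartAt R4 p) x := by
  rw [TangentBundle.continuousLinearMapAt_trivializationAt hx]
  rfl

variable [RiemannianBundle (fun x : X => TangentSpace (𝓡 4) x)]

/-- The metric at `x`, as a bilinear form on `ℝ⁴`. -/
def metricAt (x : X) (a b : R4) : ℝ :=
  inner ℝ (show TangentSpace (𝓡 4) x from a) (show TangentSpace (𝓡 4) x from b)

lemma gram_apply (p : X) (y : R4) (i j : Fin 4) :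
    gram X p y i j = metricAt ((chartAt R4 p).symm y)
      (chartSymmDeriv p y (EuclideanSpace.single i 1))
      (chartSymmDeriv p y (EuclideanSpace.single j 1)) := rfl

lemma gram_apply_chart [IsManifold (𝓡 4) 1 X] {p x : X} (hx : x ∈ (chartAt R4 p).source)
    (i j : Fin 4) :
    gram X p (chartAt R4 p x) i j = inner ℝ
      ((trivializationAt R4 (TangentSpace (𝓡 4)) p).symmL ℝ x (EuclideanSpace.single i 1) :
        TangentSpace (𝓡 4) x)
      ((trivializationAt R4 (TangentSpace (𝓡 4)) p).symmL ℝ x (EuclideanSpace.single j 1) :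
        TangentSpace (𝓡 4) x) := by
  rw [gram_apply, (chartAt R4 p).left_inv hx, ← symmL_trivializationAt_eq hx]
  rfl

lemma metricAt_sum_smul {ι : Type*} (s : Finset ι) (x : X) (c d : ι → ℝ) (a b : ι → R4) :
    metricAt x (∑ i ∈ s, c i • a i) (∑ j ∈ s, d j • b j)
      = ∑ i ∈ s, ∑ j ∈ s, c i * d j * metricAt x (a i) (b j) := by
  unfold metricAt
  have := sum_inner (𝕜 := ℝ) s (fun i => (show TangentSpace (𝓡 4) x from c i • a i))
    (show TangentSpace (𝓡 4) x from ∑ j ∈ s, d j • b j)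
  refine this.trans (Finset.sum_congr rfl fun i _ => ?_)
  have := inner_sum (𝕜 := ℝ) s (fun j => (show TangentSpace (𝓡 4) x from d j • b j))
    (show TangentSpace (𝓡 4) x from c i • a i)
  refine this.trans (Finset.sum_congr rfl fun j _ => ?_)
  have h1 := real_inner_smul_left (show TangentSpace (𝓡 4) x from a i)
    (show TangentSpace (𝓡 4) x from d j • b j) (c i)
  have h2 := real_inner_smul_right (show TangentSpace (𝓡 4) x from a i)
    (show TangentSpace (𝓡 4) x from b j) (d j)
  refine h1.trans ?_
  rw [mul_assoc]
  exact congrArg _ h2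

lemma gram_posDef [IsManifold (𝓡 4) 1 X] {p : X} {y : R4} (hy : y ∈ (chartAt R4 p).target) :
    0 < (gram X p y).det := by
  have hx := (chartAt R4 p).map_target hy
  let x := (chartAt R4 p).symm y
  let w : Fin 4 → TangentSpace (𝓡 4) x := fun i =>
    (trivializationAt R4 (TangentSpace (𝓡 4)) p).symmL ℝ x (EuclideanSpace.single i 1)
  have hw : LinearIndependent ℝ w := by
    have hb : x ∈ (trivializationAt R4 (TangentSpace (𝓡 4)) p).baseSet := by simpa using hx
    let e := (trivializationAt R4 (TangentSpace (𝓡 4)) p).continuousLinearEquivAt ℝ x hb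
    have h1 : LinearIndependent ℝ (fun i : Fin 4 => (EuclideanSpace.single i 1 : R4)) := by
      have := (EuclideanSpace.basisFun (Fin 4) ℝ).toBasis.linearIndependent
      convert! this using 1
      ext1 i
      simp
    have := h1.map' (e.symm.toLinearEquiv : R4 →ₗ[ℝ] TangentSpace (𝓡 4) x)
      (LinearMap.ker_eq_bot.2 e.symm.injective)
    convert! this using 1
    ext1 i
    exact (congrFun (Trivialization.symm_continuousLinearEquivAt_eq _ hb) _).symm
  have h := (Matrix.posDef_gram_of_linearIndependent (𝕜 := ℝ) hw).det_pos
  have heq : gram X p y = Matrix.gram ℝ w := by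
    ext i j
    rw [gram_apply]
    have h1 := symmL_trivializationAt_eq hx
    rw [(chartAt R4 p).right_inv hy] at h1
    rw [← h1]
    rfl
  rwa [heq]

lemma continuousOn_gram_det [IsManifold (𝓡 4) ∞ X]
    [IsContMDiffRiemannianBundle (𝓡 4) ∞ R4 (fun x : X => TangentSpace (𝓡 4) x)] (p : X) :
    ContinuousOn (fun y => (gram X p y).det) (chartAt R4 p).target := by
  have : IsManifold (𝓡 4) 1 X := .of_le (n := ∞) (by simp)
  have := isContinuousRiemannianBundle_of_contMDiff (F := R4)
    (fun x : X => TangentSpace (𝓡 4) x)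
  have hs : ∀ v : R4, ContinuousOn (fun x : X => (⟨x,
      (trivializationAt R4 (TangentSpace (𝓡 4)) p).symmL ℝ x v⟩ :
        TotalSpace R4 (fun x : X => TangentSpace (𝓡 4) x))) (chartAt R4 p).source := fun v =>
    (contMDiffOn_symmL (I := 𝓡 4) (n := 0) (trivializationAt R4 (TangentSpace (𝓡 4)) p) v).continuousOn.mono
      (by simp)
  have : ∀ i j, ContinuousOn (fun y => gram X p y i j) (chartAt R4 p).target := fun i j => by
    have h1 := (hs (EuclideanSpace.single i 1)).inner_bundle (hs (EuclideanSpace.single j 1))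
    refine (h1.comp (chartAt R4 p).continuousOn_symm
      (fun y hy => (chartAt R4 p).map_target hy)).congr fun y hy => ?_
    have h2 := gram_apply_chart ((chartAt R4 p).map_target hy) i j
    rw [(chartAt R4 p).right_inv hy] at h2
    exact h2
  simp only [Matrix.det_apply]
  fun_prop (disch := assumption)

/-- The transition map from the chart around `p` to the chart around `q`. -/
def transition (p q : X) : R4 → R4 := chartAt R4 q ∘ (chartAt R4 p).symm

lemma exists_hasFDerivAt_transition [IsManifold (𝓡 4) 1 X] {p q : X} {y : R4}
    (hy : y ∈ (chartAt R4 p).target) (hyq : (chartAt R4 p).symm y ∈ (chartAt R4 q).source) :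
    HasFDerivAt (transition p q) (fderiv ℝ (transition p q) y) y ∧
      (chartSymmDeriv q (transition p q y)).comp (fderiv ℝ (transition p q) y)
        = chartSymmDeriv p y := by
  have h1 : MDifferentiableAt 𝓘(ℝ, R4) (𝓡 4) (chartAt R4 p).symm y :=
    mdifferentiableAt_atlas_symm (chart_mem_atlas R4 p) hy
  have h2 : MDifferentiableAt (𝓡 4) 𝓘(ℝ, R4) (chartAt R4 q) ((chartAt R4 p).symm y) :=
    mdifferentiableAt_atlas (chart_mem_atlas R4 q) hyq
  have h3 : MDifferentiableAt 𝓘(ℝ, R4) 𝓘(ℝ, R4) (transition p q) y := h2.comp y h1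
  refine ⟨h3.differentiableAt.hasFDerivAt, ?_⟩
  have h4 : MDifferentiableAt 𝓘(ℝ, R4) (𝓡 4) (chartAt R4 q).symm (transition p q y) :=
    mdifferentiableAt_atlas_symm (chart_mem_atlas R4 q) ((chartAt R4 q).map_source hyq)
  have h5 := mfderiv_comp y h4 h3
  have h6 : (chartAt R4 q).symm ∘ transition p q =ᶠ[𝓝 y] (chartAt R4 p).symm := by
    have : ∀ᶠ z in 𝓝 y, (chartAt R4 p).symm z ∈ (chartAt R4 q).source :=
      ((chartAt R4 p).continuousAt_symm hy).eventually_mem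
        ((chartAt R4 q).open_source.mem_nhds hyq)
    filter_upwards [this] with z hz
    exact (chartAt R4 q).left_inv hz
  rw [h6.mfderiv_eq, mfderiv_eq_fderiv] at h5
  exact h5.symm

/-- The chain rule gives `Nᵀ G N` for the Gram matrix in the other chart, where `N` is the Jacobian
matrix of the transition. The square root of the determinant therefore picks up exactly the factor
of the change of variables formula, so chart volumes agree on overlaps. -/
lemma gram_transition [IsManifold (𝓡 4) 1 X] {p q : X} {y : R4}
    (hy : y ∈ (chartAt R4 p).target) (hyq : (chartAt R4 p).symm y ∈ (chartAt R4 q).source) :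
    √(gram X p y).det = |(fderiv ℝ (transition p q) y).det| *
      √(gram X q (transition p q y)).det := by
  set T' := fderiv ℝ (transition p q) y
  set b := (EuclideanSpace.basisFun (Fin 4) ℝ).toBasis
  set N : Matrix (Fin 4) (Fin 4) ℝ := LinearMap.toMatrix b b (T' : R4 →ₗ[ℝ] R4) with hN
  have hdet : N.det = T'.det := LinearMap.det_toMatrix b _
  have hx : (chartAt R4 q).symm (transition p q y) = (chartAt R4 p).symm y :=
    (chartAt R4 q).left_inv hyq
  have hT : ∀ i, T' (EuclideanSpace.single i 1) = ∑ k, N k i • EuclideanSpace.single k 1 := by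
    intro i
    have := b.sum_repr (T' (b i))
    simp only [b, OrthonormalBasis.coe_toBasis, EuclideanSpace.basisFun_apply] at this
    rw [← this]
    refine Finset.sum_congr rfl fun k _ => ?_
    simp [hN, LinearMap.toMatrix_apply, b]
  have key : gram X p y = N.transpose * gram X q (transition p q y) * N := by
    ext i j
    have hc : ∀ i, chartSymmDeriv p y (EuclideanSpace.single i 1) = ∑ k, N k i •
        chartSymmDeriv q (transition p q y) (EuclideanSpace.single k 1) := fun i => by
      rw [← (exists_hasFDerivAt_transition hy hyq).2, ContinuousLinearMap.comp_apply]
      change (chartSymmDeriv q _) (T' _) = _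
      rw [hT, map_sum]
      simp_rw [map_smul]
    rw [gram_apply, hc, hc, metricAt_sum_smul]
    simp_rw [Matrix.mul_apply, Matrix.transpose_apply, gram_apply, hx, Finset.sum_mul]
    rw [Finset.sum_comm]
    refine Finset.sum_congr rfl fun k _ => Finset.sum_congr rfl fun l _ => by ring
  rw [key, Matrix.det_mul, Matrix.det_mul, Matrix.det_transpose, hdet, mul_right_comm, ← sq,
    Real.sqrt_mul (sq_nonneg _), Real.sqrt_sq_eq_abs]

end ChartFrame

/-! ### The Riemannian volume measure compared with Lebesgue measure -/

section RiemannianVolume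

variable {X : Type*} [TopologicalSpace X] [ChartedSpace R4 X]
  [RiemannianBundle (fun x : X => TangentSpace (𝓡 4) x)] [MeasurableSpace X] [BorelSpace X]

lemma measurableSet_chart_symm_preimage (p : X) {A : Set X} (hA : MeasurableSet A) :
    MeasurableSet ((chartAt R4 p).symm ⁻¹' A ∩ (chartAt R4 p).target) := by
  have h := (chartAt R4 p).continuousOn_symm.domRestrict.measurable hA
  have := (chartAt R4 p).open_target.measurableSet.subtype_image h
  convert this using 1
  ext y
  simp [and_comm]

lemma aemeasurable_chart_symm (p : X) (μ : Measure R4) :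
    AEMeasurable (chartAt R4 p).symm (μ.restrict (chartAt R4 p).target) :=
  (chartAt R4 p).continuousOn_symm.aemeasurable (chartAt R4 p).open_target.measurableSet

lemma chartVolume_apply (p : X) {A : Set X} (hA : MeasurableSet A) :
    chartVolume X p A = ∫⁻ y in (chartAt R4 p).symm ⁻¹' A ∩ (chartAt R4 p).target,
      ENNReal.ofReal √(gram X p y).det := by
  rw [chartVolume, Measure.map_apply_of_aemeasurable (aemeasurable_chart_symm p _) hA,
    Measure.restrict_apply' (chartAt R4 p).open_target.measurableSet,
    withDensity_apply _ (measurableSet_chart_symm_preimage p hA)]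

lemma chartVolume_inter_source [IsManifold (𝓡 4) 1 X] (p q : X) {A : Set X}
    (hA : MeasurableSet A) :
    chartVolume X q (A ∩ (chartAt R4 p).source) = chartVolume X p (A ∩ (chartAt R4 q).source) := by
  have hp := (chartAt R4 p).open_source.measurableSet
  have hq := (chartAt R4 q).open_source.measurableSet
  rw [chartVolume_apply _ (hA.inter hp), chartVolume_apply _ (hA.inter hq)]
  set S := (chartAt R4 p).symm ⁻¹' (A ∩ (chartAt R4 q).source) ∩ (chartAt R4 p).target with hS
  have himg : (chartAt R4 q).symm ⁻¹' (A ∩ (chartAt R4 p).source) ∩ (chartAt R4 q).target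
      = transition p q '' S := by
    ext z
    constructor
    · rintro ⟨⟨h1, h2⟩, h3⟩
      refine ⟨chartAt R4 p ((chartAt R4 q).symm z), ⟨?_, (chartAt R4 p).map_source h2⟩, ?_⟩
      · rw [mem_preimage, (chartAt R4 p).left_inv h2]
        exact ⟨h1, (chartAt R4 q).map_target h3⟩
      · simp only [transition, Function.comp_apply]
        rw [(chartAt R4 p).left_inv h2, (chartAt R4 q).right_inv h3]
    · rintro ⟨y, ⟨⟨h1, h2⟩, h3⟩, rfl⟩
      refine ⟨?_, (chartAt R4 q).map_source h2⟩
      simp only [transition, Function.comp_apply, mem_preimage]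
      rw [(chartAt R4 q).left_inv h2]
      exact ⟨h1, (chartAt R4 p).map_target h3⟩
  have hinj : InjOn (transition p q) S := by
    rintro y ⟨⟨_, h2⟩, h3⟩ z ⟨⟨_, h5⟩, h6⟩ h
    exact (chartAt R4 p).symm.injOn h3 h6 ((chartAt R4 q).injOn h2 h5 h)
  rw [himg, lintegral_image_eq_lintegral_abs_det_fderiv_mul volume
    (measurableSet_chart_symm_preimage p (hA.inter hq))
    (fun y hy => (exists_hasFDerivAt_transition hy.2 hy.1.2).1.hasFDerivWithinAt) hinj]
  refine setLIntegral_congr_fun (measurableSet_chart_symm_preimage p (hA.inter hq))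
    fun y hy => ?_
  rw [gram_transition hy.2 hy.1.2, ENNReal.ofReal_mul (abs_nonneg _)]

lemma chartVolume_le_riemannianVolume (p : X) : chartVolume X p ≤ riemannianVolume X :=
  le_iSup (chartVolume X) p

/-- On the domain of a chart, the Riemannian volume is the chart volume. -/
lemma riemannianVolume_inter_source_le [IsManifold (𝓡 4) 1 X] (p : X) {A : Set X}
    (hA : MeasurableSet A) :
    riemannianVolume X (A ∩ (chartAt R4 p).source) ≤ chartVolume X p A := by
  have hp := (chartAt R4 p).open_source.measurableSet
  -- A supremum of measures is bounded by bounding each of them. A set is split along the chart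
  -- domain at `p`: inside, the volumes of the charts at `q` and `p` agree; outside,
  -- `riemannianVolume X` itself serves as the bound, and this term vanishes on subsets of the
  -- domain.
  have key : riemannianVolume X
      ≤ chartVolume X p + (riemannianVolume X).restrict (chartAt R4 p).sourceᶜ := by
    refine iSup_le fun q => Measure.le_iff.2 fun B hB => ?_
    rw [← measure_inter_add_sdiff B hp, Measure.add_apply, Measure.restrict_apply hB]
    refine add_le_add ?_ ?_
    · rw [chartVolume_inter_source p q hB]
      exact measure_mono inter_subset_left
    · rw [sdiff_eq]
      exact chartVolume_le_riemannianVolume q _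
  calc _ ≤ (chartVolume X p + (riemannianVolume X).restrict (chartAt R4 p).sourceᶜ)
        (A ∩ (chartAt R4 p).source) := key _
    _ = chartVolume X p (A ∩ (chartAt R4 p).source) + 0 := by
        rw [Measure.add_apply, Measure.restrict_apply (hA.inter hp)]
        congr 1
        rw [inter_assoc, inter_compl_self, inter_empty, measure_empty]
    _ ≤ _ := by rw [add_zero]; exact measure_mono inter_subset_left

/-- Countably many chart domains cover `X`. Since `N` need not be measurable, its image in each
chart is first enlarged to a measurable null set. -/
lemma riemannianVolume_eq_zero_of_forall_chart [IsManifold (𝓡 4) 1 X] [SecondCountableTopology X]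
    {N : Set X}
    (hN : ∀ p : X, volume ((chartAt R4 p).symm ⁻¹' N ∩ (chartAt R4 p).target) = 0) :
    riemannianVolume X N = 0 := by
  obtain ⟨s, hs, hsU⟩ := countable_cover_nhds (fun p : X => chart_source_mem_nhds R4 p)
  have : N ⊆ ⋃ p ∈ s, N ∩ (chartAt R4 p).source := by
    rw [← inter_iUnion₂, hsU, inter_univ]
  refine measure_mono_null this ((measure_biUnion_null_iff hs).2 fun p _ => ?_)
  obtain ⟨B, hNB, hB, hB0⟩ := exists_measurable_superset_of_null (hN p)
  have hA : MeasurableSet ((chartAt R4 p) ⁻¹' B ∩ (chartAt R4 p).source) := by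
    have h := (chartAt R4 p).continuousOn.domRestrict.measurable hB
    have := (chartAt R4 p).open_source.measurableSet.subtype_image h
    convert this using 1
    ext y
    simp [and_comm]
  have hsub : N ∩ (chartAt R4 p).source
      ⊆ ((chartAt R4 p) ⁻¹' B ∩ (chartAt R4 p).source) ∩ (chartAt R4 p).source := by
    rintro x ⟨hx, hxp⟩
    refine ⟨⟨hNB ⟨?_, (chartAt R4 p).map_source hxp⟩, hxp⟩, hxp⟩
    rwa [mem_preimage, (chartAt R4 p).left_inv hxp]
  refine measure_mono_null hsub (le_antisymm ((riemannianVolume_inter_source_le p hA).trans ?_)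
    zero_le)
  rw [chartVolume_apply p hA]
  refine (setLIntegral_measure_zero _ _ (measure_mono_null ?_ hB0)).le
  rintro y ⟨⟨hy1, _⟩, hy2⟩
  rwa [mem_preimage, (chartAt R4 p).right_inv hy2] at hy1

variable [IsManifold (𝓡 4) ∞ X]
  [IsContMDiffRiemannianBundle (𝓡 4) ∞ R4 (fun x : X => TangentSpace (𝓡 4) x)]

lemma eventually_sqrt_gram_det (p : X) : ∃ K : ℝ, 0 < K ∧ ∀ᶠ y in 𝓝 (chartAt R4 p p),
    √(gram X p y).det < K ∧ 1 < K * √(gram X p y).det := by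
  have : IsManifold (𝓡 4) 1 X := .of_le (n := ∞) (by simp)
  have hp := mem_chart_target R4 p
  have hc : ContinuousAt (fun y => √(gram X p y).det) (chartAt R4 p p) :=
    ((continuousOn_gram_det p).continuousAt ((chartAt R4 p).open_target.mem_nhds hp)).sqrt
  set s := √(gram X p (chartAt R4 p p)).det with hs
  have hs0 : 0 < s := Real.sqrt_pos.2 (gram_posDef hp)
  -- The constant `K = s + 2 / s` exceeds `s`, and `K * s = s ^ 2 + 2` exceeds 1, so one constant
  -- bounds the density from both sides nearby.
  refine ⟨s + 2 / s, by positivity, ?_⟩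
  refine (hc.eventually_lt_const (show s < s + 2 / s by linarith [show 0 < 2 / s by positivity])).and ?_
  refine (hc.const_mul (s + 2 / s)).eventually_const_lt ?_
  change 1 < (s + 2 / s) * s
  rw [add_mul, div_mul_cancel₀ _ hs0.ne']
  nlinarith

lemma exists_nhds_riemannianVolume_lt_top (p : X) : ∃ W ∈ 𝓝 p, riemannianVolume X W < ⊤ := by
  have : IsManifold (𝓡 4) 1 X := .of_le (n := ∞) (by simp)
  obtain ⟨K, hK, h⟩ := eventually_sqrt_gram_det p
  obtain ⟨r, hr, hball⟩ := Metric.eventually_nhds_iff_ball.1 h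
  refine ⟨(chartAt R4 p) ⁻¹' (Metric.ball (chartAt R4 p p) r) ∩ (chartAt R4 p).source, ?_, ?_⟩
  · exact inter_mem ((chartAt R4 p).continuousAt (mem_chart_source R4 p)
      (Metric.ball_mem_nhds _ hr)) (chart_source_mem_nhds R4 p)
  have hW : IsOpen ((chartAt R4 p) ⁻¹' (Metric.ball (chartAt R4 p p) r) ∩
      (chartAt R4 p).source) := by
    rw [inter_comm]
    exact (chartAt R4 p).isOpen_inter_preimage Metric.isOpen_ball
  refine lt_of_le_of_lt (measure_mono (subset_inter subset_rfl inter_subset_right)) ?_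
  refine (riemannianVolume_inter_source_le p hW.measurableSet).trans_lt ?_
  rw [chartVolume_apply p hW.measurableSet]
  have hsub : (chartAt R4 p).symm ⁻¹' ((chartAt R4 p) ⁻¹' (Metric.ball (chartAt R4 p p) r) ∩
      (chartAt R4 p).source) ∩ (chartAt R4 p).target ⊆ Metric.ball (chartAt R4 p p) r := by
    rintro y ⟨⟨h1, _⟩, h2⟩
    rwa [mem_preimage, (chartAt R4 p).right_inv h2] at h1
  refine (lintegral_mono_set hsub).trans_lt ?_
  refine (setLIntegral_mono measurable_const (g := fun _ => ENNReal.ofReal K)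
    fun y hy => ENNReal.ofReal_le_ofReal (hball y hy).1.le).trans_lt ?_
  rw [setLIntegral_const]
  exact ENNReal.mul_lt_top ENNReal.ofReal_lt_top measure_ball_lt_top

lemma riemannianVolume_lt_top_of_isCompact {A : Set X} (hA : IsCompact A) :
    riemannianVolume X A < ⊤ := by
  choose W hW hWt using fun p : X => exists_nhds_riemannianVolume_lt_top p
  obtain ⟨t, _, ht⟩ := hA.elim_nhds_subcover W fun x _ => hW x
  exact (measure_mono ht).trans_lt (measure_biUnion_lt_top t.finite_toSet fun i _ => hWt i)

lemma lintegral_chartVolume (p : X) {G : X → ℝ≥0∞} (hG : Measurable G) :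
    ∫⁻ x, G x ∂(chartVolume X p) = ∫⁻ y in (chartAt R4 p).target,
      ENNReal.ofReal √(gram X p y).det * G ((chartAt R4 p).symm y) := by
  have ht := (chartAt R4 p).open_target.measurableSet
  have : IsManifold (𝓡 4) 1 X := .of_le (n := ∞) (by simp)
  have hm : AEMeasurable (fun y => ENNReal.ofReal √(gram X p y).det)
      (volume.restrict (chartAt R4 p).target) :=
    ((continuousOn_gram_det p).sqrt.aemeasurable ht).ennreal_ofReal
  rw [chartVolume, lintegral_map' hG.aemeasurable (aemeasurable_chart_symm p _),
    restrict_withDensity ht]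
  exact lintegral_withDensity_eq_lintegral_mul₀ hm
    (hG.comp_aemeasurable (aemeasurable_chart_symm p _))

/-- This transports square integrability from `X` to Lebesgue measure in a chart, at the cost of a
lower bound on the density. -/
lemma lintegral_le_mul_lintegral_riemannianVolume (p : X) {O : Set R4} (hO : IsOpen O)
    (hOt : O ⊆ (chartAt R4 p).target) {K : ℝ} (hK : ∀ y ∈ O, 1 ≤ K * √(gram X p y).det)
    {G : X → ℝ≥0∞} (hG : Measurable G) :
    ∫⁻ y in O, G ((chartAt R4 p).symm y) ≤ ENNReal.ofReal K *
      ∫⁻ x in (chartAt R4 p).source ∩ (chartAt R4 p) ⁻¹' O, G x ∂(riemannianVolume X) := by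
  set A := (chartAt R4 p).source ∩ (chartAt R4 p) ⁻¹' O
  have hA : IsOpen A := (chartAt R4 p).isOpen_inter_preimage hO
  have h1 : ∫⁻ x in A, G x ∂(chartVolume X p) ≤ ∫⁻ x in A, G x ∂(riemannianVolume X) :=
    lintegral_mono' (Measure.restrict_mono subset_rfl (chartVolume_le_riemannianVolume p)) le_rfl
  refine le_trans ?_ (mul_le_mul_right h1 _)
  rw [← lintegral_indicator hA.measurableSet,
    lintegral_chartVolume p (hG.indicator hA.measurableSet),
    ← lintegral_const_mul' _ _ ENNReal.ofReal_ne_top]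
  refine le_trans ?_ (lintegral_mono_set hOt)
  refine lintegral_mono_ae ?_
  filter_upwards [ae_restrict_mem hO.measurableSet] with y hy
  have hyA : (chartAt R4 p).symm y ∈ A :=
    ⟨(chartAt R4 p).map_target (hOt hy), by rwa [mem_preimage, (chartAt R4 p).right_inv (hOt hy)]⟩
  have hK0 : 0 ≤ K := by
    by_contra hneg
    nlinarith [hK y hy, Real.sqrt_nonneg (gram X p y).det]
  rw [indicator_of_mem hyA, ← mul_assoc, ← ENNReal.ofReal_mul hK0]
  calc G ((chartAt R4 p).symm y) = 1 * G ((chartAt R4 p).symm y) := (one_mul _).symm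
    _ ≤ _ := by
      gcongr
      exact ENNReal.one_le_ofReal.2 (hK y hy)

end RiemannianVolume

/-! ### Norms of derivatives, and their comparison in charts -/

section LocalEstimates

variable {X : Type*} [TopologicalSpace X] [ChartedSpace R4 X] [IsManifold (𝓡 4) ∞ X]
  [RiemannianBundle (fun x : X => TangentSpace (𝓡 4) x)]
  [IsContMDiffRiemannianBundle (𝓡 4) ∞ R4 (fun x : X => TangentSpace (𝓡 4) x)]
  {F : Type*} [NormedAddCommGroup F] [InnerProductSpace ℝ F]
  {V : X → Type*} [TopologicalSpace (TotalSpace F V)]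
  [∀ x, NormedAddCommGroup (V x)] [∀ x, InnerProductSpace ℝ (V x)]
  [FiberBundle F V] [VectorBundle ℝ F V]

variable (F) in
/-- `u` is differentiable at `x`, as a section of `V`. -/
def DiffAt (u : Π x, V x) (x : X) : Prop :=
  MDifferentiableAt (𝓡 4) ((𝓡 4).prod 𝓘(ℝ, F)) (fun x => (⟨x, u x⟩ : TotalSpace F V)) x

lemma norm_apply_sq_le_derivNormSq {x : X} (L : TangentSpace (𝓡 4) x →L[ℝ] V x)
    (e : TangentSpace (𝓡 4) x) : ‖L e‖ ^ 2 ≤ derivNormSq L * ‖e‖ ^ 2 := by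
  have : FiniteDimensional ℝ (TangentSpace (𝓡 4) x) := inferInstanceAs (FiniteDimensional ℝ R4)
  let b := stdOrthonormalBasis ℝ (TangentSpace (𝓡 4) x)
  have h1 : L e = ∑ i, b.repr e i • L (b i) := by
    conv_lhs => rw [← b.sum_repr e]
    simp
  have h2 : ‖e‖ ^ 2 = ∑ i, ‖b.repr e i‖ ^ 2 := by
    rw [← b.repr.norm_map, EuclideanSpace.norm_sq_eq]
  have h3 : ‖L e‖ ≤ ∑ i, ‖b.repr e i‖ * ‖L (b i)‖ := by
    rw [h1]
    exact (norm_sum_le _ _).trans (Finset.sum_le_sum fun i _ => (norm_smul_le _ _))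
  calc ‖L e‖ ^ 2 ≤ (∑ i, ‖b.repr e i‖ * ‖L (b i)‖) ^ 2 := by gcongr
    _ ≤ (∑ i, ‖b.repr e i‖ ^ 2) * ∑ i, ‖L (b i)‖ ^ 2 := Finset.sum_mul_sq_le_sq_mul_sq _ _ _
    _ = derivNormSq L * ‖e‖ ^ 2 := by rw [h2, mul_comm]; rfl

lemma derivNormSq_nonneg {x : X} (L : TangentSpace (𝓡 4) x →L[ℝ] V x) : 0 ≤ derivNormSq L :=
  Finset.sum_nonneg fun _ _ => by positivity

lemma derivNormSq_neg {x : X} (L : TangentSpace (𝓡 4) x →L[ℝ] V x) :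
    derivNormSq (-L) = derivNormSq L := by
  simp [derivNormSq]

lemma derivNormSq_zero {x : X} : derivNormSq (0 : TangentSpace (𝓡 4) x →L[ℝ] V x) = 0 := by
  simp [derivNormSq]

/-- The inequality `(a + b)² ≤ 2a² + 2b²` is summed over an orthonormal basis; its four vectors turn
`2 * B ^ 2` into `8 * B ^ 2`. -/
lemma derivNormSq_le_of_norm_le {x : X} {L M : TangentSpace (𝓡 4) x →L[ℝ] V x} {A B : ℝ}
    (h : ∀ e, ‖L e‖ ≤ A * ‖M e‖ + B * ‖e‖) :
    derivNormSq L ≤ 2 * A ^ 2 * derivNormSq M + 8 * B ^ 2 := by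
  have : FiniteDimensional ℝ (TangentSpace (𝓡 4) x) := inferInstanceAs (FiniteDimensional ℝ R4)
  let b := stdOrthonormalBasis ℝ (TangentSpace (𝓡 4) x)
  have hd : Module.finrank ℝ (TangentSpace (𝓡 4) x) = 4 :=
    (finrank_euclideanSpace_fin : Module.finrank ℝ R4 = 4)
  change ∑ i, ‖L (b i)‖ ^ 2 ≤ 2 * A ^ 2 * ∑ i, ‖M (b i)‖ ^ 2 + 8 * B ^ 2
  have h1 : ∀ i, ‖L (b i)‖ ^ 2 ≤ 2 * A ^ 2 * ‖M (b i)‖ ^ 2 + 2 * B ^ 2 := fun i => by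
    have := h (b i)
    rw [b.norm_eq_one, mul_one] at this
    nlinarith [norm_nonneg (L (b i)), sq_nonneg (A * ‖M (b i)‖ - B),
      mul_self_le_mul_self (norm_nonneg _) this]
  calc _ ≤ ∑ i, (2 * A ^ 2 * ‖M (b i)‖ ^ 2 + 2 * B ^ 2) := Finset.sum_le_sum fun i _ => h1 i
    _ = _ := by
      rw [Finset.sum_add_distrib, ← Finset.mul_sum, Finset.sum_const, Finset.card_univ,
        Fintype.card_fin, nsmul_eq_mul,
        show ((Module.finrank ℝ (TangentSpace (𝓡 4) x) : ℕ) : ℝ) = 4 by exact_mod_cast hd]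
      ring

/-! ### Trivializations -/

lemma eventually_norm_trivialization_le [IsContMDiffRiemannianBundle (𝓡 4) ∞ F V] (p : X) :
    ∃ K : ℝ, 0 < K ∧ ∀ᶠ x in 𝓝 p, x ∈ (trivializationAt F V p).baseSet ∧
      (∀ v : V x, ‖(trivializationAt F V p).continuousLinearMapAt ℝ x v‖ ≤ K * ‖v‖) ∧
      ∀ w : F, ‖(trivializationAt F V p).symmL ℝ x w‖ ≤ K * ‖w‖ := by
  have := isContinuousRiemannianBundle_of_contMDiff (F := F) V
  obtain ⟨K₁, h₁, hK₁⟩ := eventually_norm_trivializationAt_lt F V p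
  obtain ⟨K₂, h₂, hK₂⟩ := eventually_norm_symmL_trivializationAt_lt F V p
  refine ⟨max K₁ K₂, by positivity, ?_⟩
  filter_upwards [hK₁, hK₂, (trivializationAt F V p).open_baseSet.mem_nhds
    (FiberBundle.mem_baseSet_trivializationAt' p)] with x h1 h2 h3
  refine ⟨h3, fun v => ?_, fun w => ?_⟩
  · exact ContinuousLinearMap.le_of_opNorm_le _ (h1.le.trans (le_max_left _ _)) v
  · exact ContinuousLinearMap.le_of_opNorm_le _ (h2.le.trans (le_max_right _ _)) w

lemma eventually_norm_tangent_trivialization_le (p : X) :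
    ∃ K : ℝ, 0 < K ∧ ∀ᶠ x in 𝓝 p, x ∈ (chartAt R4 p).source ∧
      (∀ e : TangentSpace (𝓡 4) x,
        ‖(trivializationAt R4 (TangentSpace (𝓡 4)) p).continuousLinearMapAt ℝ x e‖ ≤ K * ‖e‖) ∧
      ∀ w : R4, ‖(trivializationAt R4 (TangentSpace (𝓡 4)) p).symmL ℝ x w‖ ≤ K * ‖w‖ := by
  obtain ⟨K, hK, h⟩ := eventually_norm_trivialization_le (F := R4)
    (V := fun x : X => TangentSpace (𝓡 4) x) p
  refine ⟨K, hK, h.mono fun x hx => ⟨?_, hx.2⟩⟩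
  simpa using hx.1

lemma symmL_continuousLinearMapAt_tangent {p x : X} (hx : x ∈ (chartAt R4 p).source)
    (e : TangentSpace (𝓡 4) x) :
    (trivializationAt R4 (TangentSpace (𝓡 4)) p).symmL ℝ x
      ((trivializationAt R4 (TangentSpace (𝓡 4)) p).continuousLinearMapAt ℝ x e) = e :=
  Trivialization.symmL_continuousLinearMapAt _ (by simpa using hx) e

/-! ### Derivatives in charts -/

lemma mvfderiv_eq_fderiv_chart {G : Type*} [NormedAddCommGroup G] [NormedSpace ℝ G] {a : X → G}
    {p x : X} (hx : x ∈ (chartAt R4 p).source) (ha : MDifferentiableAt (𝓡 4) 𝓘(ℝ, G) a x)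
    (e : TangentSpace (𝓡 4) x) :
    DifferentiableAt ℝ (a ∘ (chartAt R4 p).symm) (chartAt R4 p x) ∧
    mvfderiv (𝓡 4) a x e = fderiv ℝ (a ∘ (chartAt R4 p).symm) (chartAt R4 p x)
      ((trivializationAt R4 (TangentSpace (𝓡 4)) p).continuousLinearMapAt ℝ x e) := by
  have h1 : MDifferentiableAt 𝓘(ℝ, R4) (𝓡 4) (chartAt R4 p).symm (chartAt R4 p x) :=
    mdifferentiableAt_atlas_symm (chart_mem_atlas R4 p) ((chartAt R4 p).map_source hx)
  have h2 : MDifferentiableAt (𝓡 4) 𝓘(ℝ, R4) (chartAt R4 p) x :=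
    mdifferentiableAt_atlas (chart_mem_atlas R4 p) hx
  have h3 : MDifferentiableAt 𝓘(ℝ, R4) 𝓘(ℝ, G) (a ∘ (chartAt R4 p).symm) (chartAt R4 p x) :=
    MDifferentiableAt.comp _ (by rwa [(chartAt R4 p).left_inv hx]) h1
  refine ⟨h3.differentiableAt, ?_⟩
  have h4 : (a ∘ (chartAt R4 p).symm) ∘ chartAt R4 p =ᶠ[𝓝 x] a := by
    filter_upwards [(chartAt R4 p).open_source.mem_nhds hx] with z hz
    simp [(chartAt R4 p).left_inv hz]
  have h5 := mfderiv_comp x h3 h2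
  rw [h4.mfderiv_eq, mfderiv_eq_fderiv] at h5
  rw [continuousLinearMapAt_trivializationAt_eq hx]
  exact congrArg (fun L : R4 →L[ℝ] G => L e) h5

lemma eventually_abs_mvfderiv_le {f : X → ℝ} {p : X} (hf : ContMDiffAt (𝓡 4) 𝓘(ℝ) ∞ f p) :
    ∃ K : ℝ, 0 < K ∧ ∀ᶠ x in 𝓝 p, ∀ e : TangentSpace (𝓡 4) x,
      |mvfderiv (𝓡 4) f x e| ≤ K * ‖e‖ := by
  obtain ⟨K, hK, h⟩ := eventually_norm_tangent_trivialization_le p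
  have h1 : ContMDiffAt 𝓘(ℝ, R4) 𝓘(ℝ) ∞ (f ∘ (chartAt R4 p).symm) (chartAt R4 p p) := by
    refine ContMDiffAt.comp _ (by simpa using hf) ?_
    exact (contMDiffOn_chart_symm (I := 𝓡 4) (x := p)).contMDiffAt
      ((chartAt R4 p).open_target.mem_nhds (mem_chart_target R4 p))
  have h2 : ContinuousAt (fun y => ‖fderiv ℝ (f ∘ (chartAt R4 p).symm) y‖) (chartAt R4 p p) :=
    ((contMDiffAt_iff_contDiffAt.1 h1).fderiv_right (m := 0) (by simp)).continuousAt.norm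
  obtain ⟨M, hM⟩ := exists_gt ‖fderiv ℝ (f ∘ (chartAt R4 p).symm) (chartAt R4 p p)‖
  have hM0 : 0 < M := (norm_nonneg _).trans_lt hM
  have h3 : ∀ᶠ x in 𝓝 p, ‖fderiv ℝ (f ∘ (chartAt R4 p).symm) (chartAt R4 p x)‖ < M :=
    ((chartAt R4 p).continuousAt (mem_chart_source R4 p)).eventually (h2.eventually_lt_const hM)
  have h4 : ∀ᶠ x in 𝓝 p, MDifferentiableAt (𝓡 4) 𝓘(ℝ) f x := by
    have := (contMDiffAt_iff_contMDiffAt_nhds (n := 1) (by simp)).1 (hf.of_le (by simp))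
    exact this.mono fun x hx => hx.mdifferentiableAt (by simp)
  refine ⟨M * K, by positivity, ?_⟩
  filter_upwards [h, h3, h4] with x hx1 hx2 hx3 e
  rw [(mvfderiv_eq_fderiv_chart hx1.1 hx3 e).2, ← Real.norm_eq_abs, mul_assoc]
  refine (ContinuousLinearMap.le_opNorm _ _).trans ?_
  exact mul_le_mul hx2.le (hx1.2.1 e) (norm_nonneg _) hM0.le

end LocalEstimates

/-! ### Local bounds for a smooth connection -/

section ConnectionEstimates

variable {X : Type*} [TopologicalSpace X] [ChartedSpace R4 X] [IsManifold (𝓡 4) ∞ X]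
  [RiemannianBundle (fun x : X => TangentSpace (𝓡 4) x)]
  [IsContMDiffRiemannianBundle (𝓡 4) ∞ R4 (fun x : X => TangentSpace (𝓡 4) x)]
  {F : Type*} [NormedAddCommGroup F] [InnerProductSpace ℝ F] [FiniteDimensional ℝ F]
  {V : X → Type*} [TopologicalSpace (TotalSpace F V)]
  [∀ x, NormedAddCommGroup (V x)] [∀ x, InnerProductSpace ℝ (V x)]
  [FiberBundle F V] [VectorBundle ℝ F V]
  [ContMDiffVectorBundle ∞ F V (𝓡 4)] [IsContMDiffRiemannianBundle (𝓡 4) ∞ F V]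

/-- A bump function extends the local frame to all of `X`, so that the smoothness of the connection,
which is applied to global smooth sections, bounds its covariant derivatives. -/
lemma exists_smoothOn_univ_eventuallyEq_symmL [T2Space X] (p : X) (w : F) :
    ∃ s : Π x, V x, SmoothOn F s univ ∧
      ∀ᶠ x in 𝓝 p, s x = (trivializationAt F V p).symmL ℝ x w := by
  obtain ⟨f, _, hf⟩ := (SmoothBumpFunction.nhds_basis_tsupport (I := 𝓡 4) p).mem_iff.1
    ((trivializationAt F V p).open_baseSet.mem_nhds
      (FiberBundle.mem_baseSet_trivializationAt' p))
  refine ⟨(f : X → ℝ) • fun x => (trivializationAt F V p).symmL ℝ x w, ?_, ?_⟩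
  · exact (ContMDiffOn.smul_section_of_tsupport f.contMDiff.contMDiffOn
      (trivializationAt F V p).open_baseSet hf (contMDiffOn_symmL _ w)).contMDiffOn
  · filter_upwards [f.eventuallyEq_one] with x hx
    simp [hx]

lemma SmoothOn.diffAt {u : Π x, V x} {N : Set X} (hu : SmoothOn F u N) {x : X} (hN : N ∈ 𝓝 x) :
    DiffAt F u x :=
  (hu.contMDiffAt hN).mdifferentiableAt (by simp)

lemma eventually_norm_section_le {s : Π x, V x} {p : X}
    (hs : ContMDiffAt (𝓡 4) ((𝓡 4).prod 𝓘(ℝ, F)) ∞ (fun x => (⟨x, s x⟩ : TotalSpace F V)) p) :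
    ∃ K : ℝ, 0 < K ∧ ∀ᶠ x in 𝓝 p, ‖s x‖ ≤ K := by
  have h1 : ContinuousAt (fun x => inner ℝ (s x) (s x)) p := (hs.inner_bundle hs).continuousAt
  have h2 : ContinuousAt (fun x => ‖s x‖) p := by
    have := h1.sqrt
    simpa [real_inner_self_eq_norm_sq] using this
  refine ⟨‖s p‖ + 1, by positivity, ?_⟩
  filter_upwards [h2.eventually_lt_const (u := ‖s p‖ + 1) (by simp)] with x hx using hx.le

variable (cov : CovariantDerivative (𝓡 4) F V)

/-- On the four coordinate vector fields `cov s` gives continuous, hence locally bounded, sections;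
a general `e` is expanded in them, with coefficients bounded by a multiple of `‖e‖`. -/
lemma eventually_norm_cov_le (hcov : CovariantDerivative.ContMDiffCovariantDerivative cov ∞)
    {s : Π x, V x} (hs : SmoothOn F s univ) (p : X) :
    ∃ K : ℝ, 0 < K ∧ ∀ᶠ x in 𝓝 p, ∀ e : TangentSpace (𝓡 4) x, ‖cov s x e‖ ≤ K * ‖e‖ := by
  obtain ⟨K, hK, hKp⟩ := eventually_norm_tangent_trivialization_le p
  have h1 := (hcov.contMDiff.contMDiff hs).contMDiffAt (x := p) univ_mem
  have h2 : ∀ i : Fin 4, ∃ K : ℝ, 0 < K ∧ ∀ᶠ x in 𝓝 p, ‖cov s x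
      ((trivializationAt R4 (TangentSpace (𝓡 4)) p).symmL ℝ x (EuclideanSpace.single i 1))‖ ≤ K :=
    fun i => by
      refine eventually_norm_section_le (F := F) (h1.clm_bundle_apply ?_)
      refine (contMDiffOn_symmL (I := 𝓡 4) (trivializationAt R4 (TangentSpace (𝓡 4)) p)
        (EuclideanSpace.single i 1)).contMDiffAt ((trivializationAt R4 _ p).open_baseSet.mem_nhds
        (FiberBundle.mem_baseSet_trivializationAt' p))
  choose M hM hMp using h2
  refine ⟨(∑ i, M i) * K, mul_pos (Finset.sum_pos (fun i _ => hM i) ⟨0, by simp⟩) hK, ?_⟩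
  filter_upwards [hKp, eventually_all.2 hMp] with x hx hx' e
  set w := (trivializationAt R4 (TangentSpace (𝓡 4)) p).continuousLinearMapAt ℝ x e
  have he : e = ∑ i, w i • (trivializationAt R4 (TangentSpace (𝓡 4)) p).symmL ℝ x
      (EuclideanSpace.single i 1) := by
    conv_lhs => rw [← symmL_continuousLinearMapAt_tangent hx.1 e]
    simp_rw [← map_smul, ← map_sum]
    congr 1
    have := (EuclideanSpace.basisFun (Fin 4) ℝ).sum_repr w
    simpa only [EuclideanSpace.basisFun_repr, EuclideanSpace.basisFun_apply] using this.symm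
  calc ‖cov s x e‖ = ‖∑ i, w i • cov s x ((trivializationAt R4 (TangentSpace (𝓡 4)) p).symmL ℝ x
      (EuclideanSpace.single i 1))‖ := by
        conv_lhs => rw [he]
        simp_rw [map_sum, map_smul]
    _ ≤ ∑ i, M i * (K * ‖e‖) := by
        refine (norm_sum_le _ _).trans (Finset.sum_le_sum fun i _ => ?_)
        rw [norm_smul, mul_comm]
        exact mul_le_mul (hx' i) ((PiLp.norm_apply_le w i).trans (hx.2.1 e)) (norm_nonneg _)
          (hM i).le
    _ = _ := by rw [← Finset.sum_mul, mul_assoc]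

lemma cov_sum_smul {ι : Type*} (t : Finset ι) {g : ι → X → ℝ} {s : ι → Π x, V x} {x : X}
    (hg : ∀ i ∈ t, MDifferentiableAt (𝓡 4) 𝓘(ℝ) (g i) x) (hs : ∀ i ∈ t, DiffAt F (s i) x)
    (e : TangentSpace (𝓡 4) x) :
    cov (∑ i ∈ t, g i • s i) x e
      = ∑ i ∈ t, (g i x • cov (s i) x e + mvfderiv (𝓡 4) (g i) x e • s i x) := by
  classical
  induction t using Finset.induction_on with
  | empty => simp
  | insert a t ha ih =>
    simp only [Finset.mem_insert, forall_eq_or_imp] at hg hs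
    have h1 : DiffAt F (g a • s a) x := hg.1.smul_section hs.1
    have h2 : DiffAt F (∑ i ∈ t, g i • s i) x := by
      have := MDifferentiableAt.sum_section (t := fun i => g i • s i)
        fun i hi => (hg.2 i hi).smul_section (hs.2 i hi)
      unfold DiffAt
      convert this using 3
      simp
    rw [Finset.sum_insert ha, Finset.sum_insert ha,
      cov.isCovariantDerivativeOn.add h1 h2 (mem_univ x), add_apply,
      ih hg.2 hs.2, cov.isCovariantDerivativeOn.leibniz hs.1 hg.1 (mem_univ x)]
    simp

/-- The section `u` read in the trivialization of `V` around `p`. -/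
def localRep (F : Type*) [NormedAddCommGroup F] [InnerProductSpace ℝ F]
    {V : X → Type*} [TopologicalSpace (TotalSpace F V)] [∀ x, NormedAddCommGroup (V x)]
    [∀ x, InnerProductSpace ℝ (V x)] [FiberBundle F V] [VectorBundle ℝ F V]
    (p : X) (u : Π x, V x) (x : X) : F :=
  (trivializationAt F V p).continuousLinearMapAt ℝ x (u x)

lemma DiffAt.localRep {p x : X} (hx : x ∈ (trivializationAt F V p).baseSet) {u : Π x, V x}
    (hu : DiffAt F u x) : MDifferentiableAt (𝓡 4) 𝓘(ℝ, F) (localRep F p u) x := by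
  have := ((trivializationAt F V p).mdifferentiableAt_section_iff (𝓡 4) u hx).1 hu
  refine this.congr_of_eventuallyEq ?_
  filter_upwards [(trivializationAt F V p).open_baseSet.mem_nhds hx] with y hy
  simp [ZTwoSpinor.localRep, Trivialization.continuousLinearMapAt_apply,
    Trivialization.coe_linearMapAt_of_mem _ hy]

/-- Near `x` the section is the combination of the frame `s i` with the components of `localRep F p
u` as coefficients. Locality and the Leibniz rule split its covariant derivative into the flat
derivative and a zeroth order term. -/
lemma cov_eq_of_frame {p x : X} (hx : x ∈ (trivializationAt F V p).baseSet)
    {ι : Type*} [Fintype ι] (b : OrthonormalBasis ι ℝ F) {s : ι → Π x, V x}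
    (hs : ∀ i, DiffAt F (s i) x)
    (hsx : ∀ i, ∀ᶠ y in 𝓝 x, s i y = (trivializationAt F V p).symmL ℝ y (b i))
    {u : Π x, V x} (hu : DiffAt F u x) (e : TangentSpace (𝓡 4) x) :
    cov u x e = (trivializationAt F V p).symmL ℝ x (mvfderiv (𝓡 4) (localRep F p u) x e)
      + ∑ i, inner ℝ (b i) (localRep F p u x) • cov (s i) x e := by
  have ha := hu.localRep hx
  have hgi : ∀ i, HasMFDerivAt (𝓡 4) 𝓘(ℝ) (fun y => inner ℝ (b i) (localRep F p u y)) x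
      ((innerSL ℝ (b i)).comp (mfderiv (𝓡 4) 𝓘(ℝ, F) (localRep F p u) x)) := fun i =>
    ((innerSL ℝ (b i)).hasMFDerivAt).comp x ha.hasMFDerivAt
  have hg' : ∀ i, mvfderiv (𝓡 4) (fun y => inner ℝ (b i) (localRep F p u y)) x e
      = inner ℝ (b i) (mvfderiv (𝓡 4) (localRep F p u) x e) := fun i =>
    congrArg (fun L : R4 →L[ℝ] ℝ => L e) (hgi i).mfderiv
  have hux : ∀ᶠ y in 𝓝 x, u y
      = (∑ i, (fun y => inner ℝ (b i) (localRep F p u y)) • s i) y := by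
    filter_upwards [(trivializationAt F V p).open_baseSet.mem_nhds hx, eventually_all.2 hsx]
      with y hy hsy
    have h1 := b.sum_repr' (localRep F p u y)
    simp only [Finset.sum_apply, Pi.smul_apply', hsy]
    simp_rw [← map_smul, ← map_sum]
    rw [h1, localRep, Trivialization.symmL_continuousLinearMapAt _ hy]
  have hdiff : DiffAt F (∑ i, (fun y => inner ℝ (b i) (localRep F p u y)) • s i) x := by
    have := MDifferentiableAt.sum_section (s := Finset.univ)
      (t := fun i => (fun y => inner ℝ (b i) (localRep F p u y)) • s i)
      fun i _ => (hgi i).mdifferentiableAt.smul_section (hs i)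
    unfold DiffAt
    convert this using 3
    simp
  rw [cov.isCovariantDerivativeOn.congr_of_eventuallyEq hu hdiff (s := univ) univ_mem hux,
    cov_sum_smul cov _ (fun i _ => (hgi i).mdifferentiableAt) (fun i _ => hs i),
    Finset.sum_add_distrib, add_comm]
  congr 1
  simp_rw [hg', (hsx _).self_of_nhds, ← map_smul, ← map_sum, b.sum_repr']

set_option synthInstance.maxHeartbeats 400000 in
lemma bilinear_sum_smul {ι W W' : Type*} [Fintype ι] [NormedAddCommGroup W] [NormedSpace ℝ W]
    [NormedAddCommGroup W'] [NormedSpace ℝ W'] (D : W →L[ℝ] W →L[ℝ] W' →L[ℝ] ℝ) (c : ι → ℝ)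
    (s : ι → W) (e : W') :
    D (∑ i, c i • s i) (∑ i, c i • s i) e
      = ∑ i : ι × ι, c i.1 * c i.2 * D (s i.1) (s i.2) e := by
  rw [Fintype.sum_prod_type]
  simp only [map_sum, map_smul, sum_apply, smul_apply, Finset.smul_sum, smul_eq_mul]
  rw [Finset.sum_comm]
  exact Finset.sum_congr rfl fun i _ => Finset.sum_congr rfl fun j _ => by ring

/-- In a chart and local trivialization, the derivative of a section is controlled by its covariant
derivative and its values. -/
lemma eventually_norm_mvfderiv_localRep_le [T2Space X]
    (hcov : CovariantDerivative.ContMDiffCovariantDerivative cov ∞) (p : X) :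
    ∃ K : ℝ, 0 < K ∧ ∀ᶠ x in 𝓝 p, ∀ u : Π x, V x, DiffAt F u x → ∀ e : TangentSpace (𝓡 4) x,
      ‖mvfderiv (𝓡 4) (localRep F p u) x e‖ ≤ K * (‖cov u x e‖ + ‖u x‖ * ‖e‖) := by
  set b := stdOrthonormalBasis ℝ F
  choose s hs hsp using fun i => exists_smoothOn_univ_eventuallyEq_symmL (V := V) p (b i)
  choose M hM hMp using fun i => eventually_norm_cov_le cov hcov (hs i) p
  obtain ⟨K, hK, hKp⟩ := eventually_norm_trivialization_le (F := F) (V := V) p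
  refine ⟨K + K * ∑ i, K * M i, add_pos_of_pos_of_nonneg hK (mul_nonneg hK.le
    (Finset.sum_nonneg fun i _ => (mul_pos hK (hM i)).le)), ?_⟩
  filter_upwards [hKp, eventually_all.2 hMp, (eventually_all.2 hsp).eventually_nhds]
    with x hx1 hx2 hx3 u hu e
  have h := cov_eq_of_frame cov hx1.1 b (fun i => (hs i).diffAt univ_mem)
    (fun i => hx3.mono fun y hy => hy i) hu e
  set A := ∑ i, inner ℝ (b i) (localRep F p u x) • cov (s i) x e with hA
  have hAn : ‖A‖ ≤ (∑ i, K * M i) * (‖u x‖ * ‖e‖) := by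
    rw [hA, Finset.sum_mul]
    refine (norm_sum_le _ _).trans (Finset.sum_le_sum fun i _ => ?_)
    have h1 : ‖(inner ℝ (b i) (localRep F p u x) : ℝ)‖ ≤ K * ‖u x‖ := by
      refine (norm_inner_le_norm _ _).trans ?_
      rw [b.norm_eq_one, one_mul]
      exact hx1.2.1 _
    rw [norm_smul]
    calc _ ≤ (K * ‖u x‖) * (M i * ‖e‖) :=
          mul_le_mul h1 (hx2 i e) (norm_nonneg _) (by positivity)
      _ = _ := by ring
  -- The frame formula is solved for the flat derivative: only the zeroth order term `A` has to be
  -- removed from `cov u x e`.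
  have h2 : mvfderiv (𝓡 4) (localRep F p u) x e
      = (trivializationAt F V p).continuousLinearMapAt ℝ x (cov u x e - A) := by
    rw [h, add_sub_cancel_right, Trivialization.continuousLinearMapAt_symmL _ hx1.1]
  rw [h2]
  calc _ ≤ K * ‖cov u x e - A‖ := hx1.2.1 _
    _ ≤ K * (‖cov u x e‖ + (∑ i, K * M i) * (‖u x‖ * ‖e‖)) := by
        gcongr; exact (norm_sub_le _ _).trans (by gcongr)
    _ ≤ _ := by
        have h3 : 0 ≤ K * ∑ i, K * M i := mul_nonneg hK.le
          (Finset.sum_nonneg fun i _ => (mul_pos hK (hM i)).le)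
        nlinarith [mul_nonneg h3 (norm_nonneg (cov u x e)),
          mul_nonneg hK.le (mul_nonneg (norm_nonneg (u x)) (norm_nonneg e))]

/-- The failure of `cov` to be metric is locally bounded. -/
lemma eventually_abs_mvfderiv_norm_sq_sub_le [T2Space X]
    (hcov : CovariantDerivative.ContMDiffCovariantDerivative cov ∞) (p : X) :
    ∃ K : ℝ, 0 < K ∧ ∀ᶠ x in 𝓝 p, ∀ u : Π x, V x, DiffAt F u x → ∀ e : TangentSpace (𝓡 4) x,
      |mvfderiv (𝓡 4) (fun y => (inner ℝ (u y) (u y) : ℝ)) x e - 2 * inner ℝ (cov u x e) (u x)|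
        ≤ K * ‖u x‖ ^ 2 * ‖e‖ := by
  have : ContMDiffVectorBundle 1 F V (𝓡 4) := .of_le (n := ∞) (by simp)
  have : IsContMDiffRiemannianBundle (𝓡 4) 1 F V := .of_le (n := ∞) (by simp)
  set b := stdOrthonormalBasis ℝ F
  choose s hs hsp using fun i => exists_smoothOn_univ_eventuallyEq_symmL (V := V) p (b i)
  choose M hM hMp using fun i => eventually_norm_cov_le cov hcov (hs i) p
  choose N hN hNp using fun i => eventually_norm_section_le ((hs i).contMDiffAt (x := p) univ_mem)
  choose R hR hRp using fun i : _ × _ => eventually_abs_mvfderiv_le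
    (((hs i.1).contMDiffAt (x := p) univ_mem).inner_bundle ((hs i.2).contMDiffAt univ_mem))
  obtain ⟨K, hK, hKp⟩ := eventually_norm_trivialization_le (F := F) (V := V) p
  set B : _ × _ → ℝ := fun i => R i + M i.1 * N i.2 + N i.1 * M i.2
  have hB : ∀ i, 0 < B i := fun i => add_pos (add_pos (hR i) (mul_pos (hM _) (hN _)))
    (mul_pos (hN _) (hM _))
  refine ⟨K * K * (∑ i, B i) + 1, add_pos_of_nonneg_of_pos (mul_nonneg (by positivity)
    (Finset.sum_nonneg fun i _ => (hB i).le)) one_pos, ?_⟩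
  filter_upwards [hKp, eventually_all.2 hMp, eventually_all.2 hNp, eventually_all.2 hRp,
    eventually_all.2 hsp] with x hx1 hx2 hx3 hx4 hx5 u hu e
  classical
  have hsd : ∀ i, DiffAt F (s i) x := fun i => (hs i).diffAt univ_mem
  -- The covariant derivative of the metric is a tensor, so its value on `u` depends on `u x` only.
  -- Bounds on the finitely many pairs of frame sections thus suffice, with a constant independent
  -- of `u`.
  set D := cov.derivMetricTensor x
  have hD : ∀ {σ τ : Π x, V x}, DiffAt F σ x → DiffAt F τ x → D (σ x) (τ x) e
      = mvfderiv (𝓡 4) (fun y => (inner ℝ (σ y) (τ y) : ℝ)) x e - inner ℝ (cov σ x e) (τ x)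
        - inner ℝ (σ x) (cov τ x e) := fun {σ τ} hσ hτ => by
    -- The tangent vector `e` is extended by zero to a discontinuous vector field; only its value at
    -- `x` matters.
    have := cov.derivMetricTensor_apply (X := fun y => if h : y = x then h ▸ e else 0) x hσ hτ
    simpa using this
  have h1 : mvfderiv (𝓡 4) (fun y => (inner ℝ (u y) (u y) : ℝ)) x e
      - 2 * inner ℝ (cov u x e) (u x) = D (u x) (u x) e := by
    rw [hD hu hu, real_inner_comm (cov u x e) (u x)]
    ring
  rw [h1]
  set c : _ → ℝ := fun i => inner ℝ (b i) (localRep F p u x) with hc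
  have hcb : ∀ i, |c i| ≤ K * ‖u x‖ := fun i => by
    refine (abs_real_inner_le_norm _ _).trans ?_
    rw [b.norm_eq_one, one_mul]
    exact hx1.2.1 _
  have hux : u x = ∑ i, c i • s i x := by
    simp_rw [hx5, ← map_smul, ← map_sum, hc, b.sum_repr']
    rw [localRep, Trivialization.symmL_continuousLinearMapAt _ hx1.1]
  have hDB : ∀ i j, |D (s i x) (s j x) e| ≤ B (i, j) * ‖e‖ := fun i j => by
    rw [hD (hsd i) (hsd j)]
    have e1 := hx4 (i, j) e
    have e2 : |(inner ℝ (cov (s i) x e) (s j x) : ℝ)| ≤ (M i * ‖e‖) * N j :=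
      (abs_real_inner_le_norm _ _).trans (mul_le_mul (hx2 i e) (hx3 j) (norm_nonneg _)
        (mul_nonneg (hM i).le (norm_nonneg _)))
    have e3 : |(inner ℝ (s i x) (cov (s j) x e) : ℝ)| ≤ N i * (M j * ‖e‖) :=
      (abs_real_inner_le_norm _ _).trans (mul_le_mul (hx3 i) (hx2 j e) (norm_nonneg _)
        (hN i).le)
    calc _ ≤ R (i, j) * ‖e‖ + (M i * ‖e‖) * N j + N i * (M j * ‖e‖) :=
          (abs_sub _ _).trans (add_le_add ((abs_sub _ _).trans (add_le_add e1 e2)) e3)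
      _ = _ := by simp only [B]; ring
  have h2 : D (u x) (u x) e = ∑ i : _ × _, c i.1 * c i.2 * D (s i.1 x) (s i.2 x) e := by
    conv_lhs => rw [hux]
    exact bilinear_sum_smul D c (fun i => s i x) e
  rw [h2]
  calc _ ≤ ∑ i : _ × _, (K * ‖u x‖) * (K * ‖u x‖) * (B i * ‖e‖) := by
        refine (Finset.abs_sum_le_sum_abs _ _).trans (Finset.sum_le_sum fun i _ => ?_)
        rw [abs_mul, abs_mul]
        exact mul_le_mul (mul_le_mul (hcb _) (hcb _) (abs_nonneg _) (by positivity))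
          (hDB _ _) (abs_nonneg _) (by positivity)
    _ = (K * K * ∑ i, B i) * (‖u x‖ ^ 2 * ‖e‖) := by
        rw [← Finset.mul_sum, ← Finset.sum_mul]; ring
    _ ≤ _ := by nlinarith [mul_nonneg (sq_nonneg ‖u x‖) (norm_nonneg e)]

end ConnectionEstimates

/-! ### Local lifts, and smooth 2-valued sections -/

section Lifts

variable {X : Type*} [TopologicalSpace X] [ChartedSpace R4 X] [IsManifold (𝓡 4) ∞ X]
  [RiemannianBundle (fun x : X => TangentSpace (𝓡 4) x)]
  [IsContMDiffRiemannianBundle (𝓡 4) ∞ R4 (fun x : X => TangentSpace (𝓡 4) x)]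
  {F : Type*} [NormedAddCommGroup F] [InnerProductSpace ℝ F] [FiniteDimensional ℝ F]
  {V : X → Type*} [TopologicalSpace (TotalSpace F V)]
  [∀ x, NormedAddCommGroup (V x)] [∀ x, InnerProductSpace ℝ (V x)]
  [FiberBundle F V] [VectorBundle ℝ F V]
  [ContMDiffVectorBundle ∞ F V (𝓡 4)] [IsContMDiffRiemannianBundle (𝓡 4) ∞ F V]

variable {U : Π x, Sym2 (V x)}

/-- Half the squared norm of a 2-valued section, which is `‖u‖²` where `U = [[u]] + [[-u]]`. -/
def halfNormSq (U : Π x, Sym2 (V x)) (x : X) : ℝ := pairNorm (U x) ^ 2 / 2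

lemma halfNormSq_eq {u : Π x, V x} {x : X} (h : U x = s(u x, -u x)) :
    halfNormSq U x = ‖u x‖ ^ 2 := by
  rw [halfNormSq, h, pairNorm_mk_neg_sq]; ring

lemma halfNormSq_nonneg (x : X) : 0 ≤ halfNormSq U x := by
  unfold halfNormSq; positivity

lemma halfNormSq_eq_zero {x : X} : halfNormSq U x = 0 ↔ x ∈ zeroLocus U := by
  rw [halfNormSq, div_eq_zero_iff]
  simp [zeroLocus, pairNorm_eq_zero]

lemma halfNormSq_pos {x : X} (hx : x ∉ zeroLocus U) : 0 < halfNormSq U x :=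
  (halfNormSq_nonneg x).lt_of_ne' (mt halfNormSq_eq_zero.1 hx)

lemma IsLift.eventually_eq {u : Π x, V x} {N : Set X} {x : X} (h : IsLift F U u N x) :
    ∀ᶠ y in 𝓝 x, U y = s(u y, -u y) := by
  filter_upwards [h.1.mem_nhds h.2.1] with y hy using h.2.2.2 y hy

lemma IsLift.contMDiffAt {u : Π x, V x} {N : Set X} {x : X} (h : IsLift F U u N x) :
    ContMDiffAt (𝓡 4) ((𝓡 4).prod 𝓘(ℝ, F)) ∞ (fun x => (⟨x, u x⟩ : TotalSpace F V)) x :=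
  ContMDiffOn.contMDiffAt h.2.2.1 (h.1.mem_nhds h.2.1)

lemma IsLift.diffAt {u : Π x, V x} {N : Set X} {x : X} (h : IsLift F U u N x) : DiffAt F u x :=
  h.contMDiffAt.mdifferentiableAt (by simp)

lemma IsLift.of_mem {u : Π x, V x} {N : Set X} {x y : X} (h : IsLift F U u N x) (hy : y ∈ N) :
    IsLift F U u N y := ⟨h.1, hy, h.2.2⟩

lemma IsLift.halfNormSq_eventuallyEq {u : Π x, V x} {N : Set X} {x : X} (h : IsLift F U u N x) :
    halfNormSq U =ᶠ[𝓝 x] fun y => inner ℝ (u y) (u y) :=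
  h.eventually_eq.mono fun y hy =>
    (halfNormSq_eq hy).trans (real_inner_self_eq_norm_sq (u y)).symm

lemma IsLift.contMDiffAt_halfNormSq {u : Π x, V x} {N : Set X} {x : X} (h : IsLift F U u N x) :
    ContMDiffAt (𝓡 4) 𝓘(ℝ) ∞ (halfNormSq U) x :=
  (h.contMDiffAt.inner_bundle h.contMDiffAt).congr_of_eventuallyEq h.halfNormSq_eventuallyEq

lemma pairNorm_le_of_trivialization {p x : X} {K : ℝ} (hK : 0 ≤ K)
    (hx : x ∈ (trivializationAt F V p).baseSet)
    (h : ∀ w : F, ‖(trivializationAt F V p).symmL ℝ x w‖ ≤ K * ‖w‖) (S : Sym2 (V x)) :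
    pairNorm S ≤ K * pairNorm (S.map ((trivializationAt F V p).continuousLinearMapAt ℝ x)) := by
  have : S = (S.map ((trivializationAt F V p).continuousLinearMapAt ℝ x)).map
      ((trivializationAt F V p).symmL ℝ x) := by
    induction S using Sym2.ind with
    | _ a b =>
      simp only [Sym2.map_mk]
      rw [Trivialization.symmL_continuousLinearMapAt _ hx,
        Trivialization.symmL_continuousLinearMapAt _ hx]
  conv_lhs => rw [this]
  exact pairNorm_map_le hK h

/-- Off the zero locus this is the squared norm of a smooth lift. At a zero it follows from
continuity of `U` in the trivialization around that point, where fibre norms are uniformly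
comparable with the norm of `F`. -/
lemma continuous_halfNormSq (hc : ContinuousSection F U)
    (hl : ∀ x ∉ zeroLocus U, ∃ u N, IsLift F U u N x) : Continuous (halfNormSq U) := by
  rw [continuous_iff_continuousAt]
  intro x
  by_cases hx : x ∈ zeroLocus U
  · have hx0 : halfNormSq U x = 0 := halfNormSq_eq_zero.2 hx
    obtain ⟨K, hK, hKx⟩ := eventually_norm_trivialization_le (F := F) (V := V) x
    have h0 : inTrivialization F U x x = s(0, 0) := by
      rw [inTrivialization, show U x = s(0, 0) from hx]; simp
    have h1 := hc x
    rw [h0] at h1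
    have h2 : Tendsto (fun y => (K * pairDist (inTrivialization F U x y) s(0, 0)) ^ 2 / 2) (𝓝 x)
        (𝓝 0) := by
      simpa using ((h1.const_mul K).pow 2).div_const 2
    rw [ContinuousAt, hx0]
    refine squeeze_zero' (.of_forall fun y => halfNormSq_nonneg y) ?_ h2
    filter_upwards [hKx] with y hy
    have := pairNorm_le_of_trivialization hK.le hy.1 hy.2.2 (U y)
    unfold halfNormSq
    have h3 := pairNorm_nonneg (U y)
    gcongr
    exact this
  · obtain ⟨u, N, hu⟩ := hl x hx
    exact hu.contMDiffAt_halfNormSq.continuousAt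

lemma isClosed_zeroLocus (hc : ContinuousSection F U)
    (hl : ∀ x ∉ zeroLocus U, ∃ u N, IsLift F U u N x) : IsClosed (zeroLocus U) := by
  have : zeroLocus U = halfNormSq U ⁻¹' {0} := by
    ext x
    exact halfNormSq_eq_zero.symm
  rw [this]
  exact isClosed_singleton.preimage (continuous_halfNormSq hc hl)

lemma eq_or_eq_neg_of_pair_eq {W : Type*} [AddCommGroup W] {a b : W} (h : s(a, -a) = s(b, -b)) :
    a = b ∨ a = -b := by
  rcases Sym2.eq_iff.1 h with h | h
  · exact Or.inl h.1
  · exact Or.inr h.1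

/-- Lifts are unique up to sign off the zero locus. -/
lemma IsLift.eventuallyEq_or_neg {u v : Π x, V x} {N M : Set X} {x : X} (hu : IsLift F U u N x)
    (hv : IsLift F U v M x) (hx : x ∉ zeroLocus U) :
    (∀ᶠ y in 𝓝 x, v y = u y) ∨ (∀ᶠ y in 𝓝 x, v y = -u y) := by
  have hcont : ContinuousAt (fun y => (inner ℝ (v y) (u y) : ℝ)) x :=
    (hv.contMDiffAt.inner_bundle hu.contMDiffAt).continuousAt
  have hne : 0 < ‖u x‖ ^ 2 := by
    rw [← halfNormSq_eq hu.eventually_eq.self_of_nhds]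
    exact halfNormSq_pos hx
  have hpm : ∀ᶠ y in 𝓝 x, v y = u y ∨ v y = -u y := by
    filter_upwards [hu.eventually_eq, hv.eventually_eq] with y h1 h2
    exact eq_or_eq_neg_of_pair_eq (h2.symm.trans h1)
  rcases hpm.self_of_nhds with h | h
  · left
    have : 0 < (inner ℝ (v x) (u x) : ℝ) := by rw [h, real_inner_self_eq_norm_sq]; exact hne
    filter_upwards [hpm, hcont.eventually_const_lt this] with y hy hy'
    refine hy.resolve_right fun hneg => ?_
    rw [hneg, inner_neg_left, real_inner_self_eq_norm_sq] at hy'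
    nlinarith [sq_nonneg ‖u y‖]
  · right
    have : (inner ℝ (v x) (u x) : ℝ) < 0 := by
      rw [h, inner_neg_left, real_inner_self_eq_norm_sq]; linarith
    filter_upwards [hpm, hcont.eventually_lt_const this] with y hy hy'
    refine hy.resolve_left fun hpos => ?_
    rw [hpos, real_inner_self_eq_norm_sq] at hy'
    nlinarith [sq_nonneg ‖u y‖]

/-! ### Sections in charts -/

lemma inTrivialization_eq_of_pair {p x : X} {a b : Π x, V x} (h : U x = s(a x, b x)) :
    inTrivialization F U p x = s(localRep F p a x, localRep F p b x) := by
  rw [inTrivialization, h]; rfl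

lemma localRep_neg {p x : X} (a : Π x, V x) :
    localRep F p (fun y => -a y) x = -localRep F p a x := by
  simp [localRep]

/-- A smooth section, read in a chart and a trivialization, is smooth. -/
lemma contDiffAt_localRep_chart {u : Π x, V x} {p x : X} (hx : x ∈ (chartAt R4 p).source)
    (hxb : x ∈ (trivializationAt F V p).baseSet)
    (hu : ContMDiffAt (𝓡 4) ((𝓡 4).prod 𝓘(ℝ, F)) ∞ (fun x => (⟨x, u x⟩ : TotalSpace F V)) x) :
    ContDiffAt ℝ ∞ (localRep F p u ∘ (chartAt R4 p).symm) (chartAt R4 p x) := by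
  have h1 := ((trivializationAt F V p).contMDiffAt_section_iff hxb).1 hu
  have h2 : ContMDiffAt (𝓡 4) 𝓘(ℝ, F) ∞ (localRep F p u) x := by
    refine h1.congr_of_eventuallyEq ?_
    filter_upwards [(trivializationAt F V p).open_baseSet.mem_nhds hxb] with y hy
    simp [localRep, Trivialization.continuousLinearMapAt_apply,
      Trivialization.coe_linearMapAt_of_mem _ hy]
  refine contMDiffAt_iff_contDiffAt.1 (ContMDiffAt.comp _ ?_ ?_ (I' := 𝓡 4))
  · rwa [(chartAt R4 p).left_inv hx]
  · exact (contMDiffOn_chart_symm (I := 𝓡 4) (x := p)).contMDiffAt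
      ((chartAt R4 p).open_target.mem_nhds ((chartAt R4 p).map_source hx))

lemma lipschitzOnWith_pairDist {a b : R4 → F} {t : Set R4} {K : NNReal} {f : R4 → Sym2 F}
    (ha : LipschitzOnWith K a t) (hb : LipschitzOnWith K b t) (hf : ∀ y ∈ t, f y = s(a y, b y))
    (T : Sym2 F) : LipschitzOnWith (2 * K) (fun y => pairDist (f y) T) t := by
  refine LipschitzOnWith.of_dist_le_mul fun y hy z hz => ?_
  simp only [hf y hy, hf z hz]
  rw [Real.dist_eq]
  refine (abs_pairDist_sub_le _ _ _ _ T (p := K * dist y z) ?_ ?_).trans_eq ?_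
  · rw [← dist_eq_norm]; exact ha.dist_le_mul y hy z hz
  · rw [← dist_eq_norm]; exact hb.dist_le_mul y hy z hz
  · push_cast; ring

lemma eventually_chart_symm {p : X} {P : X → Prop} (h : ∀ᶠ x in 𝓝 p, P x) :
    ∀ᶠ y in 𝓝 (chartAt R4 p p), P ((chartAt R4 p).symm y) := by
  have := (chartAt R4 p).continuousAt_symm (mem_chart_target R4 p)
  rw [ContinuousAt, (chartAt R4 p).left_inv (mem_chart_source R4 p)] at this
  exact this.eventually h

/-- Smooth 2-valued sections are locally of class `W^{1,2}`. -/
lemma SmoothSection.locallyW12 (hU : SmoothSection F U) : LocallyW12 F univ U := by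
  intro p _
  obtain ⟨f, g, N, hN, hpN, hf, hg, hfg⟩ := hU p
  have hps := mem_chart_source R4 p
  have hpb : p ∈ (trivializationAt F V p).baseSet := FiberBundle.mem_baseSet_trivializationAt' p
  set a : R4 → F := localRep F p f ∘ (chartAt R4 p).symm
  set b : R4 → F := localRep F p g ∘ (chartAt R4 p).symm
  have ha := contDiffAt_localRep_chart hps hpb
    (ContMDiffOn.contMDiffAt hf (hN.mem_nhds hpN))
  have hb := contDiffAt_localRep_chart hps hpb
    (ContMDiffOn.contMDiffAt hg (hN.mem_nhds hpN))
  obtain ⟨Ka, ta, hta, hKa⟩ := (ha.of_le (m := 1) (by simp)).exists_lipschitzOnWith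
  obtain ⟨Kb, tb, htb, hKb⟩ := (hb.of_le (m := 1) (by simp)).exists_lipschitzOnWith
  set K := max Ka Kb
  have hev : ∀ᶠ y in 𝓝 (chartAt R4 p p), y ∈ ta ∩ tb ∩ (chartAt R4 p).target ∧
      (chartAt R4 p).symm y ∈ N ∩ (trivializationAt F V p).baseSet := by
    filter_upwards [hta, htb, (chartAt R4 p).open_target.mem_nhds (mem_chart_target R4 p),
      eventually_chart_symm (P := fun x => x ∈ N) (hN.mem_nhds hpN),
      eventually_chart_symm (P := fun x => x ∈ (trivializationAt F V p).baseSet)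
        ((trivializationAt F V p).open_baseSet.mem_nhds hpb)] with y h1 h2 h3 h4 h5
    exact ⟨⟨⟨h1, h2⟩, h3⟩, h4, h5⟩
  obtain ⟨r, hr, hball⟩ := Metric.nhds_basis_closedBall.eventually_iff.1 hev
  set B := Metric.closedBall (chartAt R4 p p) r
  have hf' : ∀ y ∈ B, inTrivialization F U p ((chartAt R4 p).symm y) = s(a y, b y) :=
    fun y hy => inTrivialization_eq_of_pair (hfg _ (hball hy).2.1)
  have hlip : ∀ T, LipschitzOnWith (2 * K)
      (fun y => pairDist (inTrivialization F U p ((chartAt R4 p).symm y)) T) B := fun T =>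
    lipschitzOnWith_pairDist
      ((hKa.mono fun y hy => (hball hy).1.1.1).weaken (le_max_left _ _))
      ((hKb.mono fun y hy => (hball hy).1.1.2).weaken (le_max_right _ _)) hf' T
  have hfin : IsFiniteMeasure (volume.restrict (Metric.ball (chartAt R4 p p) r)) := ⟨by
    rw [Measure.restrict_apply_univ]; exact measure_ball_lt_top⟩
  refine ⟨Metric.ball (chartAt R4 p p) r, Metric.isOpen_ball, Metric.mem_ball_self hr,
    fun y hy => (hball (Metric.ball_subset_closedBall hy)).1.2,
    fun y hy => ⟨mem_univ _, (hball (Metric.ball_subset_closedBall hy)).2.2⟩, ?_,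
    fun _ _ => 2 * K, fun _ => memLp_const _, fun T => ?_⟩
  · obtain ⟨M, hM⟩ := (isCompact_closedBall (chartAt R4 p p) r).exists_bound_of_continuousOn
      (hlip s(0, 0)).continuousOn
    refine MemLp.of_bound (((hlip s(0, 0)).continuousOn.mono
      Metric.ball_subset_closedBall).aestronglyMeasurable measurableSet_ball) M ?_
    filter_upwards [ae_restrict_mem measurableSet_ball] with y hy
      using hM y (Metric.ball_subset_closedBall hy)
  -- Here the distance is Lipschitz on the whole ball, so no level is exceptional and `c₀ = 0` is an
  -- arbitrary choice.
  · have key := fun j : Fin 4 => exists_hasWeakPartial (c₀ := 0) j (φ := fun _ => 2 * (K : ℝ))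
      (hlip T).continuousOn (fun y _ _ => ⟨_, B, self_mem_nhdsWithin, hlip T⟩)
      (memLp_const _) (fun _ => by positivity) (fun y hy _ => by
        have hc : ContinuousAt (fun t : ℝ => y + t • (EuclideanSpace.single j 1 : R4)) 0 := by
          fun_prop
        have h1 : ∀ᶠ t : ℝ in 𝓝 0, y + t • (EuclideanSpace.single j 1 : R4) ∈
            Metric.ball (chartAt R4 p p) r :=
          hc.eventually_mem (Metric.isOpen_ball.mem_nhds (by simpa using hy))
        filter_upwards [h1] with t ht
        have := (hlip T).dist_le_mul _ (Metric.ball_subset_closedBall ht) _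
          (Metric.ball_subset_closedBall hy)
        simpa [Real.dist_eq, norm_smul] using this)
    choose g hg using key
    exact ⟨g, hg⟩

end Lifts

/-! ### Finite energy implies local Sobolev regularity -/

section SobolevRegularity
variable {X : Type*} [TopologicalSpace X] [ChartedSpace R4 X] [IsManifold (𝓡 4) ∞ X]
  [RiemannianBundle (fun x : X => TangentSpace (𝓡 4) x)]
  [IsContMDiffRiemannianBundle (𝓡 4) ∞ R4 (fun x : X => TangentSpace (𝓡 4) x)]
  {F : Type*} [NormedAddCommGroup F] [InnerProductSpace ℝ F] [FiniteDimensional ℝ F]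
  {V : X → Type*} [TopologicalSpace (TotalSpace F V)]
  [∀ x, NormedAddCommGroup (V x)] [∀ x, InnerProductSpace ℝ (V x)]
  [FiberBundle F V] [VectorBundle ℝ F V]
  [ContMDiffVectorBundle ∞ F V (𝓡 4)] [IsContMDiffRiemannianBundle (𝓡 4) ∞ F V]

variable {U : Π x, Sym2 (V x)}

lemma eventually_chart_symm_of_mem_target {p : X} {y : R4} (hy : y ∈ (chartAt R4 p).target)
    {P : X → Prop} (h : ∀ᶠ x in 𝓝 ((chartAt R4 p).symm y), P x) :
    ∀ᶠ z in 𝓝 y, P ((chartAt R4 p).symm z) :=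
  ((chartAt R4 p).continuousAt_symm hy).eventually h

/-- Two lifts differ near `x` by a sign, which the norm does not see. Hence the size of the partial
derivatives of the lifts is a well-defined function off the zero locus. -/
lemma norm_fderiv_localRep_eq {u v : Π x, V x} {N M : Set X} {p x : X}
    (hxs : x ∈ (chartAt R4 p).source) (hu : IsLift F U u N x)
    (hv : IsLift F U v M x) (hx : x ∉ zeroLocus U) (e : R4) :
    ‖fderiv ℝ (localRep F p u ∘ (chartAt R4 p).symm) (chartAt R4 p x) e‖ =
      ‖fderiv ℝ (localRep F p v ∘ (chartAt R4 p).symm) (chartAt R4 p x) e‖ := by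
  have ht := (chartAt R4 p).map_source hxs
  rcases hu.eventuallyEq_or_neg hv hx with h | h <;>
    rw [← (chartAt R4 p).left_inv hxs] at h <;>
    have h' := eventually_chart_symm_of_mem_target ht h
  · have : localRep F p v ∘ (chartAt R4 p).symm =ᶠ[𝓝 (chartAt R4 p x)]
        localRep F p u ∘ (chartAt R4 p).symm := by
      filter_upwards [h'] with z hz
      simp only [Function.comp, localRep, hz]
    rw [this.fderiv_eq]
  · have : localRep F p v ∘ (chartAt R4 p).symm =ᶠ[𝓝 (chartAt R4 p x)]
        fun z => -(localRep F p u ∘ (chartAt R4 p).symm) z := by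
      filter_upwards [h'] with z hz
      simp only [Function.comp, localRep, hz, map_neg]
    rw [this.fderiv_eq, fderiv_fun_neg]
    simp

/-- The norm of a partial derivative of the lifts, as a measurable function. -/
lemma exists_measurable_norm_partial [MeasurableSpace X] [BorelSpace X]
    (hc : ContinuousSection F U)
    (hl : ∀ x ∉ zeroLocus U, ∃ u N, IsLift F U u N x) (p : X) (e : R4) :
    ∃ Ψ : X → ℝ, Measurable Ψ ∧ (∀ x, 0 ≤ Ψ x) ∧ (∀ x ∈ zeroLocus U, Ψ x = 0) ∧
      ∀ x ∈ (chartAt R4 p).source ∩ (trivializationAt F V p).baseSet, x ∉ zeroLocus U →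
        ∀ u N, IsLift F U u N x →
          Ψ x = ‖fderiv ℝ (localRep F p u ∘ (chartAt R4 p).symm) (chartAt R4 p x) e‖ := by
  classical
  choose! u N hu using hl
  set A := ((chartAt R4 p).source ∩ (trivializationAt F V p).baseSet) ∩ (zeroLocus U)ᶜ
  have hA : IsOpen A := ((chartAt R4 p).open_source.inter
    (trivializationAt F V p).open_baseSet).inter
      (isClosed_zeroLocus hc (fun x hx => ⟨u x, N x, hu x hx⟩)).isOpen_compl
  set f : X → ℝ := fun x =>
    ‖fderiv ℝ (localRep F p (u x) ∘ (chartAt R4 p).symm) (chartAt R4 p x) e‖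
  have hf : ∀ x ∈ A, ∀ v M, IsLift F U v M x →
      f x = ‖fderiv ℝ (localRep F p v ∘ (chartAt R4 p).symm) (chartAt R4 p x) e‖ :=
    fun x hx v M hv => norm_fderiv_localRep_eq hx.1.1 (hu x hx.2) hv hx.2 e
  -- The lifts chosen at different points are unrelated, but near `x` the values of `f` may all be
  -- computed with the single lift chosen at `x`.
  have hcont : ContinuousOn f A := by
    intro x hx
    have h1 := contDiffAt_localRep_chart hx.1.1 hx.1.2 (hu x hx.2).contMDiffAt
    have h2 : ContinuousAt (fun z => ‖fderiv ℝ (localRep F p (u x) ∘ (chartAt R4 p).symm) z e‖)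
        (chartAt R4 p x) :=
      ((h1.fderiv_right (m := 0) (by simp)).continuousAt.clm_apply continuousAt_const).norm
    have h3 := ContinuousAt.comp (f := chartAt R4 p) h2 ((chartAt R4 p).continuousAt hx.1.1)
    refine (h3.congr ?_).continuousWithinAt
    filter_upwards [hA.mem_nhds hx, (hu x hx.2).1.mem_nhds (hu x hx.2).2.1] with y hy hyN
    exact (hf y hy _ _ ((hu x hx.2).of_mem hyN)).symm
  refine ⟨A.piecewise f 0, hcont.measurable_piecewise continuousOn_const hA.measurableSet,
    fun x => ?_, fun x hx => ?_, fun x hx hxZ v M hv => ?_⟩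
  · by_cases h : x ∈ A
    · rw [piecewise_eq_of_mem _ _ _ h]; exact norm_nonneg _
    · rw [piecewise_eq_of_notMem _ _ _ h]; rfl
  · rw [piecewise_eq_of_notMem _ _ _ fun h => h.2 hx]; rfl
  · have hxA : x ∈ A := ⟨hx, hxZ⟩
    rw [piecewise_eq_of_mem _ _ _ hxA]
    exact hf x hxA v M hv

lemma eventually_norm_sub_le_of_differentiableAt {a : R4 → F} {y e : R4}
    (ha : DifferentiableAt ℝ a y) {ε : ℝ} (hε : 0 < ε) :
    ∀ᶠ t : ℝ in 𝓝 0, ‖a (y + t • e) - a y‖ ≤ (‖fderiv ℝ a y e‖ + ε) * |t| := by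
  have h : HasDerivAt (fun t : ℝ => a (y + t • e)) (fderiv ℝ a y e) 0 :=
    ha.hasFDerivAt.hasLineDerivAt e
  have h2 := (h.isLittleO).def hε
  filter_upwards [h2] with t ht
  simp only [sub_zero, zero_smul, add_zero] at ht
  calc ‖a (y + t • e) - a y‖ = ‖(a (y + t • e) - a y - t • fderiv ℝ a y e) + t • fderiv ℝ a y e‖ := by
        rw [sub_add_cancel]
    _ ≤ ε * ‖t‖ + ‖t • fderiv ℝ a y e‖ := (norm_add_le _ _).trans (by gcongr)
    _ = _ := by rw [norm_smul, Real.norm_eq_abs]; ring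

/-- Off the zero locus the distances to a fixed pair are, in charts, distances to pairs of smooth
functions. -/
lemma IsLift.exists_chart {u : Π x, V x} {N : Set X} {p : X} {y : R4}
    (hy : y ∈ (chartAt R4 p).target)
    (hu : IsLift F U u N ((chartAt R4 p).symm y))
    (hb : (chartAt R4 p).symm y ∈ (trivializationAt F V p).baseSet) :
    ContDiffAt ℝ ∞ (localRep F p u ∘ (chartAt R4 p).symm) y ∧
      ∀ᶠ z in 𝓝 y, inTrivialization F U p ((chartAt R4 p).symm z) =
        s((localRep F p u ∘ (chartAt R4 p).symm) z, -(localRep F p u ∘ (chartAt R4 p).symm) z) := by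
  constructor
  · have := contDiffAt_localRep_chart ((chartAt R4 p).map_target hy) hb hu.contMDiffAt
    rwa [(chartAt R4 p).right_inv hy] at this
  · filter_upwards [eventually_chart_symm_of_mem_target hy hu.eventually_eq] with z hz
    rw [inTrivialization_eq_of_pair (b := fun y => -u y) hz, localRep_neg]
    rfl

lemma pairNorm_inTrivialization_le {p x : X} {K : ℝ} (hK : 0 ≤ K)
    (h : ∀ v : V x, ‖(trivializationAt F V p).continuousLinearMapAt ℝ x v‖ ≤ K * ‖v‖) :
    pairNorm (inTrivialization F U p x) ≤ K * √(2 * halfNormSq U x) := by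
  refine (pairNorm_map_le hK h).trans_eq ?_
  rw [halfNormSq, mul_div_cancel₀ _ two_ne_zero, Real.sqrt_sq (pairNorm_nonneg _)]

/-- Distances to fixed pairs, in charts, are continuous. -/
lemma continuousAt_pairDist_inTrivialization (hc : ContinuousSection F U)
    (hl : ∀ x ∉ zeroLocus U, ∃ u N, IsLift F U u N x) {p : X} {y : R4}
    (hy : y ∈ (chartAt R4 p).target)
    (hb : (chartAt R4 p).symm y ∈ (trivializationAt F V p).baseSet) {K : ℝ} (hK : 0 ≤ K)
    (h : ∀ᶠ z in 𝓝 y, ∀ v : V ((chartAt R4 p).symm z),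
      ‖(trivializationAt F V p).continuousLinearMapAt ℝ _ v‖ ≤ K * ‖v‖) (T : Sym2 F) :
    ContinuousAt (fun z => pairDist (inTrivialization F U p ((chartAt R4 p).symm z)) T) y := by
  by_cases hZ : (chartAt R4 p).symm y ∈ zeroLocus U
  · have h0 : inTrivialization F U p ((chartAt R4 p).symm y) = s(0, 0) := by
      rw [inTrivialization, show U _ = s(0, 0) from hZ]; simp
    have hq : ContinuousAt (fun z => 2 * (K * √(2 * halfNormSq U ((chartAt R4 p).symm z)))) y := by
      have := ContinuousAt.comp (continuous_halfNormSq hc hl).continuousAt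
        ((chartAt R4 p).continuousAt_symm hy)
      exact (((this.const_mul 2).sqrt).const_mul K).const_mul 2
    rw [ContinuousAt, halfNormSq_eq_zero.2 hZ, show 2 * (K * √(2 * 0)) = 0 by simp] at hq
    rw [ContinuousAt, tendsto_iff_norm_sub_tendsto_zero, h0]
    refine squeeze_zero' (.of_forall fun _ => norm_nonneg _) ?_ hq
    filter_upwards [h] with z hz
    refine (abs_pairDist_sub_zero_le _ T).trans ?_
    gcongr
    exact pairNorm_inTrivialization_le hK hz
  · obtain ⟨u, N, hu⟩ := hl _ hZ
    obtain ⟨ha, he⟩ := hu.exists_chart hy hb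
    obtain ⟨L, t, ht, hL⟩ := (ha.of_le (m := 1) (by simp)).exists_lipschitzOnWith
    have h1 := lipschitzOnWith_pairDist (f := fun z => s(_, _)) hL hL.neg (fun _ _ => rfl) T
    refine (h1.continuousOn.continuousAt ht).congr ?_
    filter_upwards [he] with z hz
    rw [hz]; rfl

end SobolevRegularity

section SobolevRegularity
variable {X : Type*} [TopologicalSpace X] [ChartedSpace R4 X] [IsManifold (𝓡 4) ∞ X]
  [RiemannianBundle (fun x : X => TangentSpace (𝓡 4) x)]
  [IsContMDiffRiemannianBundle (𝓡 4) ∞ R4 (fun x : X => TangentSpace (𝓡 4) x)]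
  {F : Type*} [NormedAddCommGroup F] [InnerProductSpace ℝ F] [FiniteDimensional ℝ F]
  {V : X → Type*} [TopologicalSpace (TotalSpace F V)]
  [∀ x, NormedAddCommGroup (V x)] [∀ x, InnerProductSpace ℝ (V x)]
  [FiberBundle F V] [VectorBundle ℝ F V]
  [ContMDiffVectorBundle ∞ F V (𝓡 4)] [IsContMDiffRiemannianBundle (𝓡 4) ∞ F V]

variable {U : Π x, Sym2 (V x)}

/-- In charts, the partial derivatives of a lift are controlled by its covariant derivative. -/
lemma IsLift.norm_fderiv_localRep_sq_le {cov : CovariantDerivative (𝓡 4) F V} {u : Π x, V x}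
    {N : Set X} {p x : X} {K₂ K₃ M : ℝ} (hu : IsLift F U u N x)
    (hxs : x ∈ (chartAt R4 p).source) (hxb : x ∈ (trivializationAt F V p).baseSet)
    (hT : ∀ w : R4, ‖(trivializationAt R4 (fun x : X => TangentSpace (𝓡 4) x) p).symmL ℝ x w‖
      ≤ K₂ * ‖w‖)
    (hD : ∀ u : Π x, V x, DiffAt F u x → ∀ e : TangentSpace (𝓡 4) x,
      ‖mvfderiv (𝓡 4) (localRep F p u) x e‖ ≤ K₃ * (‖cov u x e‖ + ‖u x‖ * ‖e‖))
    (hM : halfNormSq U x ≤ M) {e : R4} (he : ‖e‖ = 1) :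
    ‖fderiv ℝ (localRep F p u ∘ (chartAt R4 p).symm) (chartAt R4 p x) e‖ ^ 2 ≤
      2 * (K₃ * K₂) ^ 2 * (derivNormSq (cov u x) + M) := by
  set e' : TangentSpace (𝓡 4) x :=
    (trivializationAt R4 (fun x : X => TangentSpace (𝓡 4) x) p).symmL ℝ x e with he'
  have hxT : x ∈ (trivializationAt R4 (fun x : X => TangentSpace (𝓡 4) x) p).baseSet := by
    simpa using hxs
  have h1 : (trivializationAt R4 (fun x : X => TangentSpace (𝓡 4) x) p).continuousLinearMapAt ℝ x
      e' = e := Trivialization.continuousLinearMapAt_symmL _ hxT e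
  have hd := mvfderiv_eq_fderiv_chart hxs (hu.diffAt.localRep hxb) e'
  rw [h1] at hd
  rw [← hd.2]
  have hn : ‖e'‖ ≤ K₂ := by simpa [he] using hT e
  have hq : ‖u x‖ ^ 2 ≤ M := (halfNormSq_eq hu.eventually_eq.self_of_nhds).symm.trans_le hM
  have h2 := norm_apply_sq_le_derivNormSq (cov u x) e'
  have h3 : ‖mvfderiv (𝓡 4) (localRep F p u) x e'‖ ^ 2 ≤
      (K₃ * (‖cov u x e'‖ + ‖u x‖ * ‖e'‖)) ^ 2 := by
    gcongr; exact hD u hu.diffAt e'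
  have h4 : ‖e'‖ ^ 2 ≤ K₂ ^ 2 := by gcongr
  have h5 : 0 ≤ derivNormSq (cov u x) := derivNormSq_nonneg _
  calc _ ≤ _ := h3
    _ ≤ 2 * K₃ ^ 2 * (‖cov u x e'‖ ^ 2 + ‖u x‖ ^ 2 * ‖e'‖ ^ 2) := by
        nlinarith [sq_nonneg (K₃ * (‖cov u x e'‖ - ‖u x‖ * ‖e'‖))]
    _ ≤ 2 * K₃ ^ 2 * (derivNormSq (cov u x) * K₂ ^ 2 + M * K₂ ^ 2) := by
        gcongr
        · exact h2.trans (by gcongr)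
        · exact (sq_nonneg _).trans hq
    _ = _ := by ring

lemma IsLift.ofReal_derivNormSq_le_energyDensity (C : CliffordStructure X F V) {u : Π x, V x}
    {N : Set X} {x : X} (hu : IsLift F U u N x) :
    ENNReal.ofReal (derivNormSq (C.conn u x)) ≤ energyDensity C U x :=
  le_iSup_of_le u (le_iSup_of_le N (le_iSup_of_le hu le_rfl))

lemma memLp_two_of_lintegral_sq_lt_top {α : Type*} {m : MeasurableSpace α} {μ : Measure α}
    {f : α → ℝ} (hf : AEStronglyMeasurable f μ) (h : ∫⁻ y, ENNReal.ofReal (f y ^ 2) ∂μ < ⊤) :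
    MemLp f 2 μ := by
  rw [memLp_two_iff_integrable_sq hf]
  refine ⟨hf.pow 2, ?_⟩
  rw [hasFiniteIntegral_iff_ofReal (.of_forall fun y => sq_nonneg _)]
  exact h

/-- A 2-valued section which is locally `[[u]] + [[-u]]` off its zero locus and has finite energy
there is locally of class `W^{1,2}`. -/
theorem locallyW12_of_finite_energy [T2Space X] [MeasurableSpace X] [BorelSpace X]
    (C : CliffordStructure X F V) (hc : ContinuousSection F U)
    (hl : ∀ x ∉ zeroLocus U, ∃ u N, IsLift F U u N x)
    (hfin : ∫⁻ x in (zeroLocus U)ᶜ, energyDensity C U x ∂(riemannianVolume X) < ⊤)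
    {Ω : Set X} (hΩ : IsOpen Ω) : LocallyW12 F Ω U := by
  intro p hp
  obtain ⟨K₁, hK₁, h₁⟩ := eventually_norm_trivialization_le (F := F) (V := V) p
  obtain ⟨K₂, hK₂, h₂⟩ := eventually_norm_tangent_trivialization_le p
  obtain ⟨K₃, hK₃, h₃⟩ := eventually_norm_mvfderiv_localRep_le C.conn C.smooth_conn p
  obtain ⟨K₄, hK₄, h₄⟩ := eventually_sqrt_gram_det p
  obtain ⟨W, hW, hWfin⟩ := exists_nhds_riemannianVolume_lt_top p
  set M := halfNormSq U p + 1 with hMdef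
  have hM : 0 < M := by linarith [halfNormSq_nonneg (U := U) p]
  have hqM : ∀ᶠ x in 𝓝 p, halfNormSq U x < M :=
    (continuous_halfNormSq hc hl).continuousAt.eventually_lt_const (by linarith)
  have hX : ∀ᶠ x in 𝓝 p, (x ∈ (trivializationAt F V p).baseSet ∧
      (∀ v : V x, ‖(trivializationAt F V p).continuousLinearMapAt ℝ x v‖ ≤ K₁ * ‖v‖)) ∧
      (∀ w : R4, ‖(trivializationAt R4 (fun x : X => TangentSpace (𝓡 4) x) p).symmL ℝ x w‖
        ≤ K₂ * ‖w‖) ∧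
      (∀ u : Π x, V x, DiffAt F u x → ∀ e : TangentSpace (𝓡 4) x,
        ‖mvfderiv (𝓡 4) (localRep F p u) x e‖ ≤ K₃ * (‖C.conn u x e‖ + ‖u x‖ * ‖e‖)) ∧
      x ∈ W ∧ halfNormSq U x < M ∧ x ∈ Ω := by
    filter_upwards [h₁, h₂, h₃, hW, hqM, hΩ.mem_nhds hp] with x a1 a2 a3 a4 a5 a6
    exact ⟨⟨a1.1, a1.2.1⟩, a2.2.2, a3, a4, a5, a6⟩
  have hev := (eventually_chart_symm hX).and (h₄.and
    ((chartAt R4 p).open_target.mem_nhds (mem_chart_target R4 p)))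
  obtain ⟨R, hR, hbig⟩ := Metric.eventually_nhds_iff_ball.1 hev
  set c := chartAt R4 p p
  -- All estimates hold on the ball of radius `R`. Halving the radius makes them available in a full
  -- neighbourhood of every point of the closed ball, including its boundary.
  set r := R / 2
  have hr : 0 < r := half_pos hR
  have hsub : Metric.closedBall c r ⊆ Metric.ball c R :=
    Metric.closedBall_subset_ball (half_lt_self hR)
  have hball := fun y (hy : y ∈ Metric.closedBall c r) => hbig y (hsub hy)
  set O := Metric.ball c r
  have hgood := fun y (hy : y ∈ O) => hball _ (Metric.ball_subset_closedBall hy)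
  choose Ψ hΨm hΨ0 hΨZ hΨ using fun j : Fin 4 =>
    exists_measurable_norm_partial hc hl p (EuclideanSpace.single j (1 : ℝ))
  have hfinO : IsFiniteMeasure (volume.restrict O) := ⟨by
    rw [Measure.restrict_apply_univ]; exact measure_ball_lt_top⟩
  set h : Sym2 F → R4 → ℝ := fun T y =>
    pairDist (inTrivialization F U p ((chartAt R4 p).symm y)) T
  have hcont : ∀ T, ContinuousOn (h T) (Metric.closedBall c r) := by
    intro T y hy
    refine (continuousAt_pairDist_inTrivialization hc hl (hball _ hy).2.2 (hball _ hy).1.1.1 hK₁.le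
      ?_ T).continuousWithinAt
    filter_upwards [Metric.isOpen_ball.mem_nhds (hsub hy)] with z hz using (hbig z hz).1.1.2
  have hsource : ∀ y ∈ (chartAt R4 p).target,
      (chartAt R4 p).symm y ∈ (chartAt R4 p).source := fun y hy => (chartAt R4 p).map_target hy
  -- On the zero locus the distance to `T` has the constant value `pairDist s(0, 0) T`. Taking this
  -- value as the exceptional level keeps all differentiation where lifts exist.
  have hoff : ∀ y ∈ Metric.closedBall c r, ∀ T, h T y ≠ pairDist s(0, 0) T →
      (chartAt R4 p).symm y ∉ zeroLocus U := by
    intro y hy T hne hZ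
    refine hne ?_
    simp only [h, inTrivialization, show U ((chartAt R4 p).symm y) = s(0, 0) from hZ]
    simp
  have hΨL : ∀ j, MemLp (fun y => Ψ j ((chartAt R4 p).symm y)) 2 (volume.restrict O) := by
    intro j
    have hO : O ⊆ (chartAt R4 p).target := fun y hy => (hgood y hy).2.2
    refine memLp_two_of_lintegral_sq_lt_top ?_ ?_
    · exact ((hΨm j).comp_aemeasurable ((aemeasurable_chart_symm p volume).mono_measure
        (Measure.restrict_mono hO le_rfl))).aestronglyMeasurable
    refine (lintegral_le_mul_lintegral_riemannianVolume p Metric.isOpen_ball hO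
      (fun y hy => (hgood y hy).2.1.2.le) ((hΨm j).pow_const 2).ennreal_ofReal).trans_lt ?_
    refine ENNReal.mul_lt_top ENNReal.ofReal_lt_top ?_
    set A := (chartAt R4 p).source ∩ (chartAt R4 p) ⁻¹' O
    have hAm : MeasurableSet A :=
      ((chartAt R4 p).isOpen_inter_preimage Metric.isOpen_ball).measurableSet
    have hAgood : ∀ x ∈ A, _ := fun x hx => (hgood _ hx.2).1
    have hZm : MeasurableSet (zeroLocus U)ᶜ := (isClosed_zeroLocus hc hl).measurableSet.compl
    have hAW : riemannianVolume X A < ⊤ := by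
      refine (measure_mono fun x hx => ?_).trans_lt hWfin
      have := (hAgood x hx).2.2.2.1
      rwa [(chartAt R4 p).left_inv hx.1] at this
    set κ := 2 * (K₃ * K₂) ^ 2
    have hκ : 0 ≤ κ := by positivity
    -- The integral of the sum is split by measurability of the constant term alone; measurability
    -- of the energy density is not required.
    calc ∫⁻ x in A, ENNReal.ofReal (Ψ j x ^ 2) ∂(riemannianVolume X)
        ≤ ∫⁻ x in A, (ENNReal.ofReal κ * (zeroLocus U)ᶜ.indicator (energyDensity C U) x
            + ENNReal.ofReal (κ * M)) ∂(riemannianVolume X) := by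
          refine setLIntegral_mono' hAm fun x hx => ?_
          by_cases hxZ : x ∈ zeroLocus U
          · rw [hΨZ j x hxZ]; simp
          obtain ⟨u, N, hu⟩ := hl x hxZ
          have hx' := hAgood x hx
          rw [(chartAt R4 p).left_inv hx.1] at hx'
          rw [indicator_of_mem (show x ∈ (zeroLocus U)ᶜ from hxZ),
            hΨ j x ⟨hx.1, hx'.1.1⟩ hxZ u N hu]
          have := hu.norm_fderiv_localRep_sq_le hx.1 hx'.1.1 hx'.2.1 hx'.2.2.1 hx'.2.2.2.2.1.le
            (e := EuclideanSpace.single j 1) (by simp)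
          refine (ENNReal.ofReal_le_ofReal this).trans ?_
          rw [mul_add, ENNReal.ofReal_add (mul_nonneg hκ (derivNormSq_nonneg _)) (by positivity),
            ENNReal.ofReal_mul hκ]
          gcongr
          exact hu.ofReal_derivNormSq_le_energyDensity C
      _ = ENNReal.ofReal κ * ∫⁻ x in A, (zeroLocus U)ᶜ.indicator (energyDensity C U) x
            ∂(riemannianVolume X) + ENNReal.ofReal (κ * M) * riemannianVolume X A := by
          rw [lintegral_add_right _ measurable_const, setLIntegral_const,
            lintegral_const_mul' _ _ ENNReal.ofReal_ne_top]
      _ < ⊤ := by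
          refine ENNReal.add_lt_top.2 ⟨ENNReal.mul_lt_top ENNReal.ofReal_lt_top ?_,
            ENNReal.mul_lt_top ENNReal.ofReal_lt_top hAW⟩
          refine (setLIntegral_le_lintegral _ _).trans_lt ?_
          rwa [lintegral_indicator hZm]
  -- The difference quotients of the lift are at most `Ψ + 1/2` for small increments, by the
  -- definition of the derivative. `abs_pairDist_sub_le` doubles this to `2 * Ψ + 1`.
  set φ : Fin 4 → R4 → ℝ := fun j y => 2 * Ψ j ((chartAt R4 p).symm y) + 1
  have hφ : ∀ j, MemLp (φ j) 2 (volume.restrict O) := fun j =>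
    ((hΨL j).const_mul 2).add (memLp_const 1)
  refine ⟨O, Metric.isOpen_ball, Metric.mem_ball_self hr, fun y hy => (hgood y hy).2.2,
    fun y hy => ⟨(hgood y hy).1.2.2.2.2.2, (hgood y hy).1.1.1⟩, ?_, φ, hφ, fun T => ?_⟩
  · obtain ⟨B, hB⟩ := (isCompact_closedBall c r).exists_bound_of_continuousOn (hcont s(0, 0))
    refine MemLp.of_bound (((hcont s(0, 0)).mono
      Metric.ball_subset_closedBall).aestronglyMeasurable measurableSet_ball) B ?_
    filter_upwards [ae_restrict_mem measurableSet_ball] with y hy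
      using hB y (Metric.ball_subset_closedBall hy)
  · have key := fun j : Fin 4 => exists_hasWeakPartial
      (c₀ := pairDist s(0, 0) T) j (hcont T) (fun y hy hne => ?_) (hφ j)
      (fun y => add_nonneg (mul_nonneg zero_le_two (hΨ0 j _)) zero_le_one) (fun y hy hne => ?_)
    · choose g hg using key
      exact ⟨g, hg⟩
    · obtain ⟨u, N, hu⟩ := hl _ (hoff y hy T hne)
      obtain ⟨ha, he⟩ := hu.exists_chart (hball _ hy).2.2 (hball _ hy).1.1.1
      obtain ⟨L, t, ht, hL⟩ := (ha.of_le (m := 1) (by simp)).exists_lipschitzOnWith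
      refine ⟨2 * L, t ∩ {z | _}, mem_nhdsWithin_of_mem_nhds (inter_mem ht he), ?_⟩
      exact lipschitzOnWith_pairDist (hL.mono inter_subset_left) (hL.neg.mono inter_subset_left)
        (fun z hz => hz.2) T
    · have hy' := Metric.ball_subset_closedBall hy
      have hZ := hoff y hy' T hne
      obtain ⟨u, N, hu⟩ := hl _ hZ
      obtain ⟨ha, he⟩ := hu.exists_chart (hball _ hy').2.2 (hball _ hy').1.1.1
      have hΨe := hΨ j _ ⟨hsource y (hball _ hy').2.2, (hball _ hy').1.1.1⟩ hZ u N hu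
      rw [(chartAt R4 p).right_inv (hball _ hy').2.2] at hΨe
      have hd := eventually_norm_sub_le_of_differentiableAt (e := EuclideanSpace.single j (1 : ℝ))
        (ha.differentiableAt (by simp)) (half_pos one_pos)
      have hline : ContinuousAt (fun t : ℝ => y + t • (EuclideanSpace.single j 1 : R4)) 0 := by
        fun_prop
      have he' := hline.eventually (p := fun z => inTrivialization F U p ((chartAt R4 p).symm z)
        = _) (by simpa using he)
      filter_upwards [hd, he'] with t ht hte
      simp only [h, hte, he.self_of_nhds, φ, hΨe]
      refine (abs_pairDist_sub_le _ _ _ _ T ht ?_).trans_eq (by ring)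
      rwa [← neg_sub', norm_neg]

end SobolevRegularity

/-! ### Approximate jets, on and off the zero locus -/

section Jets
variable {X : Type*} [TopologicalSpace X] [ChartedSpace R4 X] [IsManifold (𝓡 4) ∞ X]
  [RiemannianBundle (fun x : X => TangentSpace (𝓡 4) x)]
  [IsContMDiffRiemannianBundle (𝓡 4) ∞ R4 (fun x : X => TangentSpace (𝓡 4) x)]
  {F : Type*} [NormedAddCommGroup F] [InnerProductSpace ℝ F] [FiniteDimensional ℝ F]
  {V : X → Type*} [TopologicalSpace (TotalSpace F V)]
  [∀ x, NormedAddCommGroup (V x)] [∀ x, InnerProductSpace ℝ (V x)]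
  [FiberBundle F V] [VectorBundle ℝ F V]
  [ContMDiffVectorBundle ∞ F V (𝓡 4)] [IsContMDiffRiemannianBundle (𝓡 4) ∞ F V]

variable {U : Π x, Sym2 (V x)} (C : CliffordStructure X F V)

lemma jetSq_neg {x : X} (w : V x × (TangentSpace (𝓡 4) x →L[ℝ] V x)) : jetSq (-w) = jetSq w := by
  simp [jetSq, derivNormSq_neg]

lemma gradSq_mk_neg {x : X} (w : V x × (TangentSpace (𝓡 4) x →L[ℝ] V x)) :
    gradSq s(w, -w) = 2 * derivNormSq w.2 := by
  rw [gradSq, Sym2.map_mk, pairDistSq_mk]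
  simp [derivNormSq_neg, two_mul]

lemma pairDistSq_jetSq_mk_neg_le {x : X} (w w' : V x × (TangentSpace (𝓡 4) x →L[ℝ] V x)) :
    pairDistSq jetSq s(w, -w) s(w', -w') ≤ 2 * jetSq (w - w') := by
  rw [pairDistSq_mk]
  refine (min_le_left _ _).trans_eq ?_
  rw [show -w - -w' = -(w - w') by abel, jetSq_neg, two_mul]

lemma dirac_neg {x : X} (L : TangentSpace (𝓡 4) x →L[ℝ] V x) : dirac C (-L) = -dirac C L := by
  simp [dirac]

lemma dirac_zero {x : X} : dirac C (0 : TangentSpace (𝓡 4) x →L[ℝ] V x) = 0 := by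
  simp [dirac]

lemma DiffAt.smul {u : Π x, V x} {x : X} (hu : DiffAt F u x) {g : X → ℝ}
    (hg : MDifferentiableAt (𝓡 4) 𝓘(ℝ) g x) : DiffAt F (fun y => g y • u y) x :=
  hg.smul_section hu

lemma cov_smul_apply (cov : CovariantDerivative (𝓡 4) F V) {u : Π x, V x} {x : X}
    (hu : DiffAt F u x) {g : X → ℝ} (hg : MDifferentiableAt (𝓡 4) 𝓘(ℝ) g x)
    (e : TangentSpace (𝓡 4) x) :
    cov (fun y => g y • u y) x e = g x • cov u x e + mvfderiv (𝓡 4) g x e • u x := by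
  have := cov_sum_smul cov (Finset.univ : Finset Unit) (g := fun _ => g) (s := fun _ => u)
    (fun _ _ => hg) (fun _ _ => hu) e
  simp only [Finset.univ_unique, Finset.sum_singleton] at this
  exact this

lemma DiffAt.neg {u : Π x, V x} {x : X} (hu : DiffAt F u x) : DiffAt F (fun y => -u y) x := by
  have := hu.smul (g := fun _ => (-1 : ℝ)) mdifferentiableAt_const
  simpa using this

lemma cov_neg (cov : CovariantDerivative (𝓡 4) F V) {u : Π x, V x} {x : X} (hu : DiffAt F u x) :
    cov (fun y => -u y) x = -cov u x := by
  ext e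
  have := cov_smul_apply cov hu (g := fun _ => (-1 : ℝ)) mdifferentiableAt_const e
  have h0 : mvfderiv (𝓡 4) (fun _ : X => (-1 : ℝ)) x e = 0 := by
    simp [mvfderiv]
  simpa [h0] using this

variable [MeasurableSpace X]

lemma densityOne_univ {φ : OpenPartialHomeomorph X R4} {x : X} (hx : x ∈ φ.source) :
    DensityOne φ univ x := by
  refine ⟨MeasurableSet.univ, tendsto_const_nhds.congr' ?_⟩
  obtain ⟨R, hR, h⟩ := Metric.isOpen_iff.1 φ.open_target _ (φ.map_source hx)
  filter_upwards [Ioo_mem_nhdsGT hR] with r hr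
  have h1 : Metric.closedBall (φ x) r ⊆ φ.target :=
    (Metric.closedBall_subset_ball hr.2).trans h
  rw [preimage_univ, inter_univ, inter_eq_right.2 h1, ENNReal.div_self
    (Metric.measure_closedBall_pos volume _ hr.1).ne' measure_closedBall_lt_top.ne]

/-- A differentiable lift determines the approximate jet. -/
lemma hasApproxJet_of_lift {u : Π x, V x} {x : X} (hu : DiffAt F u x)
    (h : ∀ᶠ y in 𝓝 x, U y = s(u y, -u y)) (h0 : u x = 0 → C.conn u x = 0) :
    HasApproxJet C U x s((u x, C.conn u x), -(u x, C.conn u x)) := by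
  refine ⟨u, fun y => -u y, hu, hu.neg, h.self_of_nhds, ?_, fun hx => ?_, chartAt R4 x,
    chart_mem_atlas R4 x, mem_chart_source R4 x, univ, densityOne_univ (mem_chart_source R4 x), ?_⟩
  · rw [cov_neg _ hu]; rfl
  · have h2 : (2 : ℝ) • u x = 0 := by rw [two_smul]; exact add_eq_zero_iff_eq_neg.2 hx
    have : u x = 0 := (smul_eq_zero.1 h2).resolve_left two_ne_zero
    rw [cov_neg _ hu, h0 this, neg_zero]
  · rw [nhdsWithin_univ]
    refine (Asymptotics.isLittleO_zero _ _).congr' ?_ EventuallyEq.rfl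
    filter_upwards [h] with y hy
    rw [hy, pairDist_self]

/-- At points where the zero locus has density one, the approximate jet is zero. -/
lemma hasApproxJet_zero {x p : X} (hxp : x ∈ (chartAt R4 p).source) (hx : x ∈ zeroLocus U)
    (hd : DensityOne (chartAt R4 p) (zeroLocus U) x) :
    HasApproxJet C U x s(0, -0) := by
  have h0 : DiffAt F (0 : Π x, V x) x :=
    ((Bundle.contMDiff_zeroSection ℝ V (n := 1)) x).mdifferentiableAt (by simp)
  have hc : C.conn (0 : Π x, V x) x = 0 := by rw [C.conn.zero]; rfl
  refine ⟨0, 0, h0, h0, hx, ?_, fun _ => rfl, chartAt R4 p, chart_mem_atlas R4 p, hxp,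
    zeroLocus U, hd, ?_⟩
  · rw [hc, neg_zero]; rfl
  · refine (Asymptotics.isLittleO_zero _ _).congr' ?_ EventuallyEq.rfl
    filter_upwards [self_mem_nhdsWithin] with y hy
    rw [show U y = s(0, 0) from hy]
    exact (pairDist_self _).symm

/-- Lebesgue's density theorem is applied to the zero locus in each chart. This settles the
derivative there even when the zero locus has positive measure. -/
lemma ae_hasApproxJet_zero [SecondCountableTopology X] [BorelSpace X]
    (hZ : MeasurableSet (zeroLocus U)) :
    ∀ᵐ x ∂(riemannianVolume X), x ∈ zeroLocus U → HasApproxJet C U x s(0, -0) := by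
  have : IsManifold (𝓡 4) 1 X := .of_le (n := ∞) (by simp)
  refine riemannianVolume_eq_zero_of_forall_chart fun p => ?_
  set S := (chartAt R4 p).symm ⁻¹' zeroLocus U ∩ (chartAt R4 p).target
  have hS : MeasurableSet S := measurableSet_chart_symm_preimage p hZ
  have h1 := Besicovitch.ae_tendsto_measure_inter_div volume S
  rw [ae_restrict_iff' hS] at h1
  refine measure_mono_null ?_ h1
  rintro y ⟨hy, hyt⟩ hbad
  simp only [mem_preimage, mem_compl_iff, mem_ofPred_eq, Classical.not_imp] at hy
  refine hy.2 (hasApproxJet_zero C ((chartAt R4 p).map_target hyt) hy.1 ⟨hZ, ?_⟩)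
  rw [(chartAt R4 p).right_inv hyt, inter_comm (chartAt R4 p).target]
  exact hbad ⟨hy.1, hyt⟩

end Jets

section JetOfLifts
variable {X : Type*} [TopologicalSpace X] [ChartedSpace R4 X] [IsManifold (𝓡 4) ∞ X]
  [RiemannianBundle (fun x : X => TangentSpace (𝓡 4) x)]
  [IsContMDiffRiemannianBundle (𝓡 4) ∞ R4 (fun x : X => TangentSpace (𝓡 4) x)]
  {F : Type*} [NormedAddCommGroup F] [InnerProductSpace ℝ F] [FiniteDimensional ℝ F]
  {V : X → Type*} [TopologicalSpace (TotalSpace F V)]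
  [∀ x, NormedAddCommGroup (V x)] [∀ x, InnerProductSpace ℝ (V x)]
  [FiberBundle F V] [VectorBundle ℝ F V]
  [ContMDiffVectorBundle ∞ F V (𝓡 4)] [IsContMDiffRiemannianBundle (𝓡 4) ∞ F V]

variable [MeasurableSpace X] {U : Π x, Sym2 (V x)} (C : CliffordStructure X F V)

open Classical in
variable (U) in
/-- The 1-jet at `x` of the local lifts `u x` of `U`, extended by zero to the zero locus. -/
def liftJet (u : X → Π x, V x) (x : X) : V x × (TangentSpace (𝓡 4) x →L[ℝ] V x) :=
  if x ∈ zeroLocus U then 0 else (u x x, C.conn (u x) x)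

variable {C} {u : X → Π x, V x} {N : X → Set X}

lemma liftJet_of_mem {x : X} (hx : x ∈ zeroLocus U) : liftJet U C u x = 0 := if_pos hx

lemma liftJet_of_notMem {x : X} (hx : x ∉ zeroLocus U) :
    liftJet U C u x = (u x x, C.conn (u x) x) := if_neg hx

/-- Off the zero locus `u` does not vanish, so `u` and `-u` have distinct values and the jet
condition for coinciding values is void. The exceptional null set lies in the zero locus. -/
lemma ae_hasApproxJet_liftJet [SecondCountableTopology X] [BorelSpace X]
    (hZ : MeasurableSet (zeroLocus U)) (hu : ∀ x ∉ zeroLocus U, IsLift F U (u x) (N x) x) :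
    ∀ᵐ x ∂(riemannianVolume X), HasApproxJet C U x s(liftJet U C u x, -liftJet U C u x) := by
  filter_upwards [ae_hasApproxJet_zero C hZ] with x hx
  by_cases h : x ∈ zeroLocus U
  · rw [liftJet_of_mem h]; exact hx h
  · rw [liftJet_of_notMem h]
    refine hasApproxJet_of_lift C (hu x h).diffAt (hu x h).eventually_eq fun h0 => ?_
    refine absurd ?_ h
    rw [← halfNormSq_eq_zero, halfNormSq_eq (hu x h).eventually_eq.self_of_nhds, h0]
    simp

lemma derivNormSq_liftJet_le (hu : ∀ x ∉ zeroLocus U, IsLift F U (u x) (N x) x) (x : X) :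
    ENNReal.ofReal (derivNormSq (liftJet U C u x).2) ≤
      (zeroLocus U)ᶜ.indicator (energyDensity C U) x := by
  by_cases h : x ∈ zeroLocus U
  · simp [liftJet_of_mem h, derivNormSq_zero]
  · rw [liftJet_of_notMem h, indicator_of_mem (show x ∈ (zeroLocus U)ᶜ from h)]
    exact (hu x h).ofReal_derivNormSq_le_energyDensity C

lemma lintegral_gradSq_liftJet_lt_top (hZ : MeasurableSet (zeroLocus U))
    (hu : ∀ x ∉ zeroLocus U, IsLift F U (u x) (N x) x)
    (hfin : ∫⁻ x in (zeroLocus U)ᶜ, energyDensity C U x ∂(riemannianVolume X) < ⊤) :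
    ∫⁻ x, ENNReal.ofReal (gradSq s(liftJet U C u x, -liftJet U C u x)) ∂(riemannianVolume X)
      < ⊤ := by
  calc _ ≤ ∫⁻ x, 2 * (zeroLocus U)ᶜ.indicator (energyDensity C U) x ∂(riemannianVolume X) := by
        refine lintegral_mono fun x => ?_
        dsimp only
        rw [gradSq_mk_neg, ENNReal.ofReal_mul zero_le_two, ENNReal.ofReal_ofNat]
        gcongr
        exact derivNormSq_liftJet_le hu x
    _ = 2 * ∫⁻ x in (zeroLocus U)ᶜ, energyDensity C U x ∂(riemannianVolume X) := by
        rw [lintegral_const_mul' _ _ (by simp), lintegral_indicator hZ.compl]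
    _ < ⊤ := ENNReal.mul_lt_top (by simp) hfin

lemma lintegral_pairNorm_sq_lt_top [T2Space X] [SecondCountableTopology X] [BorelSpace X]
    (hq : Continuous (halfNormSq U)) {Ω : Set X} (hΩ : IsCompact (closure Ω)) :
    ∫⁻ x in Ω, ENNReal.ofReal (pairNorm (U x) ^ 2) ∂(riemannianVolume X) < ⊤ := by
  obtain ⟨M, hM⟩ := hΩ.exists_bound_of_continuousOn hq.continuousOn
  calc _ ≤ ∫⁻ x in closure Ω, ENNReal.ofReal (pairNorm (U x) ^ 2) ∂(riemannianVolume X) :=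
        lintegral_mono_set subset_closure
    _ ≤ ∫⁻ x in closure Ω, ENNReal.ofReal (2 * M) ∂(riemannianVolume X) := by
        refine setLIntegral_mono' isClosed_closure.measurableSet fun x hx => ?_
        refine ENNReal.ofReal_le_ofReal ?_
        have := (le_abs_self _).trans (hM x hx)
        unfold halfNormSq at this
        linarith
    _ < ⊤ := by
        rw [setLIntegral_const]
        exact ENNReal.mul_lt_top ENNReal.ofReal_lt_top (riemannianVolume_lt_top_of_isCompact hΩ)

lemma hasWeakJet_liftJet [T2Space X] [SecondCountableTopology X] [BorelSpace X]
    (hc : ContinuousSection F U) (hu : ∀ x ∉ zeroLocus U, IsLift F U (u x) (N x) x)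
    (hfin : ∫⁻ x in (zeroLocus U)ᶜ, energyDensity C U x ∂(riemannianVolume X) < ⊤)
    {Ω : Set X} (hΩ : IsOpen Ω) :
    HasWeakJet C Ω U (fun x => s(liftJet U C u x, -liftJet U C u x)) := by
  have hl : ∀ x ∉ zeroLocus U, ∃ u N, IsLift F U u N x := fun x hx => ⟨_, _, hu x hx⟩
  exact ⟨locallyW12_of_finite_energy C hc hl hfin hΩ,
    ae_restrict_of_ae (ae_hasApproxJet_liftJet (isClosed_zeroLocus hc hl).measurableSet hu)⟩

end JetOfLifts

/-! ### A small positive function on a possibly noncompact manifold -/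

section SmallFunctions
variable {X : Type*} [TopologicalSpace X] [ChartedSpace R4 X] [IsManifold (𝓡 4) ∞ X]
  [RiemannianBundle (fun x : X => TangentSpace (𝓡 4) x)]
  [IsContMDiffRiemannianBundle (𝓡 4) ∞ R4 (fun x : X => TangentSpace (𝓡 4) x)]
  {F : Type*} [NormedAddCommGroup F] [InnerProductSpace ℝ F] [FiniteDimensional ℝ F]
  {V : X → Type*} [TopologicalSpace (TotalSpace F V)]
  [∀ x, NormedAddCommGroup (V x)] [∀ x, InnerProductSpace ℝ (V x)]
  [FiberBundle F V] [VectorBundle ℝ F V]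
  [ContMDiffVectorBundle ∞ F V (𝓡 4)] [IsContMDiffRiemannianBundle (𝓡 4) ∞ F V]

lemma mvfderiv_eq_zero_of_eventuallyEq_const {f : X → ℝ} {x : X} {c : ℝ}
    (h : ∀ᶠ y in 𝓝 x, f y = c) (e : TangentSpace (𝓡 4) x) : mvfderiv (𝓡 4) f x e = 0 := by
  have h1 : f =ᶠ[𝓝 x] fun _ => c := h
  have h2 : HasMFDerivAt (𝓡 4) 𝓘(ℝ) f x (0 : TangentSpace (𝓡 4) x →L[ℝ] ℝ) :=
    (hasMFDerivAt_const c x).congr_of_eventuallyEq h1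
  exact congrArg (fun L : R4 →L[ℝ] ℝ => L e) h2.mfderiv

/-- The differential of a smooth compactly supported function is bounded. -/
lemma exists_abs_mvfderiv_le_of_hasCompactSupport {f : X → ℝ}
    (hf : ContMDiff (𝓡 4) 𝓘(ℝ) ∞ f) (hc : HasCompactSupport f) :
    ∃ L : ℝ, 0 ≤ L ∧ ∀ x, ∀ e : TangentSpace (𝓡 4) x, |mvfderiv (𝓡 4) f x e| ≤ L * ‖e‖ := by
  choose K hK hKp using fun p : X => eventually_abs_mvfderiv_le (hf p)
  obtain ⟨t, _, ht⟩ := IsCompact.elim_nhds_subcover hc _ fun x _ => hKp x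
  refine ⟨∑ p ∈ t, K p, Finset.sum_nonneg fun p _ => (hK p).le, fun x e => ?_⟩
  by_cases hx : x ∈ tsupport f
  · obtain ⟨p, hp, hxp⟩ := mem_iUnion₂.1 (ht hx)
    refine (hxp e).trans ?_
    gcongr
    exact Finset.single_le_sum (fun p _ => (hK p).le) hp
  · rw [mvfderiv_eq_zero_of_eventuallyEq_const (notMem_tsupport_iff_eventuallyEq.1 hx)]
    simpa using mul_nonneg (Finset.sum_nonneg fun p _ => (hK p).le) (norm_nonneg e)

lemma mvfderiv_sum_smul {ι : Type*} (t : Finset ι) {c : ι → ℝ} {f : ι → X → ℝ} {x : X}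
    (hf : ∀ i, MDifferentiableAt (𝓡 4) 𝓘(ℝ) (f i) x) (e : TangentSpace (𝓡 4) x) :
    MDifferentiableAt (𝓡 4) 𝓘(ℝ) (fun y => ∑ i ∈ t, c i • f i y) x ∧
    mvfderiv (𝓡 4) (fun y => ∑ i ∈ t, c i • f i y) x e
      = ∑ i ∈ t, c i * mvfderiv (𝓡 4) (f i) x e := by
  classical
  induction t using Finset.induction_on with
  | empty =>
    simp only [Finset.sum_empty]
    exact ⟨mdifferentiableAt_const,
      mvfderiv_eq_zero_of_eventuallyEq_const (.of_forall fun _ => rfl) e⟩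
  | insert a t ha ih =>
    have h2 : (fun y => ∑ i ∈ insert a t, c i • f i y)
        = c a • f a + fun y => ∑ i ∈ t, c i • f i y := by
      ext y; simp [Finset.sum_insert ha]
    have h3 : mvfderiv (𝓡 4) (c a • f a) x e = c a * mvfderiv (𝓡 4) (f a) x e :=
      congrArg (fun L : R4 →L[ℝ] ℝ => L e) ((hf a).hasMFDerivAt.const_smul (c a)).mfderiv
    rw [h2, mvfderiv_add ((hf a).const_smul (c a)) ih.1, add_apply, ih.2, h3,
      Finset.sum_insert ha]
    exact ⟨((hf a).const_smul (c a)).add ih.1, rfl⟩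

/-- There are weights that make countably many given quantities summable. -/
lemma exists_summable_weights {ι : Type*} [Countable ι] (B : ι → ℝ) (v : ι → ℝ≥0∞)
    (hB : ∀ i, 1 ≤ B i) (hv : ∀ i, v i < ⊤) :
    ∃ c : ι → ℝ, (∀ i, 0 < c i) ∧ ∑' i, ENNReal.ofReal (c i * B i) ≤ 1 ∧
      ∑' i, ENNReal.ofReal (c i * B i) * v i ≤ 1 := by
  -- The `δ i` are positive with sum less than 1. Dividing by `B i * (1 + v i)` makes both `c i * B
  -- i` and `c i * B i * v i` at most `δ i`.
  obtain ⟨δ, hδ, hsum⟩ := ENNReal.exists_pos_sum_of_countable one_ne_zero ι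
  have hB0 : ∀ i, 0 < B i := fun i => one_pos.trans_le (hB i)
  have hv0 : ∀ i, 0 < 1 + (v i).toReal := fun i => add_pos_of_pos_of_nonneg one_pos
    ENNReal.toReal_nonneg
  have hcB : ∀ i, (δ i : ℝ) / (B i * (1 + (v i).toReal)) * B i = δ i / (1 + (v i).toReal) :=
    fun i => by
      have := (hB0 i).ne'
      have := (hv0 i).ne'
      field_simp
  refine ⟨fun i => δ i / (B i * (1 + (v i).toReal)), fun i => ?_, ?_, ?_⟩
  · exact div_pos (hδ i) (mul_pos (hB0 i) (hv0 i))
  · refine (ENNReal.tsum_le_tsum fun i => ?_).trans hsum.le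
    rw [hcB, ← ENNReal.ofReal_coe_nnreal]
    refine ENNReal.ofReal_le_ofReal (div_le_self (δ i).coe_nonneg ?_)
    linarith [ENNReal.toReal_nonneg (a := v i)]
  · refine (ENNReal.tsum_le_tsum fun i => ?_).trans hsum.le
    have h1 : v i = ENNReal.ofReal (v i).toReal := (ENNReal.ofReal_toReal (hv i).ne).symm
    rw [hcB]
    refine (congrArg (ENNReal.ofReal _ * ·) h1).trans_le ?_
    rw [← ENNReal.ofReal_mul (div_nonneg (δ i).coe_nonneg (hv0 i).le), ← ENNReal.ofReal_coe_nnreal]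
    refine ENNReal.ofReal_le_ofReal ?_
    rw [div_mul_eq_mul_div, div_le_iff₀ (hv0 i)]
    nlinarith [(δ i).coe_nonneg, ENNReal.toReal_nonneg (a := v i)]

/-- There is a smooth positive function which, together with its differential and its product with
the non-metricity of the connection, is dominated by an integrable function with values
in `[0, 1]`. -/
theorem exists_smooth_pos_dominated [T2Space X] [SecondCountableTopology X] [MeasurableSpace X]
    [BorelSpace X] (cov : CovariantDerivative (𝓡 4) F V)
    (hcov : CovariantDerivative.ContMDiffCovariantDerivative cov ∞) :
    ∃ ε m : X → ℝ, ContMDiff (𝓡 4) 𝓘(ℝ) ∞ ε ∧ Measurable m ∧ (∀ x, 0 < ε x) ∧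
      (∀ x, ε x ≤ m x) ∧ (∀ x, m x ≤ 1) ∧
      ∫⁻ x, ENNReal.ofReal (m x) ∂(riemannianVolume X) < ⊤ ∧
      (∀ x, ∀ e : TangentSpace (𝓡 4) x, |mvfderiv (𝓡 4) ε x e| ≤ m x * ‖e‖) ∧
      ∀ x, ∀ u : Π x, V x, DiffAt F u x → ∀ e : TangentSpace (𝓡 4) x,
        ε x * |mvfderiv (𝓡 4) (fun y => (inner ℝ (u y) (u y) : ℝ)) x e
          - 2 * inner ℝ (cov u x e) (u x)| ≤ m x * (‖u x‖ ^ 2 * ‖e‖) := by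
  have : LocallyCompactSpace X := ChartedSpace.locallyCompactSpace R4 X
  choose K hK hKp using fun p : X => eventually_abs_mvfderiv_norm_sq_sub_le (F := F) cov hcov p
  choose W₀ hW₀ hW₀fin using fun p : X => exists_nhds_riemannianVolume_lt_top p
  choose Q hQ hQp using fun p : X => exists_compact_mem_nhds p
  set W : X → Set X := fun p => interior (W₀ p ∩ Q p ∩ {x | ∀ u : Π x, V x, DiffAt F u x →
    ∀ e : TangentSpace (𝓡 4) x, |mvfderiv (𝓡 4) (fun y => (inner ℝ (u y) (u y) : ℝ)) x e
      - 2 * inner ℝ (cov u x e) (u x)| ≤ K p * ‖u x‖ ^ 2 * ‖e‖})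
  have hWn : ∀ p, W p ∈ 𝓝 p := fun p =>
    interior_mem_nhds.2 (inter_mem (inter_mem (hW₀ p) (hQp p)) (hKp p))
  have hWK : ∀ p, ∀ x ∈ W p, _ := fun p x hx => (interior_subset hx).2
  have hWQ : ∀ p, W p ⊆ Q p := fun p x hx => (interior_subset hx).1.2
  have hWv : ∀ p, riemannianVolume X (W p) < ⊤ := fun p =>
    (measure_mono fun x hx => (interior_subset hx).1.1).trans_lt (hW₀fin p)
  obtain ⟨s, hs, hsU⟩ := countable_cover_nhds hWn
  have : Countable s := hs
  obtain ⟨f, hf⟩ := SmoothPartitionOfUnity.exists_isSubordinate (𝓡 4) isClosed_univ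
    (fun i : s => W i) (fun i => isOpen_interior) (by rw [← hsU, biUnion_eq_iUnion])
  have hfs : ∀ i, ContMDiff (𝓡 4) 𝓘(ℝ) ∞ (f i) := fun i => (f i).contMDiff
  have hfc : ∀ i, HasCompactSupport (f i) := fun i =>
    (hQ i).of_isClosed_subset (isClosed_tsupport _) ((hf i).trans (hWQ i))
  have hcf : ∀ (a : ℝ) i, ContMDiff (𝓡 4) 𝓘(ℝ) ∞ (fun x => a • f i x) := fun a i =>
    ContDiff.comp_contMDiff (g := fun t : ℝ => a • t) (by fun_prop) (hfs i)
  choose L hL hLf using fun i => exists_abs_mvfderiv_le_of_hasCompactSupport (hfs i) (hfc i)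
  -- The three summands bound, on `W i`, the function `f i` itself, its differential, and the
  -- failure of the connection to be metric. With `ε = ∑ c i * f i`, a single majorant `m = ∑ c i *
  -- B i * 1_{W i}` then serves all three requirements.
  set B : s → ℝ := fun i => 1 + L i + K i
  have hB : ∀ i, 1 ≤ B i := fun i => by linarith [hL i, hK i]
  obtain ⟨c, hc, hsum, hvsum⟩ := exists_summable_weights B
    (fun i : s => riemannianVolume X (W i)) hB fun i => hWv i
  set m' : X → ℝ≥0∞ := fun x =>
    ∑' i : s, (W i).indicator (fun _ => ENNReal.ofReal (c i * B i)) x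
  have hm' : Measurable m' := Measurable.tsum fun i =>
    measurable_const.indicator isOpen_interior.measurableSet
  have hm'1 : ∀ x, m' x ≤ 1 := fun x =>
    (ENNReal.tsum_le_tsum fun i => indicator_le_self _ _ x).trans hsum
  have hm'top : ∀ x, m' x ≠ ⊤ := fun x => ((hm'1 x).trans_lt ENNReal.one_lt_top).ne
  have key : ∀ x, ∀ t : Finset s, (∀ i ∈ t, x ∈ W i) → ∑ i ∈ t, c i * B i ≤ (m' x).toReal := by
    intro x t ht
    rw [← ENNReal.ofReal_le_iff_le_toReal (hm'top x), ENNReal.ofReal_sum_of_nonneg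
      fun i _ => mul_nonneg (hc i).le (zero_le_one.trans (hB i))]
    refine le_trans (Finset.sum_le_sum fun i hi => ?_) (ENNReal.sum_le_tsum t)
    rw [indicator_of_mem (ht i hi)]
  -- Near `x` only finitely many `f i` are nonzero, and by subordination they can be taken with `x ∈
  -- W i`. So the bounds valid on the `W i` apply at `x` to every term of the finite sum.
  have hloc : ∀ x, ∃ t : Finset s, (∀ i ∈ t, x ∈ W i) ∧
      ∀ᶠ y in 𝓝 x, ∑ᶠ i, c i • f i y = ∑ i ∈ t, c i • f i y := by
    intro x
    obtain ⟨t, n, hn, hnU, hnt⟩ :=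
      f.locallyFinite.exists_finset_nhds_support_subset hf (fun i => isOpen_interior) x
    refine ⟨t, fun i hi => mem_iInter₂.1 (hnU (mem_of_mem_nhds hn)) i hi, ?_⟩
    filter_upwards [hn] with y hy
    refine finsum_eq_sum_of_support_subset _ (Subset.trans (fun i hi => ?_) (hnt y hy))
    exact right_ne_zero_of_mul hi
  refine ⟨fun x => ∑ᶠ i, c i • f i x, fun x => (m' x).toReal, ?_, hm'.ennreal_toReal, ?_, ?_, ?_,
    ?_, ?_, ?_⟩
  · refine contMDiff_finsum (fun i => hcf (c i) i)
      (f.locallyFinite.subset fun i => ?_)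
    exact Function.support_const_smul_subset (c i) (f i)
  · intro x
    obtain ⟨i, hi⟩ := f.exists_pos_of_mem (mem_univ x)
    obtain ⟨t, -, ht⟩ := hloc x
    have hnn : ∀ i, 0 ≤ c i • f i x := fun i => mul_nonneg (hc i).le (f.nonneg i x)
    refine lt_of_lt_of_le (mul_pos (hc i) hi) ?_
    refine single_le_finsum (f := fun i => c i • f i x) i ?_ hnn
    exact (f.locallyFinite.point_finite x).subset fun i hi => right_ne_zero_of_mul hi
  · intro x
    obtain ⟨t, htW, ht⟩ := hloc x
    refine ht.self_of_nhds.trans_le ?_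
    refine le_trans (Finset.sum_le_sum fun i _ => ?_) (key x t htW)
    exact mul_le_mul_of_nonneg_left ((f.le_one i x).trans (hB i)) (hc i).le
  · exact fun x => ENNReal.toReal_le_of_le_ofReal zero_le_one (by simpa using hm'1 x)
  · simp_rw [ENNReal.ofReal_toReal (hm'top _)]
    rw [lintegral_tsum fun i => (measurable_const.indicator
      isOpen_interior.measurableSet).aemeasurable]
    simp_rw [lintegral_indicator isOpen_interior.measurableSet, setLIntegral_const]
    exact hvsum.trans_lt ENNReal.one_lt_top
  · intro x e
    obtain ⟨t, htW, ht⟩ := hloc x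
    have h1 : mvfderiv (𝓡 4) (fun y => ∑ᶠ i, c i • f i y) x e
        = mvfderiv (𝓡 4) (fun y => ∑ i ∈ t, c i • f i y) x e :=
      congrArg (fun L : R4 →L[ℝ] ℝ => L e) (Filter.EventuallyEq.mfderiv_eq ht)
    rw [h1, (mvfderiv_sum_smul t (fun i => (hfs i x).mdifferentiableAt (by simp)) e).2]
    refine (Finset.abs_sum_le_sum_abs _ _).trans ?_
    refine le_trans (Finset.sum_le_sum (g := fun i => c i * B i * ‖e‖) fun i _ => ?_) ?_
    · rw [abs_mul, abs_of_pos (hc i), mul_assoc]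
      refine mul_le_mul_of_nonneg_left ((hLf i x e).trans ?_) (hc i).le
      gcongr
      linarith [hK i]
    · rw [← Finset.sum_mul]
      gcongr
      exact key x t htW
  · intro x u hu e
    obtain ⟨t, htW, ht⟩ := hloc x
    dsimp only
    rw [ht.self_of_nhds, Finset.sum_mul]
    refine le_trans (Finset.sum_le_sum (g := fun i => c i * B i * (‖u x‖ ^ 2 * ‖e‖))
      fun i hi => ?_) ?_
    · have h1 := hWK i x (htW i hi) u hu e
      have h2 : 0 ≤ ‖u x‖ ^ 2 * ‖e‖ := by positivity
      have h3 := f.nonneg i x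
      have h4 := f.le_one i x
      rw [smul_eq_mul]
      calc c i * f i x * _ ≤ c i * 1 * (K i * ‖u x‖ ^ 2 * ‖e‖) := by
            refine mul_le_mul (mul_le_mul_of_nonneg_left h4 (hc i).le) h1 (abs_nonneg _) ?_
            exact mul_nonneg (hc i).le zero_le_one
        _ = c i * K i * (‖u x‖ ^ 2 * ‖e‖) := by ring
        _ ≤ _ := by
            refine mul_le_mul_of_nonneg_right (mul_le_mul_of_nonneg_left ?_ (hc i).le) h2
            linarith [hL i]
    · rw [← Finset.sum_mul]
      exact mul_le_mul_of_nonneg_right (key x t htW) (by positivity)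

end SmallFunctions

/-! ### The cutoff function -/

section Cutoff
/-- A smooth cutoff function vanishing on `(-∞, 1]` and equal to `1` on `[2, ∞)`. -/
def cutoff (t : ℝ) : ℝ := Real.smoothTransition (t - 1)

lemma contDiff_cutoff : ContDiff ℝ ∞ cutoff :=
  Real.smoothTransition.contDiff.comp (contDiff_id.sub contDiff_const)

lemma cutoff_nonneg (t : ℝ) : 0 ≤ cutoff t := Real.smoothTransition.nonneg _

lemma cutoff_le_one (t : ℝ) : cutoff t ≤ 1 := Real.smoothTransition.le_one _

lemma cutoff_of_le_one {t : ℝ} (h : t ≤ 1) : cutoff t = 0 :=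
  Real.smoothTransition.zero_of_nonpos (by linarith)

lemma cutoff_of_two_le {t : ℝ} (h : 2 ≤ t) : cutoff t = 1 :=
  Real.smoothTransition.one_of_one_le (by linarith)

/-- A zero of the nonnegative function `cutoff` is a minimum. This makes the whole jet of a
truncated lift vanish wherever its value does, as an approximate jet requires. -/
lemma deriv_cutoff_of_eq_zero {t : ℝ} (h : cutoff t = 0) : deriv cutoff t = 0 :=
  IsLocalMin.deriv_eq_zero (.of_forall fun s => h.trans_le (cutoff_nonneg s))

lemma deriv_cutoff_of_two_le {t : ℝ} (h : 2 ≤ t) : deriv cutoff t = 0 :=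
  IsLocalMax.deriv_eq_zero (.of_forall fun s => (cutoff_le_one s).trans_eq
    (cutoff_of_two_le h).symm)

lemma exists_abs_deriv_cutoff_le : ∃ C : ℝ, 0 ≤ C ∧ ∀ t, |deriv cutoff t| ≤ C := by
  obtain ⟨C, hC⟩ := (isCompact_Icc (a := (1 : ℝ)) (b := 2)).exists_bound_of_continuousOn
    (contDiff_cutoff.continuous_deriv (by simp)).continuousOn
  have h1 : 0 ≤ C := (norm_nonneg _).trans (hC 1 (by norm_num))
  refine ⟨C, h1, fun t => ?_⟩
  by_cases h : t ∈ Icc (1 : ℝ) 2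
  · exact hC t h
  · rw [mem_Icc, not_and_or, not_le, not_le] at h
    rcases h with h | h
    · rw [deriv_cutoff_of_eq_zero (cutoff_of_le_one h.le)]; simpa using h1
    · rw [deriv_cutoff_of_two_le h.le]; simpa using h1

end Cutoff

/-! ### Truncation by values gives smooth odd sections -/

section Truncation

variable {X : Type*} [TopologicalSpace X] [ChartedSpace R4 X] [IsManifold (𝓡 4) ∞ X]
  [RiemannianBundle (fun x : X => TangentSpace (𝓡 4) x)]
  [IsContMDiffRiemannianBundle (𝓡 4) ∞ R4 (fun x : X => TangentSpace (𝓡 4) x)]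
  {F : Type*} [NormedAddCommGroup F] [InnerProductSpace ℝ F] [FiniteDimensional ℝ F]
  {V : X → Type*} [TopologicalSpace (TotalSpace F V)]
  [∀ x, NormedAddCommGroup (V x)] [∀ x, InnerProductSpace ℝ (V x)]
  [FiberBundle F V] [VectorBundle ℝ F V]
  [ContMDiffVectorBundle ∞ F V (𝓡 4)] [IsContMDiffRiemannianBundle (𝓡 4) ∞ F V]

variable {U : Π x, Sym2 (V x)} {ε : X → ℝ} {s : ℝ}

/-- The ratio `s² |u|² / ε²` that governs the truncation. -/
def truncRatio (U : Π x, Sym2 (V x)) (ε : X → ℝ) (s : ℝ) (x : X) : ℝ :=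
  s ^ 2 * halfNormSq U x / ε x ^ 2

/-- The 2-valued section `U`, cut off where `|u| ≤ ε / s`. -/
def truncation (U : Π x, Sym2 (V x)) (ε : X → ℝ) (s : ℝ) (x : X) : Sym2 (V x) :=
  (U x).map fun v => cutoff (truncRatio U ε s x) • v

lemma truncation_eq_of_pair {x : X} {v : V x} (h : U x = s(v, -v)) :
    truncation U ε s x =
      s(cutoff (truncRatio U ε s x) • v, -(cutoff (truncRatio U ε s x) • v)) := by
  rw [truncation, h, Sym2.map_mk, smul_neg]

lemma continuous_truncRatio (hq : Continuous (halfNormSq U)) (hε : Continuous ε)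
    (hε0 : ∀ x, 0 < ε x) : Continuous (truncRatio U ε s) :=
  (continuous_const.mul hq).div (hε.pow 2) fun x => (pow_pos (hε0 x) 2).ne'

/-- The ratio is continuous and vanishes on the zero locus, so it stays below 1 nearby, where the
cutoff is zero. The form `s(0, -0)` matches the pattern `s(u, -u)` of a lift. -/
lemma eventually_truncation_eq_zero (hq : Continuous (halfNormSq U)) (hε : Continuous ε)
    (hε0 : ∀ x, 0 < ε x) (hl : ∀ x ∉ zeroLocus U, ∃ u N, IsLift F U u N x) {x : X}
    (hx : x ∈ zeroLocus U) : ∀ᶠ y in 𝓝 x, truncation U ε s y = s(0, -0) := by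
  have h0 : truncRatio U ε s x = 0 := by
    rw [truncRatio, halfNormSq_eq_zero.2 hx]; simp
  filter_upwards [(continuous_truncRatio (s := s) hq hε hε0).continuousAt.eventually_lt_const
    (h0.trans_lt one_pos)] with y hy
  by_cases hyZ : y ∈ zeroLocus U
  · rw [truncation, show U y = s(0, 0) from hyZ]; simp
  · obtain ⟨u, N, hu⟩ := hl y hyZ
    rw [truncation_eq_of_pair hu.eventually_eq.self_of_nhds, cutoff_of_le_one hy.le, zero_smul]

lemma IsLift.contMDiffAt_truncRatio {u : Π x, V x} {N : Set X} {x : X} (hu : IsLift F U u N x)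
    (hε : ContMDiff (𝓡 4) 𝓘(ℝ) ∞ ε) (hε0 : ∀ x, 0 < ε x) :
    ContMDiffAt (𝓡 4) 𝓘(ℝ) ∞ (truncRatio U ε s) x := by
  have h : ContDiffAt ℝ ∞ (fun p : ℝ × ℝ => s ^ 2 * p.1 / p.2 ^ 2) (halfNormSq U x, ε x) := by
    refine ContDiffAt.div (by fun_prop) (by fun_prop) (pow_pos (hε0 x) 2).ne'
  exact ContMDiffAt.comp x (g := fun p : ℝ × ℝ => s ^ 2 * p.1 / p.2 ^ 2)
    (f := fun y => (halfNormSq U y, ε y)) h.contMDiffAt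
    (hu.contMDiffAt_halfNormSq.prodMk_space (hε x))

lemma IsLift.smoothOn_truncation {u : Π x, V x} {N : Set X} {x : X} (hu : IsLift F U u N x)
    (hε : ContMDiff (𝓡 4) 𝓘(ℝ) ∞ ε) (hε0 : ∀ x, 0 < ε x) :
    SmoothOn F (fun y => cutoff (truncRatio U ε s y) • u y) N := by
  intro y hy
  have hc : ContMDiffAt (𝓡 4) 𝓘(ℝ) ∞ (fun y => cutoff (truncRatio U ε s y)) y :=
    contDiff_cutoff.contDiffAt.comp_contMDiffAt ((hu.of_mem hy).contMDiffAt_truncRatio hε hε0)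
  exact (hc.smul_section (hu.of_mem hy).contMDiffAt).contMDiffWithinAt

lemma smoothSection_truncation (hq : Continuous (halfNormSq U))
    (hε : ContMDiff (𝓡 4) 𝓘(ℝ) ∞ ε) (hε0 : ∀ x, 0 < ε x)
    (hl : ∀ x ∉ zeroLocus U, ∃ u N, IsLift F U u N x) :
    SmoothSection F (truncation U ε s) := by
  intro x
  by_cases hx : x ∈ zeroLocus U
  · obtain ⟨M, hM, hMo, hxM⟩ := eventually_nhds_iff.1
      (eventually_truncation_eq_zero (s := s) hq hε.continuous hε0 hl hx)
    have h0 : SmoothOn F (0 : Π x, V x) M := (Bundle.contMDiff_zeroSection ℝ V).contMDiffOn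
    exact ⟨0, 0, M, hMo, hxM, h0, h0, fun y hy => by simpa using hM y hy⟩
  · obtain ⟨u, N, hu⟩ := hl x hx
    have h := hu.smoothOn_truncation (s := s) hε hε0
    exact ⟨_, _, N, hu.1, hu.2.1, h, ContMDiffOn.neg_section h, fun y hy =>
      truncation_eq_of_pair (hu.2.2.2 y hy)⟩

lemma oddSection_truncation (hl : ∀ x ∉ zeroLocus U, ∃ u N, IsLift F U u N x) :
    OddSection (truncation U ε s) := by
  intro x
  have : ∃ v : V x, U x = s(v, -v) := by
    by_cases hx : x ∈ zeroLocus U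
    · exact ⟨0, by rw [neg_zero]; exact hx⟩
    · obtain ⟨u, N, hu⟩ := hl x hx
      exact ⟨u x, hu.eventually_eq.self_of_nhds⟩
  obtain ⟨v, hv⟩ := this
  rw [truncation_eq_of_pair hv, Sym2.map_mk, neg_neg, Sym2.eq_swap]

end Truncation

/-! ### Pointwise estimates for the truncated jets -/

section TruncationEstimates
variable {X : Type*} [TopologicalSpace X] [ChartedSpace R4 X] [IsManifold (𝓡 4) ∞ X]
  [RiemannianBundle (fun x : X => TangentSpace (𝓡 4) x)]
  [IsContMDiffRiemannianBundle (𝓡 4) ∞ R4 (fun x : X => TangentSpace (𝓡 4) x)]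
  {F : Type*} [NormedAddCommGroup F] [InnerProductSpace ℝ F] [FiniteDimensional ℝ F]
  {V : X → Type*} [TopologicalSpace (TotalSpace F V)]
  [∀ x, NormedAddCommGroup (V x)] [∀ x, InnerProductSpace ℝ (V x)]
  [FiberBundle F V] [VectorBundle ℝ F V]
  [ContMDiffVectorBundle ∞ F V (𝓡 4)] [IsContMDiffRiemannianBundle (𝓡 4) ∞ F V]

variable {U : Π x, Sym2 (V x)} {ε : X → ℝ} {s : ℝ}

lemma mvfderiv_cutoff_comp {T : X → ℝ} {x : X} (hT : MDifferentiableAt (𝓡 4) 𝓘(ℝ) T x)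
    (e : TangentSpace (𝓡 4) x) :
    MDifferentiableAt (𝓡 4) 𝓘(ℝ) (fun y => cutoff (T y)) x ∧
    mvfderiv (𝓡 4) (fun y => cutoff (T y)) x e = deriv cutoff (T x) * mvfderiv (𝓡 4) T x e := by
  have h1 : HasFDerivAt cutoff (fderiv ℝ cutoff (T x)) (T x) :=
    (contDiff_cutoff.differentiable (by simp) _).hasFDerivAt
  have h2 := h1.hasMFDerivAt.comp x hT.hasMFDerivAt
  refine ⟨h2.mdifferentiableAt, ?_⟩
  have h3 : mvfderiv (𝓡 4) (fun y => cutoff (T y)) x e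
      = fderiv ℝ cutoff (T x) (mvfderiv (𝓡 4) T x e) :=
    congrArg (fun L : R4 →L[ℝ] ℝ => L e) h2.mfderiv
  rw [h3, fderiv_eq_smul_deriv, smul_eq_mul, mul_comm]

/-- This is the derivative of the identity `T ε² = s² |u|²` for the ratio `T`, kept free of
quotients for the estimate that follows. -/
lemma mvfderiv_truncRatio (hε : ContMDiff (𝓡 4) 𝓘(ℝ) ∞ ε) (hε0 : ∀ x, 0 < ε x) {u : Π x, V x}
    {N : Set X} {x : X} (hu : IsLift F U u N x) (e : TangentSpace (𝓡 4) x) :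
    mvfderiv (𝓡 4) (truncRatio U ε s) x e * ε x ^ 2
        + truncRatio U ε s x * (2 * ε x * mvfderiv (𝓡 4) ε x e)
      = s ^ 2 * mvfderiv (𝓡 4) (fun y => (inner ℝ (u y) (u y) : ℝ)) x e := by
  have hT : MDifferentiableAt (𝓡 4) 𝓘(ℝ) (truncRatio U ε s) x :=
    (hu.contMDiffAt_truncRatio hε hε0).mdifferentiableAt (by simp)
  have hd : MDifferentiableAt (𝓡 4) 𝓘(ℝ) ε x := (hε x).mdifferentiableAt (by simp)
  have hi : MDifferentiableAt (𝓡 4) 𝓘(ℝ) (fun y => (inner ℝ (u y) (u y) : ℝ)) x :=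
    (hu.contMDiffAt.inner_bundle hu.contMDiffAt).mdifferentiableAt (by simp)
  have h1 : mvfderiv (𝓡 4) (fun y => truncRatio U ε s y * (ε y * ε y)) x e
      = mvfderiv (𝓡 4) (fun y => s ^ 2 * (inner ℝ (u y) (u y) : ℝ)) x e := by
    have : (fun y => truncRatio U ε s y * (ε y * ε y)) =ᶠ[𝓝 x]
        fun y => s ^ 2 * (inner ℝ (u y) (u y) : ℝ) := by
      filter_upwards [hu.halfNormSq_eventuallyEq] with y hy
      rw [← hy, truncRatio, ← pow_two, div_mul_cancel₀ _ (pow_pos (hε0 y) 2).ne']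
    exact congrArg (fun L : R4 →L[ℝ] ℝ => L e) (Filter.EventuallyEq.mfderiv_eq this)
  have hdd : MDifferentiableAt (𝓡 4) 𝓘(ℝ) (fun y => ε y * ε y) x := hd.mul hd
  rw [mvfderiv_fun_mul hT hdd, mvfderiv_fun_mul hd hd,
    mvfderiv_fun_mul mdifferentiableAt_const hi, mvfderiv_const] at h1
  simp only [add_apply, smul_apply, smul_eq_mul, smul_zero, add_zero] at h1
  rw [← h1]
  ring

/-- Where the truncation acts, the derivative of the cutoff factor times the section is controlled
by the derivative of the section. -/
lemma norm_mul_abs_mvfderiv_truncRatio_le (cov : CovariantDerivative (𝓡 4) F V)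
    (hε : ContMDiff (𝓡 4) 𝓘(ℝ) ∞ ε) (hε0 : ∀ x, 0 < ε x) (hs : 0 < s) {u : Π x, V x}
    {N : Set X} {x : X} {m : ℝ} (hm : 0 ≤ m) (hu : IsLift F U u N x) (e : TangentSpace (𝓡 4) x)
    (h1 : |mvfderiv (𝓡 4) ε x e| ≤ m * ‖e‖)
    (h2 : ε x * |mvfderiv (𝓡 4) (fun y => (inner ℝ (u y) (u y) : ℝ)) x e
          - 2 * inner ℝ (cov u x e) (u x)| ≤ m * (‖u x‖ ^ 2 * ‖e‖))
    (hT : truncRatio U ε s x ≤ 2) :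
    ‖u x‖ * |mvfderiv (𝓡 4) (truncRatio U ε s) x e| ≤ 4 * ‖cov u x e‖ + 12 * (m / s) * ‖e‖ := by
  have key := mvfderiv_truncRatio (s := s) hε hε0 hu e
  have hq : truncRatio U ε s x * ε x ^ 2 = s ^ 2 * ‖u x‖ ^ 2 := by
    rw [truncRatio, halfNormSq_eq hu.eventually_eq.self_of_nhds,
      div_mul_cancel₀ _ (pow_pos (hε0 x) 2).ne']
  set T := truncRatio U ε s x
  set d := mvfderiv (𝓡 4) (truncRatio U ε s) x e
  set dε := mvfderiv (𝓡 4) ε x e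
  set dq := mvfderiv (𝓡 4) (fun y => (inner ℝ (u y) (u y) : ℝ)) x e
  set r := ε x
  have hr : 0 < r := hε0 x
  set a := ‖cov u x e‖
  have ha : 0 ≤ a := norm_nonneg _
  set v := ‖u x‖
  have hv : 0 ≤ v := norm_nonneg _
  set E := ‖e‖
  have hE : 0 ≤ E := norm_nonneg _
  have hT0 : 0 ≤ T := by
    by_contra! h
    nlinarith [mul_neg_of_neg_of_pos h (pow_pos hr 2), mul_nonneg (sq_nonneg s) (sq_nonneg v)]
  -- From `T ≤ 2` one has `s² v² = T r² ≤ 2 r²`; the constant 2 here is a convenient substitute for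
  -- `√2`.
  have hsv : s * v ≤ 2 * r := by
    refine abs_le_of_sq_le_sq' ?_ (by positivity) |>.2
    nlinarith [pow_pos hr 2]
  have h3 : |(inner ℝ (cov u x e) (u x) : ℝ)| ≤ a * v := abs_real_inner_le_norm _ _
  have h4 : r * |dq| ≤ 2 * r * (a * v) + m * (v ^ 2 * E) := by
    have : |dq| ≤ |dq - 2 * inner ℝ (cov u x e) (u x)| + 2 * |(inner ℝ (cov u x e) (u x) : ℝ)| := by
      have := abs_add_le (dq - 2 * inner ℝ (cov u x e) (u x)) (2 * inner ℝ (cov u x e) (u x))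
      rwa [sub_add_cancel, abs_mul 2, abs_two] at this
    nlinarith
  have h5 : |d| * r ^ 2 ≤ s ^ 2 * |dq| + T * (2 * r * (m * E)) := by
    have e1 : d * r ^ 2 = s ^ 2 * dq - T * (2 * r * dε) := by linarith
    have e2 : |d| * r ^ 2 = |s ^ 2 * dq - T * (2 * r * dε)| := by
      rw [← e1, abs_mul, abs_of_pos (pow_pos hr 2)]
    rw [e2]
    refine (abs_sub _ _).trans (add_le_add ?_ ?_)
    · rw [abs_mul, abs_of_nonneg (sq_nonneg s)]
    · rw [abs_mul, abs_mul, abs_of_nonneg hT0, abs_of_pos (by positivity : 0 < 2 * r)]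
      gcongr
  -- The claim is multiplied by `s * r ^ 3` to clear denominators. The inner product in `dq`
  -- contributes `4 * a`, by `s² v² ≤ 2 r²`. The failure of metricity contributes 4 and the
  -- differential of `ε` contributes 8 to the constant 12, both through `s v ≤ 2 r`.
  have h6 : s * (v * |d|) * r ^ 3 ≤ s * (4 * a + 12 * (m / s) * E) * r ^ 3 := by
    have e1 : s * (4 * a + 12 * (m / s) * E) = 4 * (s * a) + 12 * m * E := by field_simp
    rw [e1]
    have e2 : s * (v * |d|) * r ^ 3 = (s * v * r) * (|d| * r ^ 2) := by ring
    have e3 : (s * v * r) * (|d| * r ^ 2) ≤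
        (s * v * r) * (s ^ 2 * |dq| + T * (2 * r * (m * E))) := by gcongr
    have e4 : (s * v * r) * (s ^ 2 * |dq| + T * (2 * r * (m * E)))
        = s ^ 3 * v * (r * |dq|) + 2 * (s * v) * T * r ^ 2 * (m * E) := by ring
    have e5 : s ^ 3 * v * (r * |dq|) ≤ s ^ 3 * v * (2 * r * (a * v) + m * (v ^ 2 * E)) := by
      gcongr
    have e6 : s ^ 3 * v * (2 * r * (a * v) + m * (v ^ 2 * E))
        = 2 * s * a * r * (s ^ 2 * v ^ 2) + (s * v) * (s ^ 2 * v ^ 2) * (m * E) := by ring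
    have e7 : s ^ 2 * v ^ 2 ≤ 2 * r ^ 2 := by
      rw [← hq]; gcongr
    have e8 : 2 * s * a * r * (s ^ 2 * v ^ 2) ≤ 2 * s * a * r * (2 * r ^ 2) := by gcongr
    have e9 : (s * v) * (s ^ 2 * v ^ 2) * (m * E) ≤ (2 * r) * (2 * r ^ 2) * (m * E) := by gcongr
    have e10 : 2 * (s * v) * T * r ^ 2 * (m * E) ≤ 2 * (2 * r) * 2 * r ^ 2 * (m * E) := by gcongr
    rw [e2]
    nlinarith
  have h7 := le_of_mul_le_mul_right h6 (pow_pos hr 3)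
  exact le_of_mul_le_mul_left h7 hs

/-- The jet of the truncated section is close to the jet of the section. -/
lemma exists_jetSq_truncation_sub_le (cov : CovariantDerivative (𝓡 4) F V)
    (hε : ContMDiff (𝓡 4) 𝓘(ℝ) ∞ ε) (hε0 : ∀ x, 0 < ε x) {m : X → ℝ} (hεm : ∀ x, ε x ≤ m x)
    (hm1 : ∀ x, m x ≤ 1)
    (h1 : ∀ x, ∀ e : TangentSpace (𝓡 4) x, |mvfderiv (𝓡 4) ε x e| ≤ m x * ‖e‖)
    (h2 : ∀ x, ∀ u : Π x, V x, DiffAt F u x → ∀ e : TangentSpace (𝓡 4) x,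
      ε x * |mvfderiv (𝓡 4) (fun y => (inner ℝ (u y) (u y) : ℝ)) x e
          - 2 * inner ℝ (cov u x e) (u x)| ≤ m x * (‖u x‖ ^ 2 * ‖e‖)) :
    ∃ A B : ℝ, 0 ≤ A ∧ 0 ≤ B ∧ ∀ s : ℝ, 0 < s → ∀ (u : Π x, V x) (N : Set X) (x : X),
      IsLift F U u N x →
      jetSq ((cutoff (truncRatio U ε s x) • u x,
          cov (fun y => cutoff (truncRatio U ε s y) • u y) x) - (u x, cov u x)) ≤
        if truncRatio U ε s x < 2 then A * derivNormSq (cov u x) + B / s ^ 2 * m x else 0 := by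
  obtain ⟨C₀, hC₀, hC⟩ := exists_abs_deriv_cutoff_le
  -- The derivative of the difference is at most `(1 + 4 C₀) |∇u| + 12 C₀ m / s`, and
  -- `derivNormSq_le_of_norm_le` squares this. The extra 2 in `B` bounds the values: `|u|² ≤ 2 ε² /
  -- s² ≤ 2 m / s²`. Both error terms use `m² ≤ m`.
  refine ⟨2 * (1 + C₀ * 4) ^ 2, 8 * (C₀ * 12) ^ 2 + 2, by positivity, by positivity,
    fun s hs u N x hu => ?_⟩
  have hm : 0 ≤ m x := (hε0 x).le.trans (hεm x)
  have hT : MDifferentiableAt (𝓡 4) 𝓘(ℝ) (truncRatio U ε s) x :=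
    (hu.contMDiffAt_truncRatio hε hε0).mdifferentiableAt (by simp)
  have hdiff : ∀ e : TangentSpace (𝓡 4) x,
      (cov (fun y => cutoff (truncRatio U ε s y) • u y) x - cov u x) e
        = (cutoff (truncRatio U ε s x) - 1) • cov u x e
          + (deriv cutoff (truncRatio U ε s x) * mvfderiv (𝓡 4) (truncRatio U ε s) x e) • u x := by
    intro e
    obtain ⟨hd, he⟩ := mvfderiv_cutoff_comp hT e
    rw [sub_apply, cov_smul_apply cov hu.diffAt hd, he, sub_smul, one_smul]
    abel
  split_ifs with h
  · have hq : truncRatio U ε s x * ε x ^ 2 = s ^ 2 * ‖u x‖ ^ 2 := by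
      rw [truncRatio, halfNormSq_eq hu.eventually_eq.self_of_nhds,
        div_mul_cancel₀ _ (pow_pos (hε0 x) 2).ne']
    have hc0 := cutoff_nonneg (truncRatio U ε s x)
    have hc1 := cutoff_le_one (truncRatio U ε s x)
    have hcabs : |cutoff (truncRatio U ε s x) - 1| ≤ 1 := by rw [abs_le]; constructor <;> linarith
    have hmsq : m x ^ 2 ≤ m x := by nlinarith [hm1 x]
    have hD : derivNormSq (cov (fun y => cutoff (truncRatio U ε s y) • u y) x - cov u x) ≤
        2 * (1 + C₀ * 4) ^ 2 * derivNormSq (cov u x) + 8 * (C₀ * 12 * (m x / s)) ^ 2 := by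
      refine derivNormSq_le_of_norm_le fun e => ?_
      rw [hdiff e]
      have hb := norm_mul_abs_mvfderiv_truncRatio_le cov hε hε0 hs hm hu e (h1 x e)
        (h2 x u hu.diffAt e) h.le
      calc _ ≤ |cutoff (truncRatio U ε s x) - 1| * ‖cov u x e‖
            + |deriv cutoff (truncRatio U ε s x)|
              * (‖u x‖ * |mvfderiv (𝓡 4) (truncRatio U ε s) x e|) := by
            refine (norm_add_le _ _).trans_eq ?_
            rw [norm_smul, norm_smul, Real.norm_eq_abs, Real.norm_eq_abs, abs_mul]
            ring
        _ ≤ 1 * ‖cov u x e‖ + C₀ * (4 * ‖cov u x e‖ + 12 * (m x / s) * ‖e‖) := by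
            gcongr
            exact hC _
        _ = _ := by ring
    have hV : ‖cutoff (truncRatio U ε s x) • u x - u x‖ ^ 2 ≤ 2 / s ^ 2 * m x := by
      have e1 : cutoff (truncRatio U ε s x) • u x - u x
          = (cutoff (truncRatio U ε s x) - 1) • u x := by rw [sub_smul, one_smul]
      rw [e1, norm_smul, Real.norm_eq_abs]
      have e2 : (|cutoff (truncRatio U ε s x) - 1| * ‖u x‖) ^ 2 ≤ (1 * ‖u x‖) ^ 2 := by gcongr
      refine e2.trans ?_
      rw [one_mul, div_mul_eq_mul_div, le_div_iff₀ (by positivity), mul_comm, ← hq]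
      have e3 : ε x ^ 2 ≤ m x ^ 2 := by
        have := (hε0 x).le
        gcongr
        exact hεm x
      nlinarith [pow_pos (hε0 x) 2]
    have hB : 8 * (C₀ * 12 * (m x / s)) ^ 2 ≤ 8 * (C₀ * 12) ^ 2 / s ^ 2 * m x := by
      have : 8 * (C₀ * 12 * (m x / s)) ^ 2 = 8 * (C₀ * 12) ^ 2 / s ^ 2 * m x ^ 2 := by
        field_simp
      rw [this]
      gcongr
    rw [Prod.mk_sub_mk, jetSq]
    dsimp only
    refine (add_le_add hV (hD.trans (add_le_add_right hB _))).trans_eq ?_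
    ring
  · have h := not_lt.1 h
    have hz : cov (fun y => cutoff (truncRatio U ε s y) • u y) x - cov u x = 0 := by
      ext e
      rw [hdiff, cutoff_of_two_le h, deriv_cutoff_of_two_le h]
      simp
    rw [Prod.mk_sub_mk, hz, cutoff_of_two_le h, one_smul, sub_self, jetSq]
    simp [derivNormSq_zero]

end TruncationEstimates

/-! ### Strong convergence of the truncations -/

section TruncationJets
variable {X : Type*} [TopologicalSpace X] [ChartedSpace R4 X] [IsManifold (𝓡 4) ∞ X]
  [RiemannianBundle (fun x : X => TangentSpace (𝓡 4) x)]
  [IsContMDiffRiemannianBundle (𝓡 4) ∞ R4 (fun x : X => TangentSpace (𝓡 4) x)]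
  {F : Type*} [NormedAddCommGroup F] [InnerProductSpace ℝ F] [FiniteDimensional ℝ F]
  {V : X → Type*} [TopologicalSpace (TotalSpace F V)]
  [∀ x, NormedAddCommGroup (V x)] [∀ x, InnerProductSpace ℝ (V x)]
  [FiberBundle F V] [VectorBundle ℝ F V]
  [ContMDiffVectorBundle ∞ F V (𝓡 4)] [IsContMDiffRiemannianBundle (𝓡 4) ∞ F V]

variable [MeasurableSpace X] {U : Π x, Sym2 (V x)} {ε : X → ℝ} {C : CliffordStructure X F V}
  {u : X → Π x, V x} {N : X → Set X}

open Classical in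
variable (C U) in
/-- The 1-jet of the local lifts of the truncation of `U`. -/
def truncationJet (ε : X → ℝ) (u : X → Π x, V x) (s : ℝ) (x : X) :
    V x × (TangentSpace (𝓡 4) x →L[ℝ] V x) :=
  if x ∈ zeroLocus U then 0 else (cutoff (truncRatio U ε s x) • u x x,
    C.conn (fun y => cutoff (truncRatio U ε s y) • u x y) x)

lemma hasApproxJet_truncation (hq : Continuous (halfNormSq U))
    (hε : ContMDiff (𝓡 4) 𝓘(ℝ) ∞ ε) (hε0 : ∀ x, 0 < ε x)
    (hu : ∀ x ∉ zeroLocus U, IsLift F U (u x) (N x) x) (s : ℝ) (x : X) :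
    HasApproxJet C (truncation U ε s) x
      s(truncationJet U C ε u s x, -truncationJet U C ε u s x) := by
  have hl : ∀ x ∉ zeroLocus U, ∃ u N, IsLift F U u N x := fun x hx => ⟨_, _, hu x hx⟩
  by_cases hx : x ∈ zeroLocus U
  · have h0 : DiffAt F (0 : Π x, V x) x :=
      ((Bundle.contMDiff_zeroSection ℝ V (n := 1)) x).mdifferentiableAt (by simp)
    have hc : C.conn (0 : Π x, V x) x = 0 := by rw [C.conn.zero]; rfl
    have := hasApproxJet_of_lift C h0
      (eventually_truncation_eq_zero (s := s) hq hε.continuous hε0 hl hx) fun _ => hc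
    rw [hc] at this
    rw [truncationJet, if_pos hx]
    exact this
  · have hux := hu x hx
    rw [truncationJet, if_neg hx]
    have hT : MDifferentiableAt (𝓡 4) 𝓘(ℝ) (truncRatio U ε s) x :=
      (hux.contMDiffAt_truncRatio hε hε0).mdifferentiableAt (by simp)
    refine hasApproxJet_of_lift C (u := fun y => cutoff (truncRatio U ε s y) • u x y)
      ((hux.smoothOn_truncation hε hε0).diffAt (hux.1.mem_nhds hux.2.1)) ?_ fun h0 => ?_
    · filter_upwards [hux.eventually_eq] with y hy using truncation_eq_of_pair hy
    -- Off the zero locus the truncated lift can vanish only through the cutoff, whose derivative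
    -- then vanishes too, so the covariant derivative is zero as required.
    · have hu0 : u x x ≠ 0 := fun h => hx <| by
        rw [← halfNormSq_eq_zero, halfNormSq_eq hux.eventually_eq.self_of_nhds, h]
        simp
      have hc0 := (smul_eq_zero.1 h0).resolve_right hu0
      ext e
      obtain ⟨hd, he⟩ := mvfderiv_cutoff_comp hT e
      rw [cov_smul_apply C.conn hux.diffAt hd, he, hc0, deriv_cutoff_of_eq_zero hc0]
      simp

/-- The energy of `U` on the region that the truncations modify tends to zero. -/
lemma tendsto_setLIntegral_energyDensity [BorelSpace X] (hq : Continuous (halfNormSq U))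
    (hε : Continuous ε) (hε0 : ∀ x, 0 < ε x) (hZ : MeasurableSet (zeroLocus U))
    (hfin : ∫⁻ x in (zeroLocus U)ᶜ, energyDensity C U x ∂(riemannianVolume X) < ⊤) :
    Tendsto (fun n : ℕ => ∫⁻ x in (zeroLocus U)ᶜ ∩ {x | truncRatio U ε (n + 1) x < 2},
      energyDensity C U x ∂(riemannianVolume X)) atTop (𝓝 0) := by
  set S : ℕ → Set X := fun n => (zeroLocus U)ᶜ ∩ {x | truncRatio U ε (n + 1) x < 2}
  have hS : ∀ n, MeasurableSet (S n) := fun n => hZ.compl.inter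
    (isOpen_lt (continuous_truncRatio hq hε hε0) continuous_const).measurableSet
  -- Viewing the energy as a measure reduces the claim to continuity from above along the decreasing
  -- sets `S n`; on measurable sets this works without measurability of the density.
  set ν := (riemannianVolume X).withDensity (energyDensity C U)
  have hν : ∀ n, ∫⁻ x in S n, energyDensity C U x ∂(riemannianVolume X) = ν (S n) := fun n =>
    (withDensity_apply _ (hS n)).symm
  have hanti : Antitone S := by
    intro n k hnk x hx
    have hx2 : truncRatio U ε (k + 1) x < 2 := hx.2
    refine ⟨hx.1, show truncRatio U ε (n + 1) x < 2 from lt_of_le_of_lt ?_ hx2⟩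
    have h1 : (n : ℝ) ≤ k := Nat.cast_le.2 hnk
    have h2 := halfNormSq_nonneg (U := U) x
    unfold truncRatio
    gcongr
  -- Off the zero locus `|u|²` and `ε²` are fixed positive numbers, so the ratio exceeds 2 once `n`
  -- is large. Removing the zero locus is essential here.
  have hempty : ⋂ n, S n = ∅ := by
    refine eq_empty_of_forall_notMem fun x hx => ?_
    rw [mem_iInter] at hx
    have hpos := halfNormSq_pos (hx 0).1
    have he := pow_pos (hε0 x) 2
    obtain ⟨n, hn⟩ := exists_nat_gt (2 * ε x ^ 2 / halfNormSq U x)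
    have h1 : ((n : ℝ) + 1) ^ 2 * halfNormSq U x / ε x ^ 2 < 2 := (hx n).2
    rw [div_lt_iff₀ hpos] at hn
    rw [div_lt_iff₀ he] at h1
    have h2 : (n : ℝ) ≤ ((n : ℝ) + 1) ^ 2 := by nlinarith [(Nat.cast_nonneg n : (0 : ℝ) ≤ n)]
    nlinarith
  refine Tendsto.congr (fun n => (hν n).symm) ?_
  have := tendsto_measure_iInter_atTop (μ := ν) (fun n => (hS n).nullMeasurableSet) hanti
    ⟨0, by
      rw [← hν]
      exact ((lintegral_mono_set inter_subset_left).trans_lt hfin).ne⟩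
  rwa [hempty, measure_empty] at this

/-- The jets of the truncations converge to the jet of `U`. -/
lemma tendsto_lintegral_jetSq_truncationJet [T2Space X] [SecondCountableTopology X] [BorelSpace X]
    (hq : Continuous (halfNormSq U)) (hε : ContMDiff (𝓡 4) 𝓘(ℝ) ∞ ε) (hε0 : ∀ x, 0 < ε x)
    {m : X → ℝ} (hm : Measurable m) (hεm : ∀ x, ε x ≤ m x) (hm1 : ∀ x, m x ≤ 1)
    (hmint : ∫⁻ x, ENNReal.ofReal (m x) ∂(riemannianVolume X) < ⊤)
    (h1 : ∀ x, ∀ e : TangentSpace (𝓡 4) x, |mvfderiv (𝓡 4) ε x e| ≤ m x * ‖e‖)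
    (h2 : ∀ x, ∀ u : Π x, V x, DiffAt F u x → ∀ e : TangentSpace (𝓡 4) x,
      ε x * |mvfderiv (𝓡 4) (fun y => (inner ℝ (u y) (u y) : ℝ)) x e
          - 2 * inner ℝ (C.conn u x e) (u x)| ≤ m x * (‖u x‖ ^ 2 * ‖e‖))
    (hZ : MeasurableSet (zeroLocus U)) (hu : ∀ x ∉ zeroLocus U, IsLift F U (u x) (N x) x)
    (hfin : ∫⁻ x in (zeroLocus U)ᶜ, energyDensity C U x ∂(riemannianVolume X) < ⊤) :
    Tendsto (fun n : ℕ => ∫⁻ x, ENNReal.ofReal (pairDistSq jetSq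
      s(truncationJet U C ε u (n + 1) x, -truncationJet U C ε u (n + 1) x)
      s(liftJet U C u x, -liftJet U C u x)) ∂(riemannianVolume X)) atTop (𝓝 0) := by
  obtain ⟨A, B, hA, hB, hAB⟩ := exists_jetSq_truncation_sub_le C.conn hε hε0 hεm hm1 h1 h2
  set S : ℕ → Set X := fun n => (zeroLocus U)ᶜ ∩ {x | truncRatio U ε (n + 1) x < 2}
  have hS : ∀ n, MeasurableSet (S n) := fun n => hZ.compl.inter
    (isOpen_lt (continuous_truncRatio hq hε.continuous hε0) continuous_const).measurableSet
  have hbound : ∀ (n : ℕ) (x : X), ENNReal.ofReal (pairDistSq jetSq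
      s(truncationJet U C ε u (n + 1) x, -truncationJet U C ε u (n + 1) x)
      s(liftJet U C u x, -liftJet U C u x)) ≤
      ENNReal.ofReal (2 * A) * (S n).indicator (energyDensity C U) x
        + ENNReal.ofReal (2 * B / (n + 1) ^ 2) * ENNReal.ofReal (m x) := by
    intro n x
    have hm0 : 0 ≤ m x := (hε0 x).le.trans (hεm x)
    refine (ENNReal.ofReal_le_ofReal (pairDistSq_jetSq_mk_neg_le _ _)).trans ?_
    by_cases hx : x ∈ zeroLocus U
    · rw [truncationJet, if_pos hx, liftJet_of_mem hx, sub_zero]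
      simp [jetSq, derivNormSq_zero]
    · rw [truncationJet, if_neg hx, liftJet_of_notMem hx]
      have h := hAB (n + 1) (by positivity) _ _ x (hu x hx)
      refine (ENNReal.ofReal_le_ofReal (mul_le_mul_of_nonneg_left h zero_le_two)).trans ?_
      split_ifs with ht
      · have hxS : x ∈ S n := ⟨hx, ht⟩
        have hd : 0 ≤ derivNormSq (C.conn (u x) x) := derivNormSq_nonneg _
        rw [indicator_of_mem hxS, mul_add, ENNReal.ofReal_add (by positivity) (by positivity),
          ← mul_assoc, ENNReal.ofReal_mul (by positivity), ← mul_assoc, ← mul_div_assoc,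
          ENNReal.ofReal_mul (p := 2 * B / ((n : ℝ) + 1) ^ 2) (by positivity)]
        gcongr
        exact (hu x hx).ofReal_derivNormSq_le_energyDensity C
      · simp
  -- The first term tends to zero because the modified regions shrink to nothing, the second because
  -- of the factor `1 / (n + 1)²` in front of the finite integral of `m`.
  have hlim : Tendsto (fun n : ℕ => ENNReal.ofReal (2 * A) *
      (∫⁻ x in S n, energyDensity C U x ∂(riemannianVolume X))
      + ENNReal.ofReal (2 * B / (n + 1) ^ 2)
        * ∫⁻ x, ENNReal.ofReal (m x) ∂(riemannianVolume X)) atTop (𝓝 0) := by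
    have l1 := ENNReal.Tendsto.const_mul (a := ENNReal.ofReal (2 * A))
      (tendsto_setLIntegral_energyDensity hq hε.continuous hε0 hZ hfin)
      (Or.inr ENNReal.ofReal_ne_top)
    have l2 : Tendsto (fun n : ℕ => 2 * B / ((n : ℝ) + 1) ^ 2) atTop (𝓝 0) := by
      refine tendsto_const_nhds.div_atTop ?_
      exact (tendsto_pow_atTop two_ne_zero).comp
        (tendsto_atTop_add_const_right _ _ tendsto_natCast_atTop_atTop)
    have l3 := ENNReal.Tendsto.mul_const (b := ∫⁻ x, ENNReal.ofReal (m x) ∂(riemannianVolume X))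
      (ENNReal.tendsto_ofReal l2) (Or.inr hmint.ne)
    simpa using l1.add l3
  refine tendsto_of_tendsto_of_tendsto_of_le_of_le tendsto_const_nhds hlim
    (fun _ => zero_le) fun n => ?_
  refine (lintegral_mono (hbound n)).trans_eq ?_
  rw [lintegral_add_right _ (hm.ennreal_ofReal.const_mul _),
    lintegral_const_mul' _ _ ENNReal.ofReal_ne_top, lintegral_const_mul' _ _ ENNReal.ofReal_ne_top,
    lintegral_indicator (hS n)]

end TruncationJets

end ZTwoSpinor

end

/-! ### Assembly of the three assertions -/

theorem lemma2p1
    {X : Type*} [TopologicalSpace X] [T2Space X] [SecondCountableTopology X]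
    [MeasurableSpace X] [BorelSpace X]
    [ChartedSpace ZTwoSpinor.R4 X] [IsManifold (𝓡 4) ∞ X]
    [RiemannianBundle (fun x : X => TangentSpace (𝓡 4) x)]
    [IsContMDiffRiemannianBundle (𝓡 4) ∞ ZTwoSpinor.R4 (fun x : X => TangentSpace (𝓡 4) x)]
    {F : Type*} [NormedAddCommGroup F] [InnerProductSpace ℝ F] [FiniteDimensional ℝ F]
    {V : X → Type*} [TopologicalSpace (TotalSpace F V)]
    [∀ x, NormedAddCommGroup (V x)] [∀ x, InnerProductSpace ℝ (V x)]
    [FiberBundle F V] [VectorBundle ℝ F V]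
    [ContMDiffVectorBundle ∞ F V (𝓡 4)] [IsContMDiffRiemannianBundle (𝓡 4) ∞ F V]
    (C : ZTwoSpinor.CliffordStructure X F V)
    (U : Π x, Sym2 (V x)) (hU : ZTwoSpinor.IsZTwoHarmonicSpinor C U) :
    -- `U` is in `W^{1,2}(Ω, A_2)` if `|U|` is square integrable on `Ω` or `Ω` is relatively compact
    (∀ Ω : Set X, IsOpen Ω →
      (∫⁻ x in Ω, ENNReal.ofReal (ZTwoSpinor.pairNorm (U x) ^ 2)
          ∂(ZTwoSpinor.riemannianVolume X) < ⊤ ∨ IsCompact (closure Ω)) →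
      ZTwoSpinor.MemW12 C Ω U) ∧
    -- the distributional derivative is square integrable on `X`, and `D(U) = 0`
    (∃ J : Π x, Sym2 (V x × (TangentSpace (𝓡 4) x →L[ℝ] V x)),
      ZTwoSpinor.HasWeakJet C univ U J ∧
      ∫⁻ x, ENNReal.ofReal (ZTwoSpinor.gradSq (J x)) ∂(ZTwoSpinor.riemannianVolume X) < ⊤ ∧
      ∀ᵐ x ∂(ZTwoSpinor.riemannianVolume X),
        (J x).map (fun w => ZTwoSpinor.dirac C w.2) = s(0, 0)) ∧
    -- `U` is a strong limit of smooth odd 2-valued sections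
    (∃ Un : ℕ → Π x, Sym2 (V x),
      (∀ n, ZTwoSpinor.SmoothSection F (Un n) ∧ ZTwoSpinor.OddSection (Un n)) ∧
      ZTwoSpinor.TendstoW12 C Un U) := by
  have hc := hU.continuousSection
  choose! u N hu using hU.exists_lift
  have hlift : ∀ x ∉ ZTwoSpinor.zeroLocus U, ZTwoSpinor.IsLift F U (u x) (N x) x :=
    fun x hx => (hu x hx).1
  have hl : ∀ x ∉ ZTwoSpinor.zeroLocus U, ∃ u N, ZTwoSpinor.IsLift F U u N x :=
    fun x hx => ⟨_, _, hlift x hx⟩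
  have hq := ZTwoSpinor.continuous_halfNormSq hc hl
  have hZ := (ZTwoSpinor.isClosed_zeroLocus hc hl).measurableSet
  have hgrad := ZTwoSpinor.lintegral_gradSq_liftJet_lt_top hZ hlift hU.finite_energy
  have hjet := fun {Ω : Set X} (hΩ : IsOpen Ω) =>
    ZTwoSpinor.hasWeakJet_liftJet hc hlift hU.finite_energy hΩ
  -- The same jet, that of the chosen lifts extended by zero, serves on every `Ω`; its gradient is
  -- already square integrable on all of `X`.
  refine ⟨fun Ω hΩ h => ⟨?_, _, hjet hΩ, (setLIntegral_le_lintegral _ _).trans_lt hgrad⟩,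
    ⟨_, hjet isOpen_univ, hgrad, .of_forall fun x => ?_⟩, ?_⟩
  · exact h.elim id (ZTwoSpinor.lintegral_pairNorm_sq_lt_top hq)
  -- For this representative of the jet the equation holds at every point: by the equation for the
  -- lifts off the zero locus, and trivially on it.
  · have : ZTwoSpinor.dirac C (ZTwoSpinor.liftJet U C u x).2 = 0 := by
      by_cases hx : x ∈ ZTwoSpinor.zeroLocus U
      · rw [ZTwoSpinor.liftJet_of_mem hx]
        exact ZTwoSpinor.dirac_zero C
      · rw [ZTwoSpinor.liftJet_of_notMem hx]
        exact (hu x hx).2 x (hlift x hx).2.1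
    rw [Sym2.map_mk, Prod.snd_neg, ZTwoSpinor.dirac_neg, this, neg_zero]
  · obtain ⟨ε, m, hε, hm, hε0, hεm, hm1, hmint, h1, h2⟩ :=
      ZTwoSpinor.exists_smooth_pos_dominated C.conn C.smooth_conn
    have hsmooth := fun n : ℕ =>
      ZTwoSpinor.smoothSection_truncation (s := (n : ℝ) + 1) hq hε hε0 hl
    -- The parameter `n + 1` rather than `n` keeps the truncation scale positive.
    exact ⟨fun n => ZTwoSpinor.truncation U ε (n + 1),
      fun n => ⟨hsmooth n, ZTwoSpinor.oddSection_truncation hl⟩,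
      fun n x => s(ZTwoSpinor.truncationJet U C ε u (n + 1) x,
        -ZTwoSpinor.truncationJet U C ε u (n + 1) x),
      fun x => s(ZTwoSpinor.liftJet U C u x, -ZTwoSpinor.liftJet U C u x),
      fun n => ⟨(hsmooth n).locallyW12, .of_forall fun x =>
        ZTwoSpinor.hasApproxJet_truncation hq hε hε0 hlift _ x⟩,
      hjet isOpen_univ,
      ZTwoSpinor.tendsto_lintegral_jetSq_truncationJet hq hε hε0 hm hεm hm1 hmint h1 h2 hZ hlift
        hU.finite_energy⟩
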